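/- Write $(a;q)_\infty=\prod_{i\ge 0}(1-aq^i)$ and $\delta_q=q\,\frac{d}{dq}$. Define the formal power series in $q$ with coefficients Laurent polynomials in $z$ $$C1(z,q)=\frac{(q^2;q^4)_\infty(q;q)_\infty}{(zq;q)_\infty(z^{-1}q;q)_\infty},\qquad C2(z,q)=\frac{(-q;q^2)_\infty(q^2;q^2)_\infty}{(zq^2;q^2)_\infty(z^{-1}q^2;q^2)_\infty},\qquad C4(z,q)=\frac{(q^4;q^4)_\infty}{(q;q^2)_\infty(zq^4;q^4)_\infty(z^{-1}q^4;q^4)_\infty},$$ and for $X\in\{C1,C2,C4\}$ let $X_k(q)=\sum_{n\ge0}\big(\sum_{m\in\mathbb Z}m^k\,[z^mq^n]X(z,q)\big)q^n$. Let $N2(m,n)$ be the number of partitions $\pi$ of $n$ without repeated odd parts whose $M_2$-rank $\lceil l(\pi)/2\rceil-\#(\pi)$ equals $m$, where $l(\pi)$ is the largest part of $\pi$ ($0$ for the empty partition) and $\#(\pi)$ is the number of parts, and let $R2_k(q)=\sum_{n\ge0}\big(\sum_{m\in\mathbb Z}m^kN2(m,n)\big)q^n$. Let $E_2(q)=1-24\sum_{n\ge1}\sigma_1(n)q^n$,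 and let $\mathcal W_N(\Gamma_0(4))$ be the complex vector space of quasimodular forms on $\Gamma_0(4)$ of weight at most $2N$ with zero constant term, viewed as $q$-series: that is, the $q$-series with zero constant term that are polynomials in $E_2(q)$ and $q$-expansions at infinity of holomorphic modular forms of non-negative weight on $\Gamma_0(4)$ (with trivial character), each monomial having total weight at most $2N$ ($E_2$ counted with weight $2$). **Theorem.** For every integer $N\ge1$, the following are elements of $\frac{(-q;q^2)_\infty}{(q^2;q^2)_\infty}\cdot\mathcal W_N(\Gamma_0(4))$: 1. the functions $\delta_q^m(C1_{2j})$ for $m\ge0$, $1\le j\le N$, $j+m\le N$; 2. the functions $\delta_q^m(C2_{2j})$ for $m\ge0$, $1\le j\le N$, $j+m\le N$; 3. the functions $\delta_q^m(C4_{2j})$ for $m\ge0$, $1\le j\le N$, $j+m\le N$; 4. the function $$(a^2-3a+2)R2_a+\sum_{k=1}^{a/2-1}\binom{a}{2k}\left(2^{2k+1}-4\right)\delta_qR2_{a-2k}+\sum_{k=1}^{a/2-1}\left(2\binom{a}{2k}-2^{2k+1}\binom{a}{2k+1}+\left(2^{2k+2}-2\right)\binom{a}{2k+2}\right)R2_{a-2k},$$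 where $a=2N$. -/

import Mathlib

open scoped PowerSeries LaurentPolynomial MatrixGroups

noncomputable section

namespace M2Crank

/-! ### Formal infinite products -/

/-- Partial product `∏_{i < n} (1 - a q ^ (d + c i))` in the variable `q = PowerSeries.X`. -/
def qPochPartial {R : Type*} [CommRing R] (a : R) (d c n : ℕ) : R⟦X⟧ :=
  ∏ i ∈ Finset.range n, (1 - PowerSeries.C a * PowerSeries.X ^ (d + c * i))

/-- The infinite product `(a q ^ d; q ^ c)_∞ = ∏_{i ≥ 0} (1 - a q ^ (d + c i))` for `c, d ≥ 1`, as a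
formal power series in `q`: its `n`-th coefficient is the `n`-th coefficient of all sufficiently
long partial products (see `coeff_qPochPartial`). -/
def qPoch {R : Type*} [CommRing R] (a : R) (d c : ℕ) : R⟦X⟧ :=
  PowerSeries.mk fun n => PowerSeries.coeff n (qPochPartial a d c (n + 1))

/-- Beyond `n + 1` factors, the `n`-th coefficient of the partial products no longer changes. -/
theorem coeff_qPochPartial {R : Type*} [CommRing R] (a : R) (d c n M : ℕ) (hd : 1 ≤ d)
    (hc : 1 ≤ c) (hM : n + 1 ≤ M) :
    PowerSeries.coeff n (qPochPartial a d c M) = PowerSeries.coeff n (qPoch a d c) := by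
  induction M, hM using Nat.le_induction with
  | base => simp [qPoch]
  | succ M hM ih =>
    rw [← ih]
    unfold qPochPartial
    rw [Finset.prod_range_succ, mul_sub, mul_one, map_sub, sub_eq_self, ← mul_assoc,
      PowerSeries.coeff_mul_X_pow', if_neg]
    have : M ≤ c * M := Nat.le_mul_of_pos_left _ hc
    omega

/-- The infinite products have constant term `1`. -/
theorem constantCoeff_qPoch {R : Type*} [CommRing R] (a : R) (d c : ℕ) (hd : 1 ≤ d) :
    PowerSeries.constantCoeff (qPoch a d c) = 1 := by
  have h : d ≠ 0 := by omega
  rw [← PowerSeries.coeff_zero_eq_constantCoeff_apply]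
  simp [qPoch, qPochPartial, h]

/-- The inverse of a power series with constant term `1`. -/
def qInv {R : Type*} [CommRing R] (f : R⟦X⟧) : R⟦X⟧ :=
  PowerSeries.invOfUnit f 1

theorem mul_qInv {R : Type*} [CommRing R] (f : R⟦X⟧) (hf : PowerSeries.constantCoeff f = 1) :
    f * qInv f = 1 :=
  PowerSeries.mul_invOfUnit f 1 (by simpa using hf)

/-! ### The two-variable crank-type generating functions

They are power series in `q` whose coefficients are Laurent polynomials in `z`. -/

/-- The variable `z`. -/
abbrev zVar : ℂ[T;T⁻¹] := LaurentPolynomial.T 1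

/-- The Laurent monomial `z⁻¹`. -/
abbrev zInv : ℂ[T;T⁻¹] := LaurentPolynomial.T (-1)

/-- `C1(z,q) = (q²;q⁴)_∞ (q;q)_∞ / ((zq;q)_∞ (z⁻¹q;q)_∞)`. -/
def C1 : ℂ[T;T⁻¹]⟦X⟧ :=
  qPoch 1 2 4 * qPoch 1 1 1 * qInv (qPoch zVar 1 1 * qPoch zInv 1 1)

/-- `C2(z,q) = (-q;q²)_∞ (q²;q²)_∞ / ((zq²;q²)_∞ (z⁻¹q²;q²)_∞)`. -/
def C2 : ℂ[T;T⁻¹]⟦X⟧ :=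
  qPoch (-1) 1 2 * qPoch 1 2 2 * qInv (qPoch zVar 2 2 * qPoch zInv 2 2)

/-- `C4(z,q) = (q⁴;q⁴)_∞ / ((q;q²)_∞ (zq⁴;q⁴)_∞ (z⁻¹q⁴;q⁴)_∞)`. -/
def C4 : ℂ[T;T⁻¹]⟦X⟧ :=
  qPoch 1 4 4 * qInv (qPoch 1 1 2 * qPoch zVar 4 4 * qPoch zInv 4 4)

/-- The coefficient of `z ^ m * q ^ n`. -/
def zqCoeff (F : ℂ[T;T⁻¹]⟦X⟧) (m : ℤ) (n : ℕ) : ℂ :=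
  (PowerSeries.coeff n F).coeff m

/-! ### The `M₂`-rank of partitions without repeated odd parts -/

/-- No odd part occurs more than once. -/
def NoRepeatedOddParts {n : ℕ} (p : n.Partition) : Prop :=
  ∀ i ∈ p.parts, Odd i → p.parts.count i = 1

/-- The `M₂`-rank `⌈l(π)/2⌉ - #(π)`, with `l(π)` the largest part (`0` for the empty partition) and
`#(π)` the number of parts. -/
def m2Rank {n : ℕ} (p : n.Partition) : ℤ :=
  ⌈((p.parts.sup : ℕ) : ℚ) / 2⌉ - (p.parts.card : ℤ)

/-- `N2(m,n)`: the number of partitions of `n` without repeated odd parts and with `M₂`-rank `m`. -/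
def N2 (m : ℤ) (n : ℕ) : ℕ :=
  Nat.card {p : n.Partition // NoRepeatedOddParts p ∧ m2Rank p = m}

/-! ### Moments -/

/-- For `a : ℤ → ℕ → ℂ` such that each `a · n` has finite support, the generating function
`∑_n (∑_m m ^ k a(m,n)) q ^ n` of the `k`-th moments (with `0 ^ 0 = 1`). -/
def momentSeries (a : ℤ → ℕ → ℂ) (k : ℕ) : ℂ⟦X⟧ :=
  PowerSeries.mk fun n => ∑ᶠ m : ℤ, (m : ℂ) ^ k * a m n

theorem zqCoeff_support_finite (F : ℂ[T;T⁻¹]⟦X⟧) (n : ℕ) :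
    (Function.support fun m => zqCoeff F m n).Finite :=
  (PowerSeries.coeff n F).coeff.hasFiniteSupport

theorem N2_support_finite (n : ℕ) : (Function.support fun m => ((N2 m n : ℕ) : ℂ)).Finite := by
  refine (Set.finite_range (fun p : n.Partition => m2Rank p)).subset fun m hm => ?_
  have h : N2 m n ≠ 0 := by simpa using hm
  obtain ⟨⟨p, hp⟩⟩ := (Nat.card_ne_zero.1 h).1
  exact ⟨p, hp.2⟩

/-- `C1_k(q)`. -/
def C1Moment (k : ℕ) : ℂ⟦X⟧ := momentSeries (zqCoeff C1) k

/-- `C2_k(q)`. -/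
def C2Moment (k : ℕ) : ℂ⟦X⟧ := momentSeries (zqCoeff C2) k

/-- `C4_k(q)`. -/
def C4Moment (k : ℕ) : ℂ⟦X⟧ := momentSeries (zqCoeff C4) k

/-- `R2_k(q)`. -/
def R2Moment (k : ℕ) : ℂ⟦X⟧ := momentSeries (fun m n => (N2 m n : ℂ)) k

/-- The operator `δ_q = q d/dq`. -/
def deltaQ (f : ℂ⟦X⟧) : ℂ⟦X⟧ := PowerSeries.X * PowerSeries.derivative ℂ f

/-! ### Quasimodular forms, as `q`-series -/

/-- `E₂(q) = 1 - 24 ∑_{n ≥ 1} σ₁(n) q ^ n`. -/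
def E2Series : ℂ⟦X⟧ :=
  PowerSeries.mk fun n => if n = 0 then 1 else -24 * ((∑ d ∈ n.divisors, d : ℕ) : ℂ)

/-- `Γ₀(M)` as a subgroup of `GL₂(ℝ)`. -/
abbrev Gamma0GL (M : ℕ) : Subgroup (GL (Fin 2) ℝ) :=
  (CongruenceSubgroup.Gamma0 M).map (Matrix.SpecialLinearGroup.mapGL ℝ)

/-- The space of `q`-expansions of quasimodular forms for `Γ₀(M)` of weight at most `w`:
polynomials in `E₂` and holomorphic modular forms of nonnegative weight on `Γ₀(M)`, each monomial of
weight at most `w` (a product of modular forms being again a modular form, whose weight is the sum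
of the weights, a monomial is `E₂ ^ i * f` with `f` modular of weight `k` and `2 i + k ≤ w`). -/
def quasimodularForms (M w : ℕ) : Submodule ℂ ℂ⟦X⟧ :=
  Submodule.span ℂ {g | ∃ (i k : ℕ) (f : ModularForm (Gamma0GL M) (k : ℤ)),
    2 * i + k ≤ w ∧ g = E2Series ^ i * UpperHalfPlane.qExpansion 1 f}

/-- `W_n(Γ₀(M))`: quasimodular forms for `Γ₀(M)` of weight at most `2 n` whose `q`-expansion at
infinity has zero constant term. -/
def quasimodularZeroConst (M n : ℕ) : Submodule ℂ ℂ⟦X⟧ :=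
  quasimodularForms M (2 * n) ⊓ LinearMap.ker (PowerSeries.coeff (R := ℂ) 0)

/-- The space `(-q;q²)_∞ / (q²;q²)_∞ · W_N(Γ₀(4))`. -/
def commonSpace (N : ℕ) : Submodule ℂ ℂ⟦X⟧ :=
  (quasimodularZeroConst 4 N).map
    (LinearMap.mulLeft ℂ (qPoch (-1 : ℂ) 1 2 * qInv (qPoch (1 : ℂ) 2 2)))

end M2Crank

end

/-! Put P = (-q;q²)_∞/(q²;q²)_∞ = (q²;q²)_∞/((q;q)_∞(q⁴;q⁴)_∞).

Cranks. Each of C1, C2, C4 equals P times a normalised quotient (q^c;q^c)²/((zq^c;q^c)(z⁻¹q^c;q^c))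
with c = 1, 2, 4 (`C1_eq`, `C2_eq`, `C4_eq`). This quotient is 1 at z = 1. The moments of its
logarithmic derivative under z d/dz vanish in even order and are multiples of ∑ σ_k(n) q^{cn} in odd
order k (`moment_crankLogDeriv`). The latter are quasimodular of weight k+1 on Γ₀(4)
(`expand_sigmaSeries_mem`), and the Leibniz rule integrates this to the quotient itself: its k-th
moment has weight at most k (`QuasimodularMoments.of_logDeriv`). Finally δ_q raises the weight by 2,
both on quasimodular forms (Serre derivative and Ramanujan's equation for E₂) and on P times such
forms, because the logarithmic derivative of P has weight 2 (`deltaQ_mem_commonSpace`).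

Ranks. P is the generating function of partitions without repeated odd parts (`coeff_prefactor`).
The link with quasimodular forms is a rank-crank differential equation (`zqCoeff_thetaSeries`): a
second-order operator applied to the M₂-rank generating function gives P·h(z,q), where h is a
multiple, by a series in q, of (-zq;q²)(-z⁻¹q;q²)/((zq²;q²)(z⁻¹q²;q²))³. As h is a product of
crank-type quotients and the inverse of one, its moments are quasimodular by the same argument.
Taking the 2N-th moment of (z+z⁻¹)·P·h and expanding binomially (`rank_polynomial_identity`) yields
the combination in part 4, up to a multiple of δ_q P and the term 2P, which also removes the
constant term.

The differential equation is proved by uniqueness. Divide by (1-z)³, expanding in nonnegative powers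
of z. The coefficients on both sides satisfy two relations: a reflection m ↦ -3-m at fixed n, with
prescribed sum, and an invariance (m,n) ↦ (-1-m, n+2m+1). For the theta side the invariance is the
symmetry x ↔ y after z = x², q = xy (`thetaSum_symm`), and the reflection follows from the moments
of order 0, 1, 2 (`thetaSum_add`). For the rank side the invariance comes from two ways of
dismantling a partition, by its first two columns or by its largest part (`numRankLE_eq`,
`numRankGE_eq`), and the reflection from the symmetry of the rank (`numRankLE_neg`). Together the
two relations express the difference of the two sides at n through its value at a smaller n, so it
vanishes (`weightedRankSum_eq_thetaSum`). -/

noncomputable section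

namespace M2Crank

/-! ### Quasimodular forms on Γ₀(4): stability under products and δ_q, and divisor sums. -/

section ModularForms

open UpperHalfPlane Derivative Function
open scoped Manifold ModularForm Topology

/-! ### `q`-expansions of periodic functions -/

/-- Holomorphic functions on the upper half plane with period `1` which are bounded at `i∞`. -/
structure IsQSeries (f : ℍ → ℂ) : Prop where
  periodic : Periodic (f ∘ ofComplex) (1 : ℝ)
  holo : MDiff f
  bdd : IsBoundedAtImInfty f

namespace IsQSeries

theorem of_hasSum {f : ℍ → ℂ} {c : ℕ → ℂ} (hol : MDiff f)
    (hf : ∀ τ : ℍ, HasSum (fun m ↦ c m • Periodic.qParam (1 : ℝ) τ ^ m) (f τ)) : IsQSeries f where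
  periodic := by
    intro w
    by_cases hw : 0 < w.im
    · have h1 : 0 < (w + (1 : ℝ)).im := by simpa using hw
      simp only [comp_apply, ofComplex_apply_of_im_pos h1, ofComplex_apply_of_im_pos hw]
      refine (hf ⟨w + (1 : ℝ), h1⟩).unique ?_
      have := hf ⟨w, hw⟩
      have hq : Periodic.qParam (1 : ℝ) (w + (1 : ℝ)) = Periodic.qParam (1 : ℝ) w := by
        simp [Periodic.qParam, mul_add, Complex.exp_add]
      simpa only [coe_mk, hq] using this
    -- Off the upper half plane `ofComplex` takes a constant default value, so periodicity is
    -- automatic there.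
    · have h1 : ¬ 0 < (w + (1 : ℝ)).im := by simpa using hw
      simp only [comp_apply, ofComplex_apply_of_im_nonpos (not_lt.1 hw),
        ofComplex_apply_of_im_nonpos (not_lt.1 h1)]
  holo := hol
  bdd := isBoundedAtImInfty_of_hasSum_qExpansion one_pos hf

variable {f g : ℍ → ℂ}

theorem analyticAt (hf : IsQSeries f) : AnalyticAt ℂ (cuspFunction 1 f) 0 :=
  analyticAt_cuspFunction_zero one_pos hf.periodic hf.holo hf.bdd

theorem hasSum (hf : IsQSeries f) (τ : ℍ) :
    HasSum (fun m ↦ (qExpansion 1 f).coeff m • Periodic.qParam (1 : ℝ) τ ^ m) (f τ) :=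
  hasSum_qExpansion one_pos hf.periodic hf.holo hf.bdd τ

/-- Uniqueness of the Taylor series of the cusp function at q = 0. -/
theorem qExpansion_eq (hf : IsQSeries f) {c : ℕ → ℂ}
    (hc : ∀ τ : ℍ, HasSum (fun m ↦ c m • Periodic.qParam (1 : ℝ) τ ^ m) (f τ)) :
    qExpansion 1 f = PowerSeries.mk c := by
  ext m
  have h1 := (hasFPowerSeriesOnBall_cuspFunction one_pos hf.analyticAt hc).hasFPowerSeriesAt
  have h2 := (hasFPowerSeriesOnBall_cuspFunction one_pos hf.analyticAt hf.hasSum).hasFPowerSeriesAt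
  simpa using congr_arg (FormalMultilinearSeries.coeff · m) (h2.eq_formalMultilinearSeries h1)

theorem mul (hf : IsQSeries f) (hg : IsQSeries g) : IsQSeries (f * g) where
  periodic := hf.periodic.mul hg.periodic
  holo := hf.holo.mul hg.holo
  bdd := hf.bdd.mul hg.bdd

theorem sub (hf : IsQSeries f) (hg : IsQSeries g) : IsQSeries (f - g) where
  periodic := hf.periodic.sub hg.periodic
  holo := hf.holo.sub hg.holo
  bdd := hf.bdd.sub hg.bdd

theorem const_smul (hf : IsQSeries f) (a : ℂ) : IsQSeries (a • f) where
  periodic := hf.periodic.comp fun x ↦ a • x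
  holo := hf.holo.const_smul a
  bdd := hf.bdd.const_smul_left a

theorem qExpansion_mul (hf : IsQSeries f) (hg : IsQSeries g) :
    qExpansion 1 (f * g) = qExpansion 1 f * qExpansion 1 g :=
  UpperHalfPlane.qExpansion_mul hf.analyticAt hg.analyticAt

theorem qExpansion_sub (hf : IsQSeries f) (hg : IsQSeries g) :
    qExpansion 1 (f - g) = qExpansion 1 f - qExpansion 1 g :=
  UpperHalfPlane.qExpansion_sub hf.analyticAt hg.analyticAt

theorem qExpansion_smul (hf : IsQSeries f) (a : ℂ) :
    qExpansion 1 (a • f) = a • qExpansion 1 f :=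
  UpperHalfPlane.qExpansion_smul hf.analyticAt a

end IsQSeries

/-! ### Differentiation of q-expansions. -/

/-- The derivative of a holomorphic function bounded at `i∞` is bounded at `i∞`. -/
theorem isBoundedAtImInfty_normalizedDeriv {f : ℍ → ℂ} (hol : MDiff f)
    (hb : IsBoundedAtImInfty f) : IsBoundedAtImInfty (D f) := by
  rw [isBoundedAtImInfty_iff] at hb ⊢
  obtain ⟨M, A, hMA⟩ := hb
  -- Cauchy's estimate on the circle of radius 1 about z. The height max A 0 + 2 keeps the whole
  -- disc in the upper half plane and in the region where |f| ≤ M.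
  refine ⟨‖(2 * Real.pi * Complex.I : ℂ)⁻¹‖ * M, max A 0 + 2, fun z hz => ?_⟩
  have him : ∀ w ∈ Metric.closedBall (z : ℂ) 1, max A 0 + 1 ≤ w.im := by
    intro w hw
    rw [Metric.mem_closedBall, dist_eq_norm] at hw
    have h1 := (Complex.abs_im_le_norm (w - z)).trans hw
    rw [Complex.sub_im, abs_le] at h1
    have : (z : ℂ).im = z.im := rfl
    linarith [h1.1]
  have hd := UpperHalfPlane.mdifferentiable_iff.1 hol
  have key : ‖deriv (f ∘ ofComplex) z‖ ≤ M / 1 := by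
    refine Complex.norm_deriv_le_of_forall_mem_sphere_norm_le one_pos ?_ ?_
    · refine DifferentiableOn.diffContOnCl ?_
      refine hd.mono fun w hw => ?_
      have := him w (Metric.closure_ball_subset_closedBall hw)
      have h0 := le_max_right A 0
      show 0 < w.im
      linarith
    · intro w hw
      have h1 := him w (Metric.sphere_subset_closedBall hw)
      have h0 := le_max_right A 0
      have h2 := le_max_left A 0
      have hw0 : 0 < w.im := by linarith
      rw [comp_apply, ofComplex_apply_of_im_pos hw0]
      exact hMA _ (by show A ≤ w.im; linarith)
  rw [normalizedDerivOfComplex, norm_mul]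
  gcongr
  simpa using key

/-- By the chain rule for q = e^{2πiτ}, D f = q g'(q) with g the cusp function. The Taylor series of
g' on the unit disc, multiplied by q, is the claimed series after an index shift; its term m = 0
vanishes. -/
theorem IsQSeries.hasSum_normalizedDeriv {f : ℍ → ℂ} (hf : IsQSeries f) (τ : ℍ) :
    HasSum (fun m : ℕ ↦ ((m : ℂ) * (qExpansion 1 f).coeff m) • Periodic.qParam (1 : ℝ) τ ^ m)
      (D f τ) := by
  set g := cuspFunction 1 f with hg
  set q := Periodic.qParam (1 : ℝ) τ with hq
  have hq1 : ‖q‖ < 1 := Periodic.norm_qParam_lt_one one_pos τ.im_pos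
  have hgd : DifferentiableOn ℂ g (Metric.ball 0 1) :=
    differentiableOn_cuspFunction_ball one_pos hf.periodic hf.holo hf.bdd
  have hgq : DifferentiableAt ℂ g q :=
    differentiableAt_cuspFunction one_pos hf.periodic hf.holo hf.bdd hq1
  have hder : D f τ = q * deriv g q := by
    have h1 : f ∘ ofComplex =ᶠ[𝓝 (τ : ℂ)] fun w => g (Periodic.qParam (1 : ℝ) w) := by
      filter_upwards [isOpen_upperHalfPlaneSet.mem_nhds τ.im_pos] with w hw
      rw [comp_apply, ofComplex_apply_of_im_pos hw]
      exact (eq_cuspFunction ⟨w, hw⟩ one_ne_zero hf.periodic).symm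
    have h2 : HasDerivAt (fun w : ℂ => Periodic.qParam (1 : ℝ) w)
        (q * (2 * Real.pi * Complex.I)) τ := by
      have : HasDerivAt (fun w : ℂ => 2 * Real.pi * Complex.I * w / (1 : ℝ))
          (2 * Real.pi * Complex.I) τ := by
        simpa using (hasDerivAt_id (τ : ℂ)).const_mul (2 * Real.pi * Complex.I)
      exact this.cexp
    have h3 := (hgq.hasDerivAt.comp (τ : ℂ) h2).congr_of_eventuallyEq h1
    rw [normalizedDerivOfComplex, h3.deriv]
    field_simp [Complex.two_pi_I_ne_zero]
  have hs := Complex.hasSum_taylorSeries_on_ball (hgd.deriv Metric.isOpen_ball)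
    (show q ∈ Metric.ball (0 : ℂ) 1 by simpa using hq1)
  have hs2 := hs.mul_left q
  rw [hder, ← hasSum_nat_add_iff' 1]
  simp only [Finset.range_one, Finset.sum_singleton, Nat.cast_zero, zero_mul, zero_smul, sub_zero]
  convert! hs2 using 1
  ext n
  rw [qExpansion_coeff, iteratedDeriv_succ', Nat.factorial_succ]
  have : ((n.factorial : ℕ) : ℂ) ≠ 0 := by exact_mod_cast n.factorial_ne_zero
  have h2 : ((n : ℂ) + 1) ≠ 0 := by exact_mod_cast n.succ_ne_zero
  push_cast
  simp only [smul_eq_mul, sub_zero]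
  field_simp
  ring

theorem IsQSeries.normalizedDeriv {f : ℍ → ℂ} (hf : IsQSeries f) : IsQSeries (D f) :=
  .of_hasSum (normalizedDerivOfComplex_mdifferentiable hf.holo) hf.hasSum_normalizedDeriv

theorem coeff_deltaQ (f : ℂ⟦X⟧) (n : ℕ) :
    PowerSeries.coeff n (deltaQ f) = n * PowerSeries.coeff n f := by
  cases n with
  | zero => simp [deltaQ]
  | succ n =>
    rw [deltaQ, PowerSeries.coeff_succ_X_mul, PowerSeries.coeff_derivative]
    push_cast; ring

theorem IsQSeries.qExpansion_normalizedDeriv {f : ℍ → ℂ} (hf : IsQSeries f) :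
    qExpansion 1 (D f) = deltaQ (qExpansion 1 f) := by
  rw [hf.normalizedDeriv.qExpansion_eq hf.hasSum_normalizedDeriv]
  ext n
  rw [PowerSeries.coeff_mk, coeff_deltaQ]

theorem one_mem_strictPeriods_Gamma0GL (M : ℕ) : (1 : ℝ) ∈ (Gamma0GL M).strictPeriods := by
  simp

theorem isQSeries_modularForm {M : ℕ} [NeZero M] {k : ℤ} (f : ModularForm (Gamma0GL M) k) :
    IsQSeries f where
  periodic := SlashInvariantFormClass.periodic_comp_ofComplex f (one_mem_strictPeriods_Gamma0GL M)
  holo := f.holo'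
  bdd := ModularFormClass.bdd_at_infty f

theorem qParam_one (w : ℂ) :
    Periodic.qParam (1 : ℝ) w = Complex.exp (2 * Real.pi * Complex.I * w) := by
  simp [Periodic.qParam]

open EisensteinSeries in
theorem isQSeries_E2 : IsQSeries E2 :=
  .of_hasSum E2_mdifferentiable fun τ => by
    rw [qParam_one]
    exact hasSum_qExpansion_E2 τ

open EisensteinSeries in
theorem qExpansion_E2 : qExpansion 1 E2 = E2Series := by
  rw [isQSeries_E2.qExpansion_eq fun τ => by
    rw [qParam_one]
    exact hasSum_qExpansion_E2 τ]
  ext n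
  simp [E2Series, ArithmeticFunction.sigma_one_apply]

/-! ### Constructing modular forms on `Γ₀(M)` -/

/-- A holomorphic function which is invariant under `Γ₀(M)` and all of whose `SL₂(ℤ)`-translates are
bounded at `i∞`, as a modular form. -/
def mkModularForm (M : ℕ) [NeZero M] (k : ℤ) (f : ℍ → ℂ) (hol : MDiff f)
    (inv : ∀ γ ∈ CongruenceSubgroup.Gamma0 M, f ∣[k] γ = f)
    (bdd : ∀ γ : SL(2, ℤ), IsBoundedAtImInfty (f ∣[k] γ)) : ModularForm (Gamma0GL M) k where
  toFun := f
  slash_action_eq' := by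
    rintro _ ⟨γ, hγ, rfl⟩
    exact inv γ hγ
  holo' := hol
  bdd_at_cusps' {c} hc := by
    rw [Subgroup.IsArithmetic.isCusp_iff_isCusp_SL2Z] at hc
    rw [OnePoint.isBoundedAt_iff_forall_SL2Z hc]
    exact fun γ _ => bdd γ

theorem slash_eq_of_mem_Gamma0 {M : ℕ} {k : ℤ} (f : ModularForm (Gamma0GL M) k) {γ : SL(2, ℤ)}
    (hγ : γ ∈ CongruenceSubgroup.Gamma0 M) : (f : ℍ → ℂ) ∣[k] γ = f :=
  f.slash_action_eq' _ ⟨γ, hγ, rfl⟩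

theorem isBoundedAtImInfty_slash {M : ℕ} [NeZero M] {k : ℤ} (f : ModularForm (Gamma0GL M) k)
    (γ : SL(2, ℤ)) : IsBoundedAtImInfty ((f : ℍ → ℂ) ∣[k] γ) := by
  have hc : IsCusp (Matrix.SpecialLinearGroup.mapGL ℝ γ • OnePoint.infty) (Gamma0GL M) := by
    rw [Subgroup.IsArithmetic.isCusp_iff_isCusp_SL2Z, isCusp_SL2Z_iff']
    exact ⟨γ, rfl⟩
  exact f.bdd_at_cusps' hc _ rfl

/-! ### The Serre derivative and Ramanujan's equation for E₂. -/

/-- The Serre derivative of a modular form. -/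
def serreForm {M : ℕ} [NeZero M] {k : ℤ} (f : ModularForm (Gamma0GL M) k) :
    ModularForm (Gamma0GL M) (k + 2) :=
  mkModularForm M (k + 2) (serreDerivative k f) (serreDerivative_mdifferentiable _ f.holo')
    (fun _ hγ => serreDerivative_slash_invariant f.holo' (slash_eq_of_mem_Gamma0 f hγ))
    (fun γ => by
      -- The Serre derivative commutes with the slash action, so boundedness at every cusp reduces
      -- to boundedness at i∞ of D(f∣γ) and of E₂·(f∣γ).
      have hs : serreDerivative k f ∣[k + 2] γ = serreDerivative k ((f : ℍ → ℂ) ∣[k] γ) :=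
        serreDerivative_slash_equivariant f.holo'
      rw [hs, serreDerivative_eq]
      have hb := isBoundedAtImInfty_slash f γ
      have hd := isBoundedAtImInfty_normalizedDeriv (f.holo'.slash k _) hb
      have hE : IsBoundedAtImInfty ((((k : ℂ) * 12⁻¹) • EisensteinSeries.E2) * ((f : ℍ → ℂ) ∣[k] γ)) :=
        Filter.BoundedAtFilter.mul (EisensteinSeries.isBoundedAtImInfty_E2.const_smul_left _) hb
      exact hd.sub hE)

theorem qExpansion_serreForm {M : ℕ} [NeZero M] {k : ℤ} (f : ModularForm (Gamma0GL M) k) :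
    qExpansion 1 (serreForm f) =
      deltaQ (qExpansion 1 f) - ((k : ℂ) * 12⁻¹) • (E2Series * qExpansion 1 f) := by
  have hf := isQSeries_modularForm f
  have h : (serreForm f : ℍ → ℂ) = D f - ((k : ℂ) * 12⁻¹) • (EisensteinSeries.E2 * f) := by
    ext τ
    show serreDerivative k f τ = _
    rw [serreDerivative_apply]
    simp [mul_assoc]
  rw [h, hf.normalizedDeriv.qExpansion_sub ((isQSeries_E2.mul hf).const_smul _),
    (isQSeries_E2.mul hf).qExpansion_smul, isQSeries_E2.qExpansion_mul hf, qExpansion_E2,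
    hf.qExpansion_normalizedDeriv]

/-- `D2 γ` is 2πi c/(cz+d), the anomaly of E₂ up to a constant. Its derivative is proportional to
its square, which is why the anomalies of D E₂ and E₂² can cancel. -/
theorem normalizedDeriv_D2 (γ : SL(2, ℤ)) (z : ℍ) :
    D (EisensteinSeries.D2 γ) z = -((γ 1 0 : ℂ) / denom γ z) ^ 2 := by
  have h1 := hasDerivAt_denom_zpow (γ : GL (Fin 2) ℝ) (-1) z
  have h2 := h1.const_mul (2 * Real.pi * Complex.I * (γ 1 0 : ℂ))
  have h3 : EisensteinSeries.D2 γ ∘ ofComplex =ᶠ[𝓝 (z : ℂ)]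
      fun w => 2 * Real.pi * Complex.I * (γ 1 0 : ℂ) * denom (γ : GL (Fin 2) ℝ) w ^ (-1 : ℤ) := by
    filter_upwards [isOpen_upperHalfPlaneSet.mem_nhds z.im_pos] with w hw
    rw [comp_apply, ofComplex_apply_of_im_pos hw, EisensteinSeries.D2, zpow_neg_one]
    rfl
  rw [normalizedDerivOfComplex, (h2.congr_of_eventuallyEq h3).deriv]
  have hz := denom_ne_zero (γ : GL (Fin 2) ℝ) z
  have : ((γ : GL (Fin 2) ℝ) 1 0 : ℂ) = (γ 1 0 : ℂ) := by simp
  rw [this]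
  have e : ((-1 : ℤ) - 1) = -2 := by norm_num
  rw [e, zpow_neg]
  have hpi := Complex.two_pi_I_ne_zero
  field_simp
  norm_num

/-- `D E₂ - E₂² / 12` is invariant under `SL₂(ℤ)` in weight `4`. -/
theorem ramanujan_slash (γ : SL(2, ℤ)) :
    (D EisensteinSeries.E2 - (12⁻¹ : ℂ) • (EisensteinSeries.E2 * EisensteinSeries.E2)) ∣[(4 : ℤ)] γ
      = D EisensteinSeries.E2 - (12⁻¹ : ℂ) • (EisensteinSeries.E2 * EisensteinSeries.E2) := by
  have hE := E2_mdifferentiable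
  have hs := EisensteinSeries.E2_slash_action γ
  have hD2 : MDiff ((1 / (2 * riemannZeta 2)) • EisensteinSeries.D2 γ) := by
    have : (1 / (2 * riemannZeta 2)) • EisensteinSeries.D2 γ
        = EisensteinSeries.E2 - EisensteinSeries.E2 ∣[(2 : ℤ)] γ := by rw [hs]; abel
    rw [this]
    exact hE.sub (hE.slash 2 _)
  have hc : (1 / (2 * riemannZeta 2)) ≠ 0 := by
    rw [riemannZeta_two]; simp [Real.pi_ne_zero]
  have hD2' : MDiff (EisensteinSeries.D2 γ) := by
    have := hD2.const_smul (1 / (2 * riemannZeta 2))⁻¹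
    rwa [inv_smul_smul₀ hc] at this
  -- Computing D(E₂∣γ) in two ways, from the weight-2 anomaly formula and from the failure of D to
  -- commute with the slash action, determines (D E₂)∣γ.
  have h1 := normalizedDerivOfComplex_SL_slash (k := 2) hE (γ := γ)
  rw [hs, normalizedDerivOfComplex_sub _ _ hE hD2, normalizedDerivOfComplex_smul _ _ hD2'] at h1
  have h2 := ModularForm.mul_slash_SL2 2 2 γ EisensteinSeries.E2 EisensteinSeries.E2
  rw [hs] at h2
  norm_num at h2
  ext z
  have h1z := congrFun h1 z
  have h2z := congrFun h2 z
  rw [sub_eq_add_neg, SlashAction.add_slash, SlashAction.neg_slash, ModularForm.SL_smul_slash]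
  norm_num at h1z
  simp only [Pi.add_apply, Pi.neg_apply, Pi.smul_apply, Pi.sub_apply, Pi.mul_apply,
    smul_eq_mul] at h1z h2z ⊢
  rw [h2z]
  rw [normalizedDeriv_D2] at h1z
  rw [EisensteinSeries.D2, riemannZeta_two] at *
  have hz := denom_ne_zero (γ : GL (Fin 2) ℝ) z
  rw [mul_div_assoc] at h1z ⊢
  -- With X = c/(cz+d) the claim is a polynomial identity in X, E₂(z) and D E₂(z); the value ζ(2) =
  -- π²/6 makes the X and X² terms cancel.
  generalize (γ 1 0 : ℂ) / denom (γ : GL (Fin 2) ℝ) z = X at h1z ⊢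
  rw [eq_sub_of_add_eq h1z.symm]
  have hpi : (Real.pi : ℂ) ≠ 0 := by simp [Real.pi_ne_zero]
  field_simp
  ring_nf
  simp only [Complex.I_sq]
  ring

/-- The level one modular form `D E₂ - E₂² / 12` of weight `4`, at level `M`. -/
def ramanujanForm (M : ℕ) [NeZero M] : ModularForm (Gamma0GL M) 4 :=
  mkModularForm M 4 (D EisensteinSeries.E2 - (12⁻¹ : ℂ) • (EisensteinSeries.E2 * EisensteinSeries.E2))
    (isQSeries_E2.normalizedDeriv.sub ((isQSeries_E2.mul isQSeries_E2).const_smul _)).holo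
    (fun γ _ => ramanujan_slash γ)
    (fun γ => by
      rw [ramanujan_slash]
      exact (isQSeries_E2.normalizedDeriv.sub ((isQSeries_E2.mul isQSeries_E2).const_smul _)).bdd)

theorem qExpansion_ramanujanForm (M : ℕ) [NeZero M] :
    qExpansion 1 (ramanujanForm M) = deltaQ E2Series - (12⁻¹ : ℂ) • (E2Series * E2Series) := by
  have h := isQSeries_E2
  show qExpansion 1 (D EisensteinSeries.E2 -
    (12⁻¹ : ℂ) • (EisensteinSeries.E2 * EisensteinSeries.E2)) = _
  rw [h.normalizedDeriv.qExpansion_sub ((h.mul h).const_smul _), (h.mul h).qExpansion_smul,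
    h.qExpansion_mul h, h.qExpansion_normalizedDeriv, qExpansion_E2]

/-! ### Changing the level -/

theorem exists_SL (a b c d : ℤ) (h : a * d - b * c = 1) :
    ∃ γ : SL(2, ℤ), γ 0 0 = a ∧ γ 0 1 = b ∧ γ 1 0 = c ∧ γ 1 1 = d :=
  ⟨⟨!![a, b; c, d], by rw [Matrix.det_fin_two_of, h]⟩, rfl, rfl, rfl, rfl⟩

theorem SL_det (γ : SL(2, ℤ)) : γ 0 0 * γ 1 1 - γ 0 1 * γ 1 0 = 1 := by
  rw [← Matrix.det_fin_two]; exact γ.2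

theorem coe_SL (γ : SL(2, ℤ)) : (γ : GL (Fin 2) ℝ).val =
    !![(γ 0 0 : ℝ), (γ 0 1 : ℝ); (γ 1 0 : ℝ), (γ 1 1 : ℝ)] := by
  ext i j
  fin_cases i <;> fin_cases j <;> simp

/-- Restriction of a modular form to a smaller group. -/
def restrictForm {Γ Γ' : Subgroup (GL (Fin 2) ℝ)} (h : Γ' ≤ Γ) {k : ℤ} (f : ModularForm Γ k) :
    ModularForm Γ' k where
  toFun := f
  slash_action_eq' A hA := f.slash_action_eq' A (h hA)
  holo' := f.holo'
  bdd_at_cusps' hc := f.bdd_at_cusps' (hc.mono h)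

/-- The matrix `diag(d, 1)`. -/
def diagGL (d : ℕ) [NeZero d] : GL (Fin 2) ℝ :=
  Matrix.GeneralLinearGroup.mkOfDetNeZero !![(d : ℝ), 0; 0, 1] (by simp [NeZero.ne d])

theorem coe_diagGL (d : ℕ) [NeZero d] : (diagGL d).val = !![(d : ℝ), 0; 0, 1] := rfl

theorem det_diagGL (d : ℕ) [NeZero d] : (diagGL d).val.det = d := by
  simp [diagGL, Matrix.GeneralLinearGroup.mkOfDetNeZero]

theorem diagGL_smul (d : ℕ) [NeZero d] (τ : ℍ) : ((diagGL d • τ : ℍ) : ℂ) = d * τ := by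
  have hd : (0 : ℝ) < d := by exact_mod_cast NeZero.pos d
  rw [coe_smul_of_det_pos (by rw [Matrix.GeneralLinearGroup.val_det_apply, det_diagGL]; exact hd)]
  simp [num, denom, diagGL, Matrix.GeneralLinearGroup.mkOfDetNeZero]

theorem slash_diagGL (d : ℕ) [NeZero d] (k : ℤ) (f : ℍ → ℂ) (τ : ℍ) :
    (f ∣[k] diagGL d) τ = (d : ℂ) ^ (k - 1) * f (diagGL d • τ) := by
  have hd : (0 : ℝ) < d := by exact_mod_cast NeZero.pos d
  have hdet : (diagGL d).det.val = d := by
    rw [Matrix.GeneralLinearGroup.val_det_apply, det_diagGL]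
  rw [ModularForm.slash_apply, hdet, abs_of_pos hd, σ, if_pos (by rw [hdet]; exact hd)]
  simp [denom, diagGL, Matrix.GeneralLinearGroup.mkOfDetNeZero, mul_comm]

theorem IsQSeries.slash_diagGL {f : ℍ → ℂ} (hf : IsQSeries f) (d : ℕ) [NeZero d] (k : ℤ) :
    IsQSeries (f ∣[k] diagGL d) ∧ qExpansion 1 (f ∣[k] diagGL d) =
      ((d : ℂ) ^ (k - 1)) • PowerSeries.expand d (NeZero.ne d) (qExpansion 1 f) := by
  have hs : ∀ τ : ℍ, HasSum (fun m ↦ (PowerSeries.coeff m (((d : ℂ) ^ (k - 1)) •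
      PowerSeries.expand d (NeZero.ne d) (qExpansion 1 f))) • Periodic.qParam (1 : ℝ) τ ^ m)
      ((f ∣[k] diagGL d) τ) := by
    intro τ
    rw [M2Crank.slash_diagGL]
    have h1 := (hf.hasSum (diagGL d • τ)).mul_left ((d : ℂ) ^ (k - 1))
    have h2 : Periodic.qParam (1 : ℝ) ((diagGL d • τ : ℍ) : ℂ) = Periodic.qParam (1 : ℝ) τ ^ d := by
      rw [diagGL_smul, Periodic.qParam, Periodic.qParam, ← Complex.exp_nat_mul]
      congr 1
      ring
    rw [h2] at h1
    have hinj : Function.Injective fun n : ℕ => d * n :=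
      fun a b h => Nat.eq_of_mul_eq_mul_left (NeZero.pos d) h
    rw [← hinj.hasSum_iff]
    · convert! h1 using 1
      ext n
      simp [PowerSeries.coeff_expand_mul, pow_mul, mul_assoc]
    · intro m hm
      have : ¬ d ∣ m := fun ⟨n, hn⟩ => hm ⟨n, hn.symm⟩
      simp [PowerSeries.coeff_expand, this]
  have hq := IsQSeries.of_hasSum (hf.holo.slash k _) hs
  refine ⟨hq, ?_⟩
  rw [hq.qExpansion_eq hs]
  ext m
  simp

open ConjAct Pointwise in
-- Conjugation by diag(d,1) multiplies the upper right entry by d and divides the lower left one by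
-- d, so it carries Γ₀(dM) into Γ₀(M).
theorem Gamma0GL_le_conj (M d : ℕ) [NeZero d] :
    Gamma0GL (d * M) ≤ toConjAct (diagGL d)⁻¹ • Gamma0GL M := by
  rintro _ ⟨γ, hγ, rfl⟩
  rw [Subgroup.mem_pointwise_smul_iff_inv_smul_mem, ← toConjAct_inv, inv_inv, toConjAct_smul]
  have hγ' : γ ∈ CongruenceSubgroup.Gamma0 (d * M) := hγ
  rw [CongruenceSubgroup.Gamma0_mem, ZMod.intCast_zmod_eq_zero_iff_dvd] at hγ'
  obtain ⟨e, he⟩ := hγ'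
  obtain ⟨γ', h00, h01, h10, h11⟩ := exists_SL (γ 0 0) (d * γ 0 1) (M * e) (γ 1 1) (by
    push_cast at he
    linear_combination SL_det γ + γ 0 1 * he)
  refine ⟨γ', ?_, ?_⟩
  · show γ' ∈ CongruenceSubgroup.Gamma0 M
    simp [CongruenceSubgroup.Gamma0_mem, h10]
  · rw [eq_mul_inv_iff_mul_eq]
    refine Units.ext ?_
    show (γ' : GL (Fin 2) ℝ).val * (diagGL d).val = (diagGL d).val * (γ : GL (Fin 2) ℝ).val
    rw [coe_SL, coe_SL, h00, h01, h10, h11, he, coe_diagGL]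
    simp [mul_comm, mul_left_comm]
    ring

/-- The modular form `d ^ (k - 1) f(d τ)`. -/
def raiseForm {M : ℕ} (d : ℕ) [NeZero d] {k : ℤ} (f : ModularForm (Gamma0GL M) k) :
    ModularForm (Gamma0GL (d * M)) k :=
  restrictForm (Gamma0GL_le_conj M d) (ModularForm.translate f (diagGL d))

theorem qExpansion_raiseForm {M : ℕ} [NeZero M] (d : ℕ) [NeZero d] {k : ℤ}
    (f : ModularForm (Gamma0GL M) k) : qExpansion 1 (raiseForm d f) =
      ((d : ℂ) ^ (k - 1)) • PowerSeries.expand d (NeZero.ne d) (qExpansion 1 f) :=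
  ((isQSeries_modularForm f).slash_diagGL d k).2

theorem Gamma0GL_le {M M' : ℕ} (h : M ∣ M') : Gamma0GL M' ≤ Gamma0GL M := by
  refine Subgroup.map_mono fun γ hγ => ?_
  rw [CongruenceSubgroup.Gamma0_mem, ZMod.intCast_zmod_eq_zero_iff_dvd] at hγ ⊢
  exact (Int.natCast_dvd_natCast.2 h).trans hγ

theorem Gamma0GL_le_SL (M : ℕ) : Gamma0GL M ≤ 𝒮ℒ := by
  rintro _ ⟨γ, -, rfl⟩
  exact ⟨γ, rfl⟩

/-- The anomaly is a multiple of c/(cz+d), which is bounded for Im z ≥ 1 because |cz+d| ≥ |c| Im z.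
-/
theorem isBoundedAtImInfty_E2_slash (γ : SL(2, ℤ)) :
    IsBoundedAtImInfty (EisensteinSeries.E2 ∣[(2 : ℤ)] γ) := by
  rw [EisensteinSeries.E2_slash_action]
  refine EisensteinSeries.isBoundedAtImInfty_E2.sub (Asymptotics.IsBigO.const_smul_left ?_ _)
  show IsBoundedAtImInfty _
  rw [isBoundedAtImInfty_iff]
  refine ⟨‖(2 * Real.pi * Complex.I : ℂ)‖, 1, fun z hz => ?_⟩
  rw [EisensteinSeries.D2, norm_div, norm_mul]
  have hz0 := norm_pos_iff.2 (denom_ne_zero (γ : GL (Fin 2) ℝ) z)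
  rw [div_le_iff₀ hz0]
  gcongr
  have him : (denom (γ : GL (Fin 2) ℝ) z).im = γ 1 0 * z.im := by simp [denom]
  calc ‖(γ 1 0 : ℂ)‖ = |(γ 1 0 : ℝ)| := by simp
    _ ≤ |(γ 1 0 : ℝ)| * z.im := le_mul_of_one_le_right (abs_nonneg _) hz
    _ = |(denom (γ : GL (Fin 2) ℝ) z).im| := by rw [him, abs_mul, abs_of_pos z.im_pos]
    _ ≤ _ := Complex.abs_im_le_norm _

/-- The three upper triangular representatives of integral matrices of determinant 2 modulo SL₂(ℤ),
chosen by the parity of the bottom row of γ. They reduce the growth of E₂(2τ) at any cusp to that of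
a translate of E₂ at i∞, since upper triangular matrices preserve boundedness there. -/
theorem exists_diagGL_two_mul (γ : SL(2, ℤ)) : ∃ (γ' : SL(2, ℤ)) (B : GL (Fin 2) ℝ),
    B 1 0 = 0 ∧ diagGL 2 * (γ : GL (Fin 2) ℝ) = (γ' : GL (Fin 2) ℝ) * B := by
  rcases Int.even_or_odd' (γ 1 0) with ⟨c, hc | hc⟩
  · obtain ⟨γ', h00, h01, h10, h11⟩ := exists_SL (γ 0 0) (2 * γ 0 1) c (γ 1 1) (by
      linear_combination SL_det γ + γ 0 1 * hc)
    refine ⟨γ', Matrix.GeneralLinearGroup.mkOfDetNeZero !![2, 0; 0, 1] (by simp), rfl, Units.ext ?_⟩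
    show (diagGL 2).val * (γ : GL (Fin 2) ℝ).val = (γ' : GL (Fin 2) ℝ).val * !![2, 0; 0, 1]
    rw [coe_SL, coe_SL, h00, h01, h10, h11, hc, coe_diagGL]
    ext i j
    fin_cases i <;> fin_cases j <;> simp [Matrix.mul_apply, Fin.sum_univ_two] <;> ring
  · rcases Int.even_or_odd' (γ 1 1) with ⟨d, hd | hd⟩
    · obtain ⟨γ', h00, h01, h10, h11⟩ := exists_SL (2 * γ 0 0) (γ 0 1) (γ 1 0) d (by
        linear_combination SL_det γ - γ 0 0 * hd)
      refine ⟨γ', Matrix.GeneralLinearGroup.mkOfDetNeZero !![1, 0; 0, 2] (by simp), rfl, Units.ext ?_⟩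
      show (diagGL 2).val * (γ : GL (Fin 2) ℝ).val = (γ' : GL (Fin 2) ℝ).val * !![1, 0; 0, 2]
      rw [coe_SL, coe_SL, h00, h01, h10, h11, hd, coe_diagGL]
      ext i j
      fin_cases i <;> fin_cases j <;> simp [Matrix.mul_apply, Fin.sum_univ_two] <;> ring
    · obtain ⟨γ', h00, h01, h10, h11⟩ := exists_SL (2 * γ 0 0) (γ 0 1 - γ 0 0) (γ 1 0) (d - c) (by
        linear_combination SL_det γ - γ 0 0 * hd + γ 0 0 * hc)
      refine ⟨γ', Matrix.GeneralLinearGroup.mkOfDetNeZero !![1, 1; 0, 2] (by simp), rfl, Units.ext ?_⟩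
      show (diagGL 2).val * (γ : GL (Fin 2) ℝ).val = (γ' : GL (Fin 2) ℝ).val * !![1, 1; 0, 2]
      rw [coe_SL, coe_SL, h00, h01, h10, h11, hd, hc, coe_diagGL]
      ext i j
      fin_cases i <;> fin_cases j <;> simp [Matrix.mul_apply, Fin.sum_univ_two] <;> ring

/-- In weight 2 the slash by diag(d,1) contributes a factor d, exactly what turns the lower left
entry of γ' into that of γ. Hence E₂(τ) and dE₂(dτ) have the same anomaly, which drops out of
`eisensteinTwo`. -/
theorem D2_slash_diagGL {γ γ' : SL(2, ℤ)} (d : ℕ) [NeZero d] (h0 : γ 1 0 = d * γ' 1 0)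
    (h1 : γ 1 1 = γ' 1 1) :
    EisensteinSeries.D2 γ' ∣[(2 : ℤ)] diagGL d = EisensteinSeries.D2 γ := by
  ext z
  rw [slash_diagGL, EisensteinSeries.D2, EisensteinSeries.D2]
  have hden : denom (γ' : GL (Fin 2) ℝ) (diagGL d • z : ℍ) = denom (γ : GL (Fin 2) ℝ) z := by
    simp [denom, diagGL_smul, h0, h1]
    ring
  rw [hden, h0]
  norm_num
  ring

/-- The modular form `E₂(τ) - 2 E₂(2τ)` of weight `2` on `Γ₀(2)`. -/
def eisensteinTwo : ModularForm (Gamma0GL 2) 2 :=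
  mkModularForm 2 2 (EisensteinSeries.E2 - EisensteinSeries.E2 ∣[(2 : ℤ)] diagGL 2)
    (isQSeries_E2.sub (isQSeries_E2.slash_diagGL 2 2).1).holo
    (fun γ hγ => by
      rw [CongruenceSubgroup.Gamma0_mem, ZMod.intCast_zmod_eq_zero_iff_dvd] at hγ
      obtain ⟨c, hc⟩ := hγ
      obtain ⟨γ', h00, h01, h10, h11⟩ := exists_SL (γ 0 0) (2 * γ 0 1) c (γ 1 1) (by
        push_cast at hc
        linear_combination SL_det γ + γ 0 1 * hc)
      have hmul : diagGL 2 * (γ : GL (Fin 2) ℝ) = (γ' : GL (Fin 2) ℝ) * diagGL 2 := by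
        refine Units.ext ?_
        show (diagGL 2).val * (γ : GL (Fin 2) ℝ).val = (γ' : GL (Fin 2) ℝ).val * (diagGL 2).val
        rw [coe_SL, coe_SL, h00, h01, h10, h11, hc, coe_diagGL]
        simp [mul_comm]
      have h1 := EisensteinSeries.E2_slash_action γ
      have h2 := EisensteinSeries.E2_slash_action γ'
      have h3 : EisensteinSeries.D2 γ' ∣[(2 : ℤ)] diagGL 2 = EisensteinSeries.D2 γ :=
        D2_slash_diagGL 2 (by rw [h10, hc]) h11.symm
      rw [sub_eq_add_neg, SlashAction.add_slash, SlashAction.neg_slash, h1]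
      have h4 : (EisensteinSeries.E2 ∣[(2 : ℤ)] diagGL 2) ∣[(2 : ℤ)] γ
          = EisensteinSeries.E2 ∣[(2 : ℤ)] diagGL 2 -
            (1 / (2 * riemannZeta 2)) • EisensteinSeries.D2 γ := by
        rw [ModularForm.SL_slash, ← SlashAction.slash_mul, hmul, SlashAction.slash_mul,
          ← ModularForm.SL_slash, h2, ← h3, sub_eq_add_neg, SlashAction.add_slash,
          SlashAction.neg_slash, sub_eq_add_neg]
        congr 2
        ext z
        simp [slash_diagGL, mul_left_comm]
      rw [h4]
      abel)
    (fun γ => by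
      obtain ⟨γ', B, hB, hmul⟩ := exists_diagGL_two_mul γ
      rw [sub_eq_add_neg, SlashAction.add_slash, SlashAction.neg_slash, ← sub_eq_add_neg]
      refine (isBoundedAtImInfty_E2_slash γ).sub ?_
      have : (EisensteinSeries.E2 ∣[(2 : ℤ)] diagGL 2) ∣[(2 : ℤ)] γ
          = (EisensteinSeries.E2 ∣[(2 : ℤ)] γ') ∣[(2 : ℤ)] B := by
        rw [ModularForm.SL_slash, ← SlashAction.slash_mul, hmul, SlashAction.slash_mul,
          ← ModularForm.SL_slash]
      rw [this]
      exact (isBoundedAtImInfty_E2_slash γ').slash 2 hB)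

theorem qExpansion_eisensteinTwo : qExpansion 1 eisensteinTwo =
    E2Series - (2 : ℂ) • PowerSeries.expand 2 two_ne_zero E2Series := by
  have h := isQSeries_E2.slash_diagGL 2 2
  show qExpansion 1 (EisensteinSeries.E2 - EisensteinSeries.E2 ∣[(2 : ℤ)] diagGL 2) = _
  rw [isQSeries_E2.qExpansion_sub h.1, h.2, qExpansion_E2]
  norm_num

/-! ### The filtered algebra of quasimodular forms -/

theorem quasimodularForms_mono {M w w' : ℕ} (h : w ≤ w') :
    quasimodularForms M w ≤ quasimodularForms M w' :=
  Submodule.span_mono fun _ ⟨i, k, f, hw, hg⟩ => ⟨i, k, f, hw.trans h, hg⟩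

theorem qExpansion_mem_quasimodularForms {M k w : ℕ} (f : ModularForm (Gamma0GL M) (k : ℤ))
    (h : k ≤ w) : qExpansion 1 f ∈ quasimodularForms M w :=
  Submodule.subset_span ⟨0, k, f, by simpa using h, by simp⟩

theorem one_mem_quasimodularForms (M w : ℕ) [NeZero M] : 1 ∈ quasimodularForms M w := by
  have h : qExpansion 1 ((1 : ModularForm (Gamma0GL M) 0) : ℍ → ℂ) = 1 := qExpansion_one 1
  rw [← h]
  exact qExpansion_mem_quasimodularForms (k := 0) (1 : ModularForm (Gamma0GL M) 0) (Nat.zero_le _)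

theorem mul_mem_quasimodularForms {M w w' : ℕ} [NeZero M] {f g : ℂ⟦X⟧}
    (hf : f ∈ quasimodularForms M w) (hg : g ∈ quasimodularForms M w') :
    f * g ∈ quasimodularForms M (w + w') := by
  induction hf, hg using Submodule.span_induction₂ with
  | mem_mem x y hx hy =>
    obtain ⟨i, k, f, hw, rfl⟩ := hx
    obtain ⟨i', k', f', hw', rfl⟩ := hy
    refine Submodule.subset_span ⟨i + i', k + k',
      (f.mul f').mcast (by push_cast; rfl), by omega, ?_⟩
    have : qExpansion 1 ((f.mul f').mcast (by push_cast; rfl) :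
        ModularForm (Gamma0GL M) ((k + k' : ℕ) : ℤ)) = qExpansion 1 f * qExpansion 1 f' :=
      (isQSeries_modularForm f).qExpansion_mul (isQSeries_modularForm f')
    rw [this]
    ring
  | zero_left y hy => simp
  | zero_right x hx => simp
  | add_left x y z _ _ _ h1 h2 => rw [add_mul]; exact add_mem h1 h2
  | add_right x y z _ _ _ h1 h2 => rw [mul_add]; exact add_mem h1 h2
  | smul_left r x y _ _ h => rw [smul_mul_assoc]; exact Submodule.smul_mem _ _ h
  | smul_right r x y _ _ h => rw [mul_smul_comm]; exact Submodule.smul_mem _ _ h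

theorem pow_mem_quasimodularForms {M w : ℕ} [NeZero M] {f : ℂ⟦X⟧}
    (hf : f ∈ quasimodularForms M w) (n : ℕ) : f ^ n ∈ quasimodularForms M (n * w) := by
  induction n with
  | zero => simpa using one_mem_quasimodularForms M 0
  | succ n ih =>
    rw [pow_succ, Nat.succ_mul]
    exact mul_mem_quasimodularForms ih hf

theorem E2Series_mem_quasimodularForms (M : ℕ) [NeZero M] :
    E2Series ∈ quasimodularForms M 2 := by
  have h : qExpansion 1 ((1 : ModularForm (Gamma0GL M) 0) : ℍ → ℂ) = 1 := qExpansion_one 1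
  exact Submodule.subset_span ⟨1, 0, (1 : ModularForm (Gamma0GL M) 0), le_rfl, by rw [h]; simp⟩

/-! ### The derivation `δ_q` -/

/-- `δ_q` as a derivation. -/
def deltaDer : Derivation ℂ ℂ⟦X⟧ ℂ⟦X⟧ := (PowerSeries.X : ℂ⟦X⟧) • PowerSeries.derivative ℂ

theorem deltaDer_apply (f : ℂ⟦X⟧) : deltaDer f = deltaQ f := rfl

theorem deltaQ_mul (f g : ℂ⟦X⟧) : deltaQ (f * g) = f * deltaQ g + g * deltaQ f := by
  exact deltaDer.leibniz f g

theorem deltaQ_add (f g : ℂ⟦X⟧) : deltaQ (f + g) = deltaQ f + deltaQ g := deltaDer.map_add f g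

theorem deltaQ_smul (c : ℂ) (f : ℂ⟦X⟧) : deltaQ (c • f) = c • deltaQ f := deltaDer.map_smul c f

theorem deltaQ_E2Series_mem (M : ℕ) [NeZero M] :
    deltaQ E2Series ∈ quasimodularForms M 4 := by
  have hE := E2Series_mem_quasimodularForms M
  have h1 := mul_mem_quasimodularForms hE hE
  have h2 := qExpansion_mem_quasimodularForms (w := 4)
    ((ramanujanForm M).mcast (b := ((4 : ℕ) : ℤ)) (by norm_num)) le_rfl
  rw [ModularForm.coe_mcast, qExpansion_ramanujanForm] at h2
  have h3 := add_mem h2 (Submodule.smul_mem _ (12⁻¹ : ℂ) h1)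
  rwa [sub_add_cancel] at h3

/-- On a modular form f of weight k, δ_q f is the Serre derivative plus (k/12)E₂f; on E₂ it is given
by Ramanujan's equation. The Leibniz rule extends this to the generators E₂^i f. -/
theorem deltaQ_mem_quasimodularForms {M w : ℕ} [NeZero M] {f : ℂ⟦X⟧}
    (hf : f ∈ quasimodularForms M w) : deltaQ f ∈ quasimodularForms M (w + 2) := by
  have hE := E2Series_mem_quasimodularForms M
  induction hf using Submodule.span_induction with
  | mem x hx =>
    obtain ⟨i, k, f, hw, rfl⟩ := hx
    have h1 : deltaQ (qExpansion 1 f) ∈ quasimodularForms M (k + 2) := by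
      have h : deltaQ (qExpansion 1 f) =
          qExpansion 1 (serreForm f) + (((k : ℤ) : ℂ) * 12⁻¹) • (E2Series * qExpansion 1 f) := by
        rw [qExpansion_serreForm]; abel
      rw [h]
      refine add_mem ?_ (Submodule.smul_mem _ _ ?_)
      · exact qExpansion_mem_quasimodularForms (k := k + 2) ((serreForm f).mcast (by push_cast; rfl))
          le_rfl
      · rw [add_comm]
        exact mul_mem_quasimodularForms hE (qExpansion_mem_quasimodularForms _ le_rfl)
    have h2 : deltaQ (E2Series ^ i) ∈ quasimodularForms M (2 * i + 2) := by
      rw [← deltaDer_apply, Derivation.leibniz_pow, deltaDer_apply]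
      rcases i with - | i
      · simp
      · refine nsmul_mem ?_ _
        rw [smul_eq_mul, Nat.add_sub_cancel]
        refine quasimodularForms_mono (by omega)
          (mul_mem_quasimodularForms (pow_mem_quasimodularForms hE i) (deltaQ_E2Series_mem M))
    rw [deltaQ_mul]
    refine add_mem ?_ ?_
    · exact quasimodularForms_mono (by omega)
        (mul_mem_quasimodularForms (pow_mem_quasimodularForms hE i) h1)
    · exact quasimodularForms_mono (by omega)
        (mul_mem_quasimodularForms (qExpansion_mem_quasimodularForms f le_rfl) h2)
  | zero => rw [← deltaDer_apply, map_zero]; exact zero_mem _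
  | add x y _ _ hx hy => rw [deltaQ_add]; exact add_mem hx hy
  | smul a x _ hx => rw [deltaQ_smul]; exact Submodule.smul_mem _ _ hx

/-! ### Divisor sums -/

/-- `∑_{n ≥ 1} σ_k(n) q ^ n`. -/
def sigmaSeries (k : ℕ) : ℂ⟦X⟧ :=
  PowerSeries.mk fun n => ((ArithmeticFunction.sigma k n : ℕ) : ℂ)

theorem E2Series_eq : E2Series = 1 - (24 : ℂ) • sigmaSeries 1 := by
  ext n
  rw [E2Series, sigmaSeries, PowerSeries.coeff_mk, map_sub, PowerSeries.coeff_smul,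
    PowerSeries.coeff_mk, PowerSeries.coeff_one, ArithmeticFunction.sigma_one_apply]
  by_cases hn : n = 0
  · simp [hn]
  · simp [hn]

theorem expand_mem_of_forms {d M k : ℕ} [NeZero d] [NeZero M] (hd : d * M = 4)
    (f : ModularForm (Gamma0GL M) (k : ℤ)) :
    PowerSeries.expand d (NeZero.ne d) (qExpansion 1 f) ∈ quasimodularForms 4 k := by
  have h := qExpansion_raiseForm d f
  have h2 := qExpansion_mem_quasimodularForms
    (restrictForm (Gamma0GL_le (dvd_of_eq hd)) (raiseForm d f)) le_rfl
  change qExpansion 1 (raiseForm d f) ∈ _ at h2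
  have hd0 : ((d : ℂ) ^ ((k : ℤ) - 1)) ≠ 0 := zpow_ne_zero _ (by exact_mod_cast NeZero.ne d)
  rw [h] at h2
  exact (Submodule.smul_mem_iff _ hd0).1 h2

theorem expand_E2Series_mem {d : ℕ} (hd : d ∣ 4) :
    PowerSeries.expand d (by rintro rfl; simp at hd) E2Series ∈ quasimodularForms 4 2 := by
  have h1 := E2Series_mem_quasimodularForms 4
  have h2 : PowerSeries.expand 2 two_ne_zero E2Series ∈ quasimodularForms 4 2 := by
    have h : PowerSeries.expand 2 two_ne_zero E2Series
        -- E₂(2τ) is recovered from E₂(τ) and the modular form E₂(τ) - 2E₂(2τ); replacing τ by 2τ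
        -- then gives E₂(4τ).
        = (2⁻¹ : ℂ) • (E2Series - qExpansion 1 (restrictForm
          (Gamma0GL_le (show 2 ∣ 4 by norm_num)) eisensteinTwo)) := by
      show _ = (2⁻¹ : ℂ) • (E2Series - qExpansion 1 eisensteinTwo)
      rw [qExpansion_eisensteinTwo, sub_sub_cancel, inv_smul_smul₀ two_ne_zero]
    rw [h]
    exact Submodule.smul_mem _ _ (sub_mem h1 (qExpansion_mem_quasimodularForms (k := 2) _ le_rfl))
  have h4 : PowerSeries.expand 4 four_ne_zero E2Series ∈ quasimodularForms 4 2 := by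
    have h : PowerSeries.expand 4 four_ne_zero E2Series
        = (2⁻¹ : ℂ) • (PowerSeries.expand 2 two_ne_zero E2Series -
          PowerSeries.expand 2 two_ne_zero (qExpansion 1 eisensteinTwo)) := by
      rw [qExpansion_eisensteinTwo, map_sub, sub_sub_cancel, map_smul,
        inv_smul_smul₀ (two_ne_zero' ℂ), ← PowerSeries.expand_mul]
    rw [h]
    exact Submodule.smul_mem _ _ (sub_mem h2
      (expand_mem_of_forms (k := 2) (d := 2) (M := 2) rfl eisensteinTwo))
  have : d ∈ Nat.divisors 4 := Nat.mem_divisors.2 ⟨hd, by norm_num⟩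
  have hmem : d = 1 ∨ d = 2 ∨ d = 4 := by
    have h : Nat.divisors 4 = {1, 2, 4} := by decide
    simpa [h] using this
  rcases hmem with rfl | rfl | rfl
  · rwa [PowerSeries.expand_one_apply]
  · exact h2
  · exact h4

/-- `∑ σ_k(n) q ^ (d n)` is quasimodular of weight `k + 1` on `Γ₀(4)` for odd `k` and `d ∣ 4`. -/
theorem expand_sigmaSeries_mem {d k : ℕ} (hd : d ∣ 4) (hk : Odd k) :
    PowerSeries.expand d (by rintro rfl; simp at hd) (sigmaSeries k) ∈
      quasimodularForms 4 (k + 1) := by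
  have hd0 : d ≠ 0 := by rintro rfl; simp at hd
  have : NeZero d := ⟨hd0⟩
  rcases Nat.lt_or_ge k 3 with hk3 | hk3
  · obtain rfl : k = 1 := by obtain ⟨r, rfl⟩ := hk; omega
    have h : sigmaSeries 1 = (24⁻¹ : ℂ) • (1 - E2Series) := by
      rw [E2Series_eq, sub_sub_cancel, inv_smul_smul₀ (by norm_num)]
    rw [h, map_smul, map_sub, map_one]
    exact Submodule.smul_mem _ _ (sub_mem (one_mem_quasimodularForms 4 _) (expand_E2Series_mem hd))
  · have hk1 : 3 ≤ k + 1 := by omega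
    have hev : Even (k + 1) := hk.add_one
    obtain ⟨M, hM⟩ := hd
    have : NeZero M := ⟨by rintro rfl; simp at hM⟩
    set c : ℂ := -(2 * ((k + 1 : ℕ) : ℂ) / (bernoulli (k + 1) : ℂ)) with hc
    have hE : qExpansion 1 (ModularForm.E hk1) = 1 + c • sigmaSeries k := by
      ext n
      rw [EisensteinSeries.E_qExpansion_coeff hk1 hev, map_add, PowerSeries.coeff_one,
        PowerSeries.coeff_smul, sigmaSeries, PowerSeries.coeff_mk]
      by_cases hn : n = 0
      · simp [hn]
      · simp [hn, hc]
    -- Solving the Eisenstein series for its divisor sum needs c ≠ 0. A vanishing Bernoulli number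
    -- would make c zero by the convention for division by zero; it is excluded because ζ(2r) is a
    -- multiple of that number and does not vanish.
    have hc0 : c ≠ 0 := by
      intro h0
      have hB : (bernoulli (k + 1) : ℂ) = 0 := by
        by_contra hB
        have : (2 * ((k + 1 : ℕ) : ℂ)) ≠ 0 := by
          exact_mod_cast (by omega : 2 * (k + 1) ≠ 0)
        exact neg_ne_zero.2 (div_ne_zero this hB) h0
      obtain ⟨r, hr⟩ := hev
      have hr0 : r ≠ 0 := by omega
      have hz := riemannZeta_two_mul_nat hr0
      have h2r : k + 1 = 2 * r := by omega
      rw [h2r] at hB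
      rw [hB, mul_zero, zero_div] at hz
      refine riemannZeta_ne_zero_of_one_lt_re ?_ hz
      norm_cast
      omega
    have h : sigmaSeries k = c⁻¹ • (qExpansion 1 (restrictForm (Gamma0GL_le_SL M)
        (ModularForm.E hk1)) - 1) := by
      show _ = c⁻¹ • (qExpansion 1 (ModularForm.E hk1) - 1)
      rw [hE, add_sub_cancel_left, inv_smul_smul₀ hc0]
    rw [h, map_smul, map_sub, map_one]
    exact Submodule.smul_mem _ _ (sub_mem (expand_mem_of_forms hM.symm _)
      (one_mem_quasimodularForms 4 _))

end ModularForms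

/-! ### Congruences between power series -/

section Products

variable {R : Type*} [CommRing R]

/-- Reduction of power series modulo `X ^ n`. -/
def modX (R : Type*) [CommRing R] (n : ℕ) :
    R⟦X⟧ →+* R⟦X⟧ ⧸ Ideal.span {(PowerSeries.X : R⟦X⟧) ^ n} :=
  Ideal.Quotient.mk _

theorem modX_eq_iff {n : ℕ} {f g : R⟦X⟧} :
    modX R n f = modX R n g ↔ ∀ m < n, PowerSeries.coeff m f = PowerSeries.coeff m g := by
  rw [modX, Ideal.Quotient.eq, Ideal.mem_span_singleton, PowerSeries.X_pow_dvd_iff]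
  simp only [map_sub, sub_eq_zero]

theorem ext_modX {f g : R⟦X⟧} (h : ∀ n, modX R n f = modX R n g) : f = g := by
  ext n
  exact modX_eq_iff.1 (h (n + 1)) n n.lt_succ_self

theorem modX_qPoch {n M : ℕ} (hM : n ≤ M) (a : R) {d c : ℕ} (hd : 1 ≤ d) (hc : 1 ≤ c) :
    modX R n (qPoch a d c) = modX R n (qPochPartial a d c M) :=
  modX_eq_iff.2 fun m hm => (coeff_qPochPartial a d c m M hd hc (by omega)).symm

theorem qPochPartial_succ (a : R) (d c n : ℕ) :
    qPochPartial a d c (n + 1) =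
      qPochPartial a d c n * (1 - PowerSeries.C a * PowerSeries.X ^ (d + c * n)) :=
  Finset.prod_range_succ _ _

theorem qPochPartial_double (a : R) (d c n : ℕ) :
    qPochPartial a d c (2 * n) = qPochPartial a d (2 * c) n * qPochPartial a (d + c) (2 * c) n := by
  induction n with
  | zero => simp [qPochPartial]
  | succ n ih =>
    rw [show 2 * (n + 1) = 2 * n + 1 + 1 by ring, qPochPartial_succ, qPochPartial_succ,
      qPochPartial_succ, qPochPartial_succ, ih, show d + c * (2 * n) = d + 2 * c * n by ring,
      show d + c * (2 * n + 1) = d + c + 2 * c * n by ring]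
    ring

/-- Splitting an infinite product into its even and odd factors. -/
theorem qPoch_eq_mul (a : R) {d c : ℕ} (hd : 1 ≤ d) (hc : 1 ≤ c) :
    qPoch a d c = qPoch a d (2 * c) * qPoch a (d + c) (2 * c) := by
  refine ext_modX fun n => ?_
  rw [map_mul, modX_qPoch (M := 2 * n) (by omega) a hd hc, modX_qPoch le_rfl a hd (by omega),
    modX_qPoch le_rfl a (by omega) (by omega), qPochPartial_double, map_mul]

theorem qPoch_mul_qPoch_neg (a : R) {d c : ℕ} (hd : 1 ≤ d) (hc : 1 ≤ c) :
    qPoch a d c * qPoch (-a) d c = qPoch (a ^ 2) (2 * d) (2 * c) := by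
  refine ext_modX fun n => ?_
  rw [map_mul, modX_qPoch le_rfl a hd hc, modX_qPoch le_rfl (-a) hd hc,
    modX_qPoch le_rfl _ (by omega) (by omega), ← map_mul, qPochPartial, qPochPartial, qPochPartial,
    ← Finset.prod_mul_distrib]
  refine congrArg _ (Finset.prod_congr rfl fun i _ => ?_)
  rw [show 2 * d + 2 * c * i = (d + c * i) * 2 by ring, pow_mul, map_pow, map_neg]
  ring

/-- `(-aq;q²)(aq;q)(a²q⁴;q⁴) = (a²q²;q²)(aq²;q²)`. -/
theorem qPoch_neg_odd (a : R) :
    qPoch (-a) 1 2 * qPoch a 1 1 * qPoch (a ^ 2) 4 4 = qPoch (a ^ 2) 2 2 * qPoch a 2 2 := by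
  rw [qPoch_eq_mul a (d := 1) (c := 1) le_rfl le_rfl, qPoch_eq_mul (a ^ 2) (d := 2) (c := 2)
    (by norm_num) (by norm_num), ← qPoch_mul_qPoch_neg a (d := 1) (c := 2) (by norm_num)
    (by norm_num)]
  ring

theorem map_qPoch {R' : Type*} [CommRing R'] (φ : R →+* R') (a : R) (d c : ℕ) :
    PowerSeries.map φ (qPoch a d c) = qPoch (φ a) d c := by
  ext n
  have : PowerSeries.map φ (qPochPartial a d c (n + 1)) = qPochPartial (φ a) d c (n + 1) := by
    simp [qPochPartial]
  simp only [qPoch, PowerSeries.coeff_map, PowerSeries.coeff_mk, ← this]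

/-! ### Inverses of power series with constant term 1. -/

theorem qInv_mul (f : R⟦X⟧) (hf : PowerSeries.constantCoeff f = 1) : qInv f * f = 1 := by
  rw [mul_comm, mul_qInv f hf]

theorem eq_qInv_of_mul_eq_one {f g : R⟦X⟧} (hf : PowerSeries.constantCoeff f = 1)
    (h : f * g = 1) : g = qInv f := by
  calc g = qInv f * f * g := by rw [qInv_mul f hf, one_mul]
    _ = qInv f := by rw [mul_assoc, h, mul_one]

theorem constantCoeff_qInv (f : R⟦X⟧) : PowerSeries.constantCoeff (qInv f) = 1 := by
  simp [qInv, PowerSeries.constantCoeff_invOfUnit]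

theorem qInv_mul_distrib {f g : R⟦X⟧} (hf : PowerSeries.constantCoeff f = 1)
    (hg : PowerSeries.constantCoeff g = 1) : qInv (f * g) = qInv f * qInv g := by
  refine (eq_qInv_of_mul_eq_one (by simp [hf, hg]) ?_).symm
  rw [mul_mul_mul_comm, mul_qInv f hf, mul_qInv g hg, one_mul]

theorem map_qInv {R' : Type*} [CommRing R'] (φ : R →+* R') {f : R⟦X⟧}
    (hf : PowerSeries.constantCoeff f = 1) :
    PowerSeries.map φ (qInv f) = qInv (PowerSeries.map φ f) := by
  refine eq_qInv_of_mul_eq_one ?_ ?_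
  · rw [← PowerSeries.coeff_zero_eq_constantCoeff_apply] at hf ⊢
    simp [hf]
  · rw [← map_mul, mul_qInv f hf, map_one]

theorem qInv_one : qInv (1 : R⟦X⟧) = 1 :=
  (eq_qInv_of_mul_eq_one (by simp) (by simp)).symm

/-! ### Logarithmic derivatives of infinite products -/

/-- `∑_{N ≥ 1} a ^ N X ^ N`. -/
def geomTail (a : R) : R⟦X⟧ := PowerSeries.mk fun N => if N = 0 then 0 else a ^ N

theorem one_sub_mul_geomTail (a : R) :
    (1 - PowerSeries.C a * PowerSeries.X) * geomTail a = PowerSeries.C a * PowerSeries.X := by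
  have h : PowerSeries.C a * PowerSeries.X * geomTail a =
      geomTail a * PowerSeries.C a * PowerSeries.X := by ring
  rw [sub_mul, one_mul, h]
  ext (_ | n)
  · simp [geomTail]
  · rw [map_sub, PowerSeries.coeff_succ_mul_X, PowerSeries.coeff_succ_mul_X,
      PowerSeries.coeff_mul_C, PowerSeries.coeff_C]
    rcases n with _ | n <;> simp [geomTail, pow_succ]

theorem expand_geomTail (a : R) {k : ℕ} (hk : k ≠ 0) :
    (1 - PowerSeries.C a * PowerSeries.X ^ k) * PowerSeries.expand k hk (geomTail a) =
      PowerSeries.C a * PowerSeries.X ^ k := by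
  simpa [map_mul, map_sub, PowerSeries.expand_C, PowerSeries.expand_X] using
    congrArg (PowerSeries.expand k hk) (one_sub_mul_geomTail a)

variable [Algebra ℂ R]

theorem derivation_qInv (D : Derivation ℂ R⟦X⟧ R⟦X⟧) {f e : R⟦X⟧}
    (hf : PowerSeries.constantCoeff f = 1) (h : D f = f * e) : D (qInv f) = -(qInv f * e) := by
  have h1 : f * D (qInv f) + qInv f * D f = 0 := by
    rw [← smul_eq_mul, ← smul_eq_mul, ← D.leibniz, mul_qInv f hf, D.map_one_eq_zero]
  rw [h] at h1
  linear_combination qInv f * h1 + (-(D (qInv f)) - qInv f * e) * mul_qInv f hf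

theorem derivation_qPochPartial (D : Derivation ℂ R⟦X⟧ R⟦X⟧) (a : R) {c : ℕ} (hc : c ≠ 0)
    (κ : ℕ → ℂ) (hκ : ∀ i, D (PowerSeries.C a * PowerSeries.X ^ (c + c * i)) =
      κ i • (PowerSeries.C a * PowerSeries.X ^ (c + c * i))) (M : ℕ) :
    D (qPochPartial a c c M) = -(qPochPartial a c c M * ∑ i ∈ Finset.range M,
      κ i • PowerSeries.expand (c + c * i) (by omega) (geomTail a)) := by
  induction M with
  | zero => simp [qPochPartial]
  | succ M ih =>
    have hg := expand_geomTail a (k := c + c * M) (by omega)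
    rw [qPochPartial_succ, D.leibniz, ih, Finset.sum_range_succ, map_sub, D.map_one_eq_zero, hκ]
    simp only [smul_eq_mul, Algebra.smul_def]
    linear_combination (qPochPartial a c c M * algebraMap ℂ R⟦X⟧ (κ M)) * hg

/-- Each monomial aX^k is an eigenvector of D, so the factor 1 - aX^k contributes to the logarithmic
derivative minus its eigenvalue times ∑_{r≥1} a^r X^{kr}. Adding over the factors and collecting by
k = c(i+1) gives a divisor sum. Preservation of X^n-divisibility lets D pass to the truncated
products. The formulation serves both δ_q, with eigenvalue k, and z d/dz, with constant eigenvalue.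
-/
theorem derivation_qPoch (D : Derivation ℂ R⟦X⟧ R⟦X⟧)
    (hD : ∀ (n : ℕ) (f : R⟦X⟧), PowerSeries.X ^ n ∣ f → PowerSeries.X ^ n ∣ D f)
    (a : R) {c : ℕ} (hc : c ≠ 0)
    (κ : ℕ → ℂ) (hκ : ∀ i, D (PowerSeries.C a * PowerSeries.X ^ (c + c * i)) =
      κ i • (PowerSeries.C a * PowerSeries.X ^ (c + c * i))) :
    D (qPoch a c c) = qPoch a c c * -(PowerSeries.expand c hc (PowerSeries.mk fun N =>
      ∑ p ∈ N.divisorsAntidiagonal, κ (p.1 - 1) • a ^ p.2)) := by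
  have hmod : ∀ {n f g}, modX R n f = modX R n g → modX R n (D f) = modX R n (D g) := by
    intro n f g h
    rw [modX, Ideal.Quotient.eq, Ideal.mem_span_singleton] at h ⊢
    rw [← map_sub]
    exact hD n _ h
  refine ext_modX fun n => ?_
  have h1 := modX_qPoch (le_refl n) a (show 1 ≤ c by omega) (show 1 ≤ c by omega)
  rw [hmod h1, derivation_qPochPartial D a hc κ hκ, mul_neg, map_neg, map_neg, map_mul, map_mul, h1]
  congr 2
  rw [modX_eq_iff]
  intro m hm
  rw [map_sum]
  simp only [PowerSeries.coeff_smul, PowerSeries.coeff_expand, geomTail, PowerSeries.coeff_mk]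
  by_cases hcm : c ∣ m
  swap
  · rw [if_neg hcm]
    refine Finset.sum_eq_zero fun i _ => ?_
    rw [if_neg, smul_zero]
    exact fun h => hcm ((Dvd.intro (1 + i) (by ring)).trans h)
  obtain ⟨k, rfl⟩ := hcm
  rw [if_pos (Dvd.intro _ rfl), Nat.mul_div_cancel_left _ (by omega)]
  have hlt : k < n := lt_of_le_of_lt (Nat.le_mul_of_pos_left k (by omega)) hm
  rcases Nat.eq_zero_or_pos k with rfl | hk
  · simp
  rw [Nat.sum_divisorsAntidiagonal (fun d r => κ (d - 1) • a ^ r), ← Finset.sum_filter_add_sum_filter_not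
    (Finset.range n) (fun i => i + 1 ∣ k)]
  -- Only factors with c(i+1) ∣ ck reach degree ck; the rest of the sum is reindexed by the divisor
  -- d = i + 1 of k.
  have hz : ∑ i ∈ Finset.range n with ¬ (i + 1 ∣ k), (κ i • if c + c * i ∣ c * k then
      (if c * k / (c + c * i) = 0 then (0 : R) else a ^ (c * k / (c + c * i))) else 0) = 0 := by
    refine Finset.sum_eq_zero fun i hi => ?_
    rw [if_neg, smul_zero]
    rw [Finset.mem_filter] at hi
    rw [show c + c * i = c * (i + 1) by ring]
    exact fun h => hi.2 (Nat.dvd_of_mul_dvd_mul_left (by omega) h)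
  rw [hz, add_zero]
  refine Finset.sum_bij' (fun i _ => i + 1) (fun d _ => d - 1) ?_ ?_ ?_ ?_ ?_
  · intro i hi
    rw [Finset.mem_filter] at hi
    exact Nat.mem_divisors.2 ⟨hi.2, by omega⟩
  · intro d hd
    have h1 := Nat.pos_of_mem_divisors hd
    have h2 := Nat.divisor_le hd
    rw [Finset.mem_filter, Finset.mem_range, Nat.sub_add_cancel h1]
    exact ⟨by omega, Nat.dvd_of_mem_divisors hd⟩
  · intro i _
    simp
  · intro d hd
    exact Nat.sub_add_cancel (Nat.pos_of_mem_divisors hd)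
  · intro i hi
    rw [Finset.mem_filter] at hi
    have h2 : c * k / (c + c * i) = k / (i + 1) := by
      rw [show c + c * i = c * (i + 1) by ring, Nat.mul_div_mul_left _ _ (by omega)]
    rw [if_pos, if_neg, h2, Nat.add_sub_cancel]
    · rw [h2]
      exact (Nat.div_pos (Nat.le_of_dvd hk hi.2) (by omega)).ne'
    · rw [show c + c * i = c * (i + 1) by ring]
      exact Nat.mul_dvd_mul_left _ hi.2

end Products

/-! ### The prefactor -/

/-- `(-q;q²)_∞ / (q²;q²)_∞`. -/
def prefactor : ℂ⟦X⟧ := qPoch (-1 : ℂ) 1 2 * qInv (qPoch (1 : ℂ) 2 2)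

/-- The case a = 1 of `qPoch_neg_odd`. In this form all products are of the type (q^c;q^c)_∞ with c
∣ 4, so the logarithmic derivative of the prefactor can be read off. -/
theorem prefactor_mul : prefactor * (qPoch 1 1 1 * qPoch 1 4 4) = qPoch 1 2 2 := by
  have h := qPoch_neg_odd (1 : ℂ)
  simp only [one_pow] at h
  have h2 := qInv_mul (qPoch (1 : ℂ) 2 2) (constantCoeff_qPoch _ _ _ (by norm_num))
  rw [prefactor]
  linear_combination qInv (qPoch (1 : ℂ) 2 2) * h + qPoch 1 2 2 * h2

theorem constantCoeff_prefactor : PowerSeries.constantCoeff prefactor = 1 := by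
  rw [prefactor, map_mul, constantCoeff_qInv, constantCoeff_qPoch _ _ _ le_rfl, one_mul]

theorem deltaQ_qPoch {c : ℕ} (hc : c ≠ 0) :
    deltaQ (qPoch 1 c c) = qPoch 1 c c * -((c : ℂ) • PowerSeries.expand c hc (sigmaSeries 1)) := by
  have h := derivation_qPoch deltaDer (fun n f hf => ?_) (1 : ℂ) hc (fun i => (c + c * i : ℕ)) ?_
  · rw [deltaDer_apply] at h
    rw [h]
    congr 2
    rw [← map_smul]
    congr 1
    ext N
    simp only [PowerSeries.coeff_mk, PowerSeries.coeff_smul, sigmaSeries, one_pow, smul_eq_mul,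
      mul_one]
    rw [Nat.sum_divisorsAntidiagonal (fun d _ => ((c + c * (d - 1) : ℕ) : ℂ)),
      ArithmeticFunction.sigma_one_apply, Nat.cast_sum, Finset.mul_sum]
    refine Finset.sum_congr rfl fun d hd => ?_
    obtain ⟨e, rfl⟩ := Nat.exists_eq_succ_of_ne_zero (Nat.pos_of_mem_divisors hd).ne'
    rw [Nat.succ_eq_add_one, Nat.add_sub_cancel]
    push_cast
    ring
  · rw [PowerSeries.X_pow_dvd_iff] at hf ⊢
    intro m hm
    rw [deltaDer_apply, coeff_deltaQ, hf m hm, mul_zero]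
  · intro i
    rw [deltaDer_apply]
    ext n
    simp only [map_one, one_mul, coeff_deltaQ, PowerSeries.coeff_smul, PowerSeries.coeff_X_pow,
      smul_eq_mul]
    split_ifs with h <;> simp [h]

/-- The logarithmic derivative of `(-q;q²)_∞ / (q²;q²)_∞`. -/
def logDerivPrefactor : ℂ⟦X⟧ :=
  sigmaSeries 1 - 2 * PowerSeries.expand 2 two_ne_zero (sigmaSeries 1) +
    4 * PowerSeries.expand 4 four_ne_zero (sigmaSeries 1)

theorem deltaQ_prefactor : deltaQ prefactor = prefactor * logDerivPrefactor := by
  have h := congrArg deltaQ prefactor_mul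
  rw [deltaQ_mul, deltaQ_mul, deltaQ_qPoch one_ne_zero, deltaQ_qPoch two_ne_zero,
    deltaQ_qPoch four_ne_zero, PowerSeries.expand_one_apply, ← prefactor_mul] at h
  have hu : IsUnit (qPoch (1 : ℂ) 1 1 * qPoch 1 4 4) := by
    rw [PowerSeries.isUnit_iff_constantCoeff]
    simp [constantCoeff_qPoch]
  refine hu.mul_right_cancel ?_
  simp only [Algebra.smul_def, Nat.cast_one, map_one, Nat.cast_ofNat, map_ofNat] at h
  rw [logDerivPrefactor]
  linear_combination h

theorem logDerivPrefactor_mem : logDerivPrefactor ∈ quasimodularForms 4 2 := by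
  have h := fun (d : ℕ) (hd : d ∣ 4) => expand_sigmaSeries_mem (k := 1) hd odd_one
  have h1 := h 1 (by norm_num)
  have h2 := Submodule.smul_mem _ (2 : ℂ) (h 2 (by norm_num))
  have h4 := Submodule.smul_mem _ (4 : ℂ) (h 4 (by norm_num))
  rw [PowerSeries.expand_one_apply] at h1
  have := add_mem (sub_mem h1 h2) h4
  simp only [Algebra.smul_def, map_ofNat] at this
  exact this

theorem coeff_zero_logDerivPrefactor : PowerSeries.coeff 0 logDerivPrefactor = 0 := by
  have h := congrArg (PowerSeries.coeff 0) deltaQ_prefactor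
  rw [coeff_deltaQ, PowerSeries.coeff_zero_eq_constantCoeff_apply,
    PowerSeries.coeff_zero_eq_constantCoeff_apply, map_mul, constantCoeff_prefactor] at h
  simpa using h.symm

theorem mem_commonSpace_iff {N : ℕ} {g : ℂ⟦X⟧} :
    g ∈ commonSpace N ↔ ∃ f ∈ quasimodularForms 4 (2 * N), PowerSeries.coeff 0 f = 0 ∧
      g = prefactor * f := by
  rw [commonSpace, Submodule.mem_map]
  constructor
  · rintro ⟨f, ⟨hf, h0⟩, rfl⟩
    exact ⟨f, hf, h0, rfl⟩
  · rintro ⟨f, hf, h0, rfl⟩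
    exact ⟨f, ⟨hf, h0⟩, rfl⟩

theorem commonSpace_mono {N N' : ℕ} (h : N ≤ N') : commonSpace N ≤ commonSpace N' := by
  intro g hg
  obtain ⟨f, hf, h0, rfl⟩ := mem_commonSpace_iff.1 hg
  exact mem_commonSpace_iff.2 ⟨f, quasimodularForms_mono (by omega) hf, h0, rfl⟩

/-- With P the prefactor and L its logarithmic derivative, δ_q(Pf) = P(δ_q f + fL), and L has weight
2. -/
theorem deltaQ_mem_commonSpace {N : ℕ} {g : ℂ⟦X⟧} (hg : g ∈ commonSpace N) :
    deltaQ g ∈ commonSpace (N + 1) := by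
  obtain ⟨f, hf, h0, rfl⟩ := mem_commonSpace_iff.1 hg
  refine mem_commonSpace_iff.2 ⟨deltaQ f + f * logDerivPrefactor, ?_, ?_, ?_⟩
  · refine add_mem (deltaQ_mem_quasimodularForms hf) ?_
    exact mul_mem_quasimodularForms hf logDerivPrefactor_mem
  · rw [PowerSeries.coeff_zero_eq_constantCoeff_apply] at h0
    rw [map_add, coeff_deltaQ]
    simp [h0]
  · rw [deltaQ_mul, deltaQ_prefactor]
    ring

theorem iterate_deltaQ_mem_commonSpace {N : ℕ} {g : ℂ⟦X⟧} (hg : g ∈ commonSpace N) (m : ℕ) :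
    deltaQ^[m] g ∈ commonSpace (N + m) := by
  induction m with
  | zero => exact hg
  | succ m ih =>
    rw [Function.iterate_succ_apply']
    exact deltaQ_mem_commonSpace ih

/-! ### The operator `z d/dz` and evaluation at `z = 1` -/

/-- The linear map `T ^ m ↦ m T ^ m`. -/
def laurentEulerLinear : ℂ[T;T⁻¹] →ₗ[ℂ] ℂ[T;T⁻¹] where
  toFun f := .ofCoeff (Finsupp.onFinset f.coeff.support (fun m => (m : ℂ) * f.coeff m)
    fun m hm => by rw [Finsupp.mem_support_iff]; exact right_ne_zero_of_mul hm)
  map_add' f g := by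
    ext m
    simp [AddMonoidAlgebra.coeff_add, mul_add]
  map_smul' a f := by
    ext m
    simp only [RingHom.id_apply, AddMonoidAlgebra.coeff_smul_apply, Finsupp.onFinset_apply,
      smul_eq_mul]
    ring

theorem coeff_laurentEulerLinear (f : ℂ[T;T⁻¹]) (m : ℤ) :
    (laurentEulerLinear f).coeff m = m * f.coeff m := rfl

theorem laurentEulerLinear_monomial (a : ℂ) (n : ℤ) :
    laurentEulerLinear (LaurentPolynomial.C a * LaurentPolynomial.T n) =
      (n : ℂ) • (LaurentPolynomial.C a * LaurentPolynomial.T n) := by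
  ext m
  rw [coeff_laurentEulerLinear, AddMonoidAlgebra.coeff_smul_apply, ← LaurentPolynomial.single_eq_C_mul_T,
    AddMonoidAlgebra.coeff_single, Finsupp.single_apply, smul_eq_mul]
  split_ifs with h <;> simp [h]

/-- The derivation `z d/dz` of the ring of Laurent polynomials. -/
def laurentEuler : Derivation ℂ ℂ[T;T⁻¹] ℂ[T;T⁻¹] :=
  Derivation.mk' laurentEulerLinear fun f g => by
    induction f using LaurentPolynomial.induction_on' with
    | add p q hp hq => simp only [add_mul, map_add, hp, hq, add_smul, smul_add]; abel
    | C_mul_T n a =>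
      induction g using LaurentPolynomial.induction_on' with
      | add p q hp hq => simp only [mul_add, map_add, hp, hq, add_smul, smul_add]; abel
      | C_mul_T m b =>
        have : LaurentPolynomial.C a * LaurentPolynomial.T n *
            (LaurentPolynomial.C b * LaurentPolynomial.T m) =
            LaurentPolynomial.C (a * b) * LaurentPolynomial.T (n + m) := by
          rw [map_mul, LaurentPolynomial.T_add]; ring
        rw [laurentEulerLinear_monomial, laurentEulerLinear_monomial, this,
          laurentEulerLinear_monomial, ← this]
        simp only [smul_eq_mul, Algebra.smul_def, Int.cast_add, map_add]
        ring

theorem coeff_laurentEuler (f : ℂ[T;T⁻¹]) (m : ℤ) :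
    (laurentEuler f).coeff m = m * f.coeff m := rfl

theorem coeff_iterate_laurentEuler (f : ℂ[T;T⁻¹]) (k : ℕ) (m : ℤ) :
    (laurentEuler^[k] f).coeff m = (m : ℂ) ^ k * f.coeff m := by
  induction k with
  | zero => simp
  | succ k ih => rw [Function.iterate_succ_apply', coeff_laurentEuler, ih, pow_succ]; ring

theorem iterate_laurentEuler_eq (f : ℂ[T;T⁻¹]) (k : ℕ) :
    laurentEuler^[k] f = ((laurentEuler : ℂ[T;T⁻¹] →ₗ[ℂ] ℂ[T;T⁻¹]) ^ k) f :=
  (Module.End.pow_apply _ _ _).symm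

/-- Evaluation at `z = 1`. -/
def evalOne : ℂ[T;T⁻¹] →+* ℂ := LaurentPolynomial.eval₂ (RingHom.id ℂ) 1

@[simp]
theorem evalOne_T (m : ℤ) : evalOne (LaurentPolynomial.T m) = 1 := by
  simp [evalOne]

@[simp]
theorem evalOne_C (a : ℂ) : evalOne (LaurentPolynomial.C a) = a := by
  simp [evalOne]

theorem evalOne_eq_finsum (f : ℂ[T;T⁻¹]) : evalOne f = ∑ᶠ m, f.coeff m := by
  induction f using LaurentPolynomial.induction_on' with
  | add p q hp hq =>
    rw [map_add, hp, hq, ← finsum_add_distrib p.coeff.hasFiniteSupport q.coeff.hasFiniteSupport]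
    rfl
  | C_mul_T n a =>
    rw [map_mul, evalOne_C, evalOne_T, finsum_eq_single _ n]
    · rw [← LaurentPolynomial.single_eq_C_mul_T, AddMonoidAlgebra.coeff_single,
        Finsupp.single_eq_same, mul_one]
    · intro m hm
      rw [← LaurentPolynomial.single_eq_C_mul_T, AddMonoidAlgebra.coeff_single,
        Finsupp.single_eq_of_ne hm]

/-- The derivation `z d/dz`, acting on the coefficients of a power series in `q`. -/
def zDer : Derivation ℂ ℂ[T;T⁻¹]⟦X⟧ ℂ[T;T⁻¹]⟦X⟧ :=
  Derivation.mk'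
    { toFun := fun F => PowerSeries.mk fun n => laurentEuler (PowerSeries.coeff n F)
      map_add' := fun F G => by ext1 n; simp
      map_smul' := fun a F => by
        ext1 n
        simp only [PowerSeries.coeff_mk, RingHom.id_apply]
        rw [PowerSeries.coeff_smul, PowerSeries.coeff_smul, PowerSeries.coeff_mk]
        exact laurentEuler.map_smul a _ }
    fun F G => by
      ext1 n
      simp only [LinearMap.coe_mk, AddHom.coe_mk, PowerSeries.coeff_mk, smul_eq_mul, map_add,
        PowerSeries.coeff_mul, map_sum, Derivation.leibniz, Finset.sum_add_distrib]
      congr 1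
      rw [← Finset.Nat.sum_antidiagonal_swap]
      rfl

theorem coeff_zDer (F : ℂ[T;T⁻¹]⟦X⟧) (n : ℕ) :
    PowerSeries.coeff n (zDer F) = laurentEuler (PowerSeries.coeff n F) := by
  simp [zDer]

theorem coeff_iterate_zDer (F : ℂ[T;T⁻¹]⟦X⟧) (k n : ℕ) :
    PowerSeries.coeff n (zDer^[k] F) = laurentEuler^[k] (PowerSeries.coeff n F) := by
  induction k with
  | zero => rfl
  | succ k ih => rw [Function.iterate_succ_apply', Function.iterate_succ_apply', coeff_zDer, ih]

/-- The series of the `k`-th moments of the coefficients of `F` as Laurent polynomials in `z`. -/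
def moment (F : ℂ[T;T⁻¹]⟦X⟧) (k : ℕ) : ℂ⟦X⟧ := PowerSeries.map evalOne (zDer^[k] F)

theorem momentSeries_zqCoeff (F : ℂ[T;T⁻¹]⟦X⟧) (k : ℕ) :
    momentSeries (zqCoeff F) k = moment F k := by
  ext n
  simp only [momentSeries, moment, PowerSeries.coeff_mk, PowerSeries.coeff_map, coeff_iterate_zDer,
    evalOne_eq_finsum, coeff_iterate_laurentEuler, zqCoeff]

theorem moment_zero (F : ℂ[T;T⁻¹]⟦X⟧) : moment F 0 = PowerSeries.map evalOne F := rfl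

theorem moment_succ (F : ℂ[T;T⁻¹]⟦X⟧) (k : ℕ) : moment F (k + 1) = moment (zDer F) k := rfl

theorem moment_add (F G : ℂ[T;T⁻¹]⟦X⟧) (k : ℕ) : moment (F + G) k = moment F k + moment G k := by
  rw [moment, iterate_map_add, map_add]; rfl

theorem moment_neg (F : ℂ[T;T⁻¹]⟦X⟧) (k : ℕ) : moment (-F) k = -moment F k := by
  rw [moment, iterate_map_neg, map_neg]; rfl

/-- Power series in `q` as power series with constant Laurent polynomials as coefficients. -/
def constZ : ℂ⟦X⟧ →+* ℂ[T;T⁻¹]⟦X⟧ := PowerSeries.map LaurentPolynomial.C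

theorem laurentEuler_C (a : ℂ) : laurentEuler (LaurentPolynomial.C a) = 0 :=
  laurentEuler.map_algebraMap a

theorem laurentEuler_T (m : ℤ) : laurentEuler (LaurentPolynomial.T m) = m • LaurentPolynomial.T m := by
  have := laurentEulerLinear_monomial 1 m
  rw [map_one, one_mul] at this
  rw [← Int.cast_smul_eq_zsmul ℂ]
  exact this

theorem zDer_constZ (f : ℂ⟦X⟧) : zDer (constZ f) = 0 := by
  ext1 n
  rw [coeff_zDer, constZ, PowerSeries.coeff_map, laurentEuler_C, map_zero]

theorem moment_constZ_mul (f : ℂ⟦X⟧) (F : ℂ[T;T⁻¹]⟦X⟧) (k : ℕ) :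
    moment (constZ f * F) k = f * moment F k := by
  induction k generalizing F with
  | zero =>
    rw [moment_zero, moment_zero, map_mul]
    congr 1
    ext n
    simp [constZ]
  | succ k ih =>
    rw [moment_succ, moment_succ, ← ih, zDer.leibniz, zDer_constZ, smul_zero, add_zero, smul_eq_mul]

/-! ### Series whose moments are quasimodular -/

/-- The `k`-th moments of `F` are quasimodular forms of weight at most `w + k`. -/
def QuasimodularMoments (w : ℕ) (F : ℂ[T;T⁻¹]⟦X⟧) : Prop :=
  ∀ k, moment F k ∈ quasimodularForms 4 (w + k)

namespace QuasimodularMoments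

variable {w w' : ℕ} {F G e : ℂ[T;T⁻¹]⟦X⟧}

theorem add (hF : QuasimodularMoments w F) (hG : QuasimodularMoments w G) :
    QuasimodularMoments w (F + G) := fun k => by
  rw [moment_add]
  exact add_mem (hF k) (hG k)

theorem neg (hF : QuasimodularMoments w F) : QuasimodularMoments w (-F) := fun k => by
  rw [moment_neg]
  exact neg_mem (hF k)

/-- Leibniz rule; the weights vary in the induction because z d/dz raises them by one. The
hypotheses concern only moments of order at most n, so that the lemma applies in `of_logDeriv`,
where the moments of one factor are known only up to the current order. -/
theorem moment_mul_mem {n : ℕ} : ∀ {k : ℕ}, k ≤ n → ∀ {w w' : ℕ} {F G : ℂ[T;T⁻¹]⟦X⟧},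
    (∀ k ≤ n, moment F k ∈ quasimodularForms 4 (w + k)) →
    (∀ k ≤ n, moment G k ∈ quasimodularForms 4 (w' + k)) →
    moment (F * G) k ∈ quasimodularForms 4 (w + w' + k) := by
  induction n with
  | zero =>
    intro k hk w w' F G hF hG
    obtain rfl : k = 0 := by omega
    rw [moment_zero, map_mul]
    have := mul_mem_quasimodularForms (hF 0 le_rfl) (hG 0 le_rfl)
    rwa [show w + 0 + (w' + 0) = w + w' + 0 by ring] at this
  | succ n ih =>
    intro k hk w w' F G hF hG
    rcases k with _ | k
    · exact ih (Nat.zero_le _) (fun k hk => hF k (by omega)) (fun k hk => hG k (by omega))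
    · rw [moment_succ, zDer.leibniz, smul_eq_mul, smul_eq_mul, moment_add]
      refine add_mem ?_ ?_
      · have := ih (k := k) (by omega) (w := w) (w' := w' + 1) (F := F) (G := zDer G)
          (fun k hk => hF k (by omega)) (fun k hk => by
            have := hG (k + 1) (by omega)
            rwa [moment_succ, show w' + (k + 1) = w' + 1 + k by ring] at this)
        rwa [show w + (w' + 1) + k = w + w' + (k + 1) by ring] at this
      · have := ih (k := k) (by omega) (w := w') (w' := w + 1) (F := G) (G := zDer F)
          (fun k hk => hG k (by omega)) (fun k hk => by
            have := hF (k + 1) (by omega)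
            rwa [moment_succ, show w + (k + 1) = w + 1 + k by ring] at this)
        rwa [show w' + (w + 1) + k = w + w' + (k + 1) by ring] at this

theorem mul (hF : QuasimodularMoments w F) (hG : QuasimodularMoments w' G) :
    QuasimodularMoments (w + w') (F * G) := fun k =>
  moment_mul_mem (le_refl k) (fun k _ => hF k) (fun k _ => hG k)

theorem mul_weight_zero (hF : QuasimodularMoments 0 F) (hG : QuasimodularMoments 0 G) :
    QuasimodularMoments 0 (F * G) := by
  have := hF.mul hG
  rwa [Nat.add_zero] at this

/-- Integrating a logarithmic derivative. -/
theorem of_logDeriv (he : QuasimodularMoments 1 e) (h0 : PowerSeries.map evalOne F = 1)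
    (h : zDer F = F * e) : QuasimodularMoments 0 F := by
  suffices H : ∀ n, ∀ k ≤ n, moment F k ∈ quasimodularForms 4 (0 + k) from fun k => H k k le_rfl
  intro n
  have h1 : moment F 0 ∈ quasimodularForms 4 (0 + 0) := by
    rw [moment_zero, h0]
    exact one_mem_quasimodularForms 4 _
  induction n with
  | zero =>
    intro k hk
    obtain rfl : k = 0 := by omega
    exact h1
  | succ n ih =>
    rintro (_ | k) hk
    · exact h1
    -- The moment of order k+1 of F is the k-th moment of F·e, which involves only the moments of F
    -- of order at most k.
    · rw [moment_succ, h]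
      have := moment_mul_mem (n := n) (k := k) (by omega) ih (fun k _ => he k)
      rwa [show 0 + 1 + k = 0 + (k + 1) by ring] at this

theorem T (m : ℤ) : QuasimodularMoments 0 (PowerSeries.C (LaurentPolynomial.T m)) := fun k => by
  have : moment (PowerSeries.C (LaurentPolynomial.T m)) k = ((m : ℂ) ^ k) • (1 : ℂ⟦X⟧) := by
    ext n
    rw [moment, PowerSeries.coeff_map, coeff_iterate_zDer, PowerSeries.coeff_smul,
      PowerSeries.coeff_C, PowerSeries.coeff_one]
    split_ifs with hn
    · rw [evalOne_eq_finsum, finsum_eq_single _ m]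
      · simp [coeff_iterate_laurentEuler]
      · intro x hx
        rw [coeff_iterate_laurentEuler, LaurentPolynomial.T_apply, if_neg (Ne.symm hx), mul_zero]
    · rw [iterate_map_zero, map_zero, smul_zero]
  rw [this]
  exact Submodule.smul_mem _ _ (one_mem_quasimodularForms 4 _)

end QuasimodularMoments

/-! ### The crank-type quotients -/

/-- `(q^c;q^c)² / ((z^s q^c;q^c) (z^{-s} q^c;q^c))`. -/
def crankQuotient (s : ℤ) (c : ℕ) : ℂ[T;T⁻¹]⟦X⟧ :=
  qPoch 1 c c ^ 2 * qInv (qPoch (LaurentPolynomial.T s) c c * qPoch (LaurentPolynomial.T (-s)) c c)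

/-- The logarithmic derivative of `crankQuotient s c` with respect to `z d/dz`. -/
def crankLogDeriv (s : ℤ) (c : ℕ) (hc : c ≠ 0) : ℂ[T;T⁻¹]⟦X⟧ :=
  PowerSeries.expand c hc (PowerSeries.mk fun N => ∑ p ∈ N.divisorsAntidiagonal,
    (s : ℂ) • (LaurentPolynomial.T s ^ p.2 - LaurentPolynomial.T (-s) ^ p.2))

variable {s : ℤ} {c : ℕ}

theorem constZ_qPoch (a : ℂ) (d c : ℕ) :
    constZ (qPoch a d c) = qPoch (LaurentPolynomial.C a) d c := map_qPoch _ _ _ _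

theorem constantCoeff_crankDenominator (hc : c ≠ 0) : PowerSeries.constantCoeff
    (qPoch (LaurentPolynomial.T s : ℂ[T;T⁻¹]) c c * qPoch (LaurentPolynomial.T (-s)) c c) = 1 := by
  rw [map_mul, constantCoeff_qPoch _ _ _ (by omega), constantCoeff_qPoch _ _ _ (by omega), one_mul]

theorem constantCoeff_crankQuotient (hc : c ≠ 0) :
    PowerSeries.constantCoeff (crankQuotient s c) = 1 := by
  rw [crankQuotient, map_mul, constantCoeff_qInv, map_pow, constantCoeff_qPoch _ _ _ (by omega),
    one_pow, one_mul]

theorem map_evalOne_crankQuotient (hc : c ≠ 0) :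
    PowerSeries.map evalOne (crankQuotient s c) = 1 := by
  rw [crankQuotient, map_mul, map_qInv _ (constantCoeff_crankDenominator hc), map_pow, map_mul,
    map_qPoch, map_qPoch, map_qPoch, map_one, evalOne_T, evalOne_T, ← sq]
  refine mul_qInv _ ?_
  rw [map_pow, constantCoeff_qPoch _ _ _ (by omega), one_pow]

theorem zDer_C_T_mul_X_pow (m : ℤ) (k : ℕ) :
    zDer (PowerSeries.C (LaurentPolynomial.T m) * PowerSeries.X ^ k) =
      (m : ℂ) • (PowerSeries.C (LaurentPolynomial.T m) * PowerSeries.X ^ k) := by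
  ext1 n
  rw [coeff_zDer, PowerSeries.coeff_smul, PowerSeries.coeff_C_mul, PowerSeries.coeff_X_pow]
  split_ifs
  · rw [mul_one, laurentEuler_T, Int.cast_smul_eq_zsmul]
  · simp

theorem zDer_qPoch_T (hc : c ≠ 0) (m : ℤ) :
    zDer (qPoch (LaurentPolynomial.T m) c c) = qPoch (LaurentPolynomial.T m) c c *
      -(PowerSeries.expand c hc (PowerSeries.mk fun N => ∑ p ∈ N.divisorsAntidiagonal,
        (m : ℂ) • LaurentPolynomial.T m ^ p.2)) := by
  refine derivation_qPoch zDer (fun n F hF => ?_) _ hc (fun _ => (m : ℂ))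
    fun i => zDer_C_T_mul_X_pow m _
  rw [PowerSeries.X_pow_dvd_iff] at hF ⊢
  intro k hk
  rw [coeff_zDer, hF k hk, map_zero]

theorem zDer_crankQuotient (hc : c ≠ 0) :
    zDer (crankQuotient s c) = crankQuotient s c * crankLogDeriv s c hc := by
  have h1 := zDer_qPoch_T hc s
  have h2 := zDer_qPoch_T hc (-s)
  have h0 : zDer (qPoch 1 c c ^ 2) = 0 := by
    rw [← map_one LaurentPolynomial.C, ← constZ_qPoch, ← map_pow, zDer_constZ]
  have h3 : zDer (qPoch (LaurentPolynomial.T s : ℂ[T;T⁻¹]) c c *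
      qPoch (LaurentPolynomial.T (-s)) c c) =
      (qPoch (LaurentPolynomial.T s : ℂ[T;T⁻¹]) c c * qPoch (LaurentPolynomial.T (-s)) c c) *
        -crankLogDeriv s c hc := by
    have h4 : crankLogDeriv s c hc = (PowerSeries.expand c hc (PowerSeries.mk fun N =>
        ∑ p ∈ N.divisorsAntidiagonal, (s : ℂ) • LaurentPolynomial.T s ^ p.2)) +
        PowerSeries.expand c hc (PowerSeries.mk fun N => ∑ p ∈ N.divisorsAntidiagonal,
        ((-s : ℤ) : ℂ) • LaurentPolynomial.T (-s) ^ p.2) := by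
      rw [crankLogDeriv, ← map_add]
      congr 1
      ext1 N
      simp only [PowerSeries.coeff_mk, map_add, ← Finset.sum_add_distrib, smul_sub, Int.cast_neg,
        neg_smul]
      simp only [sub_eq_add_neg]
    rw [zDer.leibniz, h1, h2, h4, smul_eq_mul, smul_eq_mul]
    ring
  rw [crankQuotient, zDer.leibniz, h0, smul_zero, add_zero,
    derivation_qInv zDer (constantCoeff_crankDenominator hc) h3, smul_eq_mul]
  ring

theorem zDer_expand (hc : c ≠ 0) (F : ℂ[T;T⁻¹]⟦X⟧) :
    zDer (PowerSeries.expand c hc F) = PowerSeries.expand c hc (zDer F) := by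
  ext1 n
  rw [coeff_zDer, PowerSeries.coeff_expand, PowerSeries.coeff_expand, coeff_zDer]
  split_ifs <;> simp

theorem moment_expand (hc : c ≠ 0) (F : ℂ[T;T⁻¹]⟦X⟧) (k : ℕ) :
    moment (PowerSeries.expand c hc F) k = PowerSeries.expand c hc (moment F k) := by
  induction k generalizing F with
  | zero => exact PowerSeries.map_expand ..
  | succ k ih => rw [moment_succ, zDer_expand, ih, moment_succ]

theorem evalOne_iterate_laurentEuler_T (k : ℕ) (m : ℤ) :
    evalOne (laurentEuler^[k] (LaurentPolynomial.T m)) = (m : ℂ) ^ k := by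
  rw [evalOne_eq_finsum, finsum_eq_single _ m]
  · simp [coeff_iterate_laurentEuler]
  · intro x hx
    rw [coeff_iterate_laurentEuler, LaurentPolynomial.T_apply, if_neg (Ne.symm hx), mul_zero]

/-- The term s(z^{sr} - z^{-sr}) has k-th moment s^{k+1} r^k (1 - (-1)^k). The antisymmetry in z
kills the even orders, leaving only divisor sums σ_k with k odd, which are the quasimodular ones. -/
theorem moment_crankLogDeriv (hc : c ≠ 0) (k : ℕ) :
    moment (crankLogDeriv s c hc) k =
      ((s : ℂ) ^ (k + 1) * (1 - (-1) ^ k)) • PowerSeries.expand c hc (sigmaSeries k) := by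
  rw [crankLogDeriv, moment_expand, ← map_smul]
  congr 1
  ext N
  rw [moment, PowerSeries.coeff_map, coeff_iterate_zDer, PowerSeries.coeff_mk,
    PowerSeries.coeff_smul, sigmaSeries, PowerSeries.coeff_mk, iterate_laurentEuler_eq, map_sum,
    map_sum,
    ArithmeticFunction.sigma_apply, Nat.cast_sum, smul_eq_mul, Finset.mul_sum,
    ← Nat.sum_divisorsAntidiagonal' (fun _ r => (s : ℂ) ^ (k + 1) * (1 - (-1) ^ k) * ((r ^ k : ℕ) : ℂ))]
  refine Finset.sum_congr rfl fun p _ => ?_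
  rw [map_smul, map_sub, ← iterate_laurentEuler_eq, ← iterate_laurentEuler_eq, LaurentPolynomial.T_pow, LaurentPolynomial.T_pow,
    LaurentPolynomial.smul_eq_C_mul, map_mul, evalOne_C, map_sub, evalOne_iterate_laurentEuler_T,
    evalOne_iterate_laurentEuler_T]
  have : (((p.2 : ℤ) * -s : ℤ) : ℂ) = (-1) * (p.2 * s) := by push_cast; ring
  rw [this, mul_pow]
  push_cast
  ring

theorem quasimodularMoments_crankLogDeriv (hc : c ≠ 0) (hd : c ∣ 4) :
    QuasimodularMoments 1 (crankLogDeriv s c hc) := fun k => by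
  rw [moment_crankLogDeriv]
  rcases Nat.even_or_odd k with hk | hk
  · rw [hk.neg_one_pow, sub_self, mul_zero, zero_smul]
    exact zero_mem _
  · rw [add_comm 1 k]
    exact Submodule.smul_mem _ _ (expand_sigmaSeries_mem hd hk)

theorem quasimodularMoments_crankQuotient (hd : c ∣ 4) :
    QuasimodularMoments 0 (crankQuotient s c) :=
  have hc : c ≠ 0 := by rintro rfl; simp at hd
  .of_logDeriv (quasimodularMoments_crankLogDeriv hc hd) (map_evalOne_crankQuotient hc)
    (zDer_crankQuotient hc)

/-- For the prefactor P: P(q;q) = (q²;q²)/(q⁴;q⁴) = (q²;q⁴). In the two analogues below, P(q²;q²) =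
(-q;q²) and P(q⁴;q⁴) = (q²;q²)/(q;q) = 1/(q;q²). -/
theorem C1_eq : C1 = constZ prefactor * crankQuotient 1 1 := by
  have h : prefactor * qPoch 1 1 1 = qPoch 1 2 4 := by
    refine (PowerSeries.isUnit_iff_constantCoeff.2 ?_ : IsUnit (qPoch (1 : ℂ) 4 4)).mul_right_cancel ?_
    · simp [constantCoeff_qPoch]
    · rw [mul_assoc, prefactor_mul, qPoch_eq_mul (1 : ℂ) (d := 2) (c := 2) (by norm_num) (by norm_num)]
  have h2 := congrArg constZ h
  rw [map_mul, constZ_qPoch, constZ_qPoch, map_one] at h2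
  rw [C1, crankQuotient, ← h2]
  ring

theorem C2_eq : C2 = constZ prefactor * crankQuotient 1 2 := by
  have h : prefactor * qPoch 1 2 2 = qPoch (-1) 1 2 := by
    rw [prefactor, mul_assoc, qInv_mul _ (constantCoeff_qPoch _ _ _ (by norm_num)), mul_one]
  have h2 := congrArg constZ h
  rw [map_mul, constZ_qPoch, constZ_qPoch, map_one, map_neg, map_one] at h2
  rw [C2, crankQuotient, ← h2]
  ring

theorem C4_eq : C4 = constZ prefactor * crankQuotient 1 4 := by
  have h : prefactor * qPoch 1 4 4 * qPoch 1 1 2 = 1 := by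
    refine (PowerSeries.isUnit_iff_constantCoeff.2 ?_ : IsUnit (qPoch (1 : ℂ) 2 2)).mul_right_cancel ?_
    · simp [constantCoeff_qPoch]
    · have := prefactor_mul
      rw [qPoch_eq_mul (1 : ℂ) (d := 1) (c := 1) le_rfl le_rfl] at this
      linear_combination this
  have h2 := congrArg constZ h
  rw [map_mul, map_mul, constZ_qPoch, constZ_qPoch, map_one, map_one] at h2
  rw [C4, crankQuotient, mul_assoc (qPoch 1 1 2), qInv_mul_distrib
    (constantCoeff_qPoch _ _ _ le_rfl) (constantCoeff_crankDenominator four_ne_zero),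
    ← eq_qInv_of_mul_eq_one (constantCoeff_qPoch _ _ _ le_rfl) ((mul_comm _ _).trans h2)]
  ring

theorem coeff_zero_moment {F : ℂ[T;T⁻¹]⟦X⟧} (hF : PowerSeries.constantCoeff F = 1) {k : ℕ}
    (hk : k ≠ 0) : PowerSeries.coeff 0 (moment F k) = 0 := by
  obtain ⟨k, rfl⟩ := Nat.exists_eq_succ_of_ne_zero hk
  rw [moment, PowerSeries.coeff_map, coeff_iterate_zDer,
    PowerSeries.coeff_zero_eq_constantCoeff_apply, hF, Function.iterate_succ_apply,
    laurentEuler.map_one_eq_zero, iterate_map_zero, map_zero]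

theorem iterate_deltaQ_moment_mem {m j N : ℕ} (hj : 1 ≤ j) (hN : j + m ≤ N) (hd : c ∣ 4) :
    deltaQ^[m] (momentSeries (zqCoeff (constZ prefactor * crankQuotient s c)) (2 * j)) ∈
      commonSpace N := by
  refine commonSpace_mono hN (iterate_deltaQ_mem_commonSpace ?_ m)
  rw [momentSeries_zqCoeff, moment_constZ_mul]
  refine mem_commonSpace_iff.2 ⟨_, ?_, coeff_zero_moment
    (constantCoeff_crankQuotient (s := s) (c := c) ?_) (by omega), rfl⟩
  · simpa using quasimodularMoments_crankQuotient (s := s) hd (2 * j)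
  · rintro rfl
    simp at hd

/-! ### Partitions without repeated odd parts, as multisets -/

/-- Multisets of positive integers in which no odd number is repeated. -/
def oddDistinct : Set (Multiset ℕ) := {ν | 0 ∉ ν ∧ ∀ i, Odd i → ν.count i ≤ 1}

/-- `⌈l / 2⌉` for the largest part `l`. -/
def halfSup (ν : Multiset ℕ) : ℕ := (ν.sup + 1) / 2

/-- The `M₂`-rank. -/
def msRank (ν : Multiset ℕ) : ℤ := (halfSup ν : ℤ) - Multiset.card ν

theorem msRank_zero : msRank 0 = 0 := rfl

/-- The right-hand bound is t for even t and t - 1 for odd t: exactly the condition that t can be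
adjoined as a largest part without repeating an odd part. -/
theorem two_mul_halfSup_le {ν : Multiset ℕ} {t : ℕ} :
    2 * halfSup ν ≤ t ↔ ∀ x ∈ ν, x ≤ 2 * (t / 2) := by
  rw [← Multiset.sup_le, halfSup]
  omega

theorem finite_oddDistinct_sum (n : ℤ) : {ν ∈ oddDistinct | (ν.sum : ℤ) = n}.Finite := by
  rcases lt_or_ge n 0 with hn | hn
  · refine Set.Finite.subset Set.finite_empty fun ν hν => ?_
    have := hν.2
    omega
  lift n to ℕ using hn
  refine (Set.finite_range (fun p : n.Partition => p.parts)).subset fun ν hν => ?_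
  refine ⟨⟨ν, fun {i} hi => Nat.pos_of_ne_zero ?_, by exact_mod_cast hν.2⟩, rfl⟩
  rintro rfl
  exact hν.1.1 hi

/-- The partitions of `n` without repeated odd parts. -/
def oddDistinctFinset (n : ℤ) : Finset (Multiset ℕ) := (finite_oddDistinct_sum n).toFinset

theorem mem_oddDistinctFinset {n : ℤ} {ν : Multiset ℕ} :
    ν ∈ oddDistinctFinset n ↔ ν ∈ oddDistinct ∧ (ν.sum : ℤ) = n := by
  simp [oddDistinctFinset]

/-! ### Removing the first two columns -/

/-- Add two to every part of `ν`, then add `⌊c/2⌋ - #ν` parts `2` and `c mod 2` parts `1`. -/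
def addColumns (ν : Multiset ℕ) (c : ℕ) : Multiset ℕ :=
  ν.map (· + 2) + Multiset.replicate ((c - 2 * Multiset.card ν) / 2) 2 + Multiset.replicate (c % 2) 1

section addColumns

variable {ν : Multiset ℕ} {c : ℕ}

theorem sum_addColumns (h : 2 * Multiset.card ν ≤ c) : (addColumns ν c).sum = ν.sum + c := by
  simp only [addColumns, Multiset.sum_add, Multiset.sum_map_add, Multiset.map_id', Multiset.map_const',
    Multiset.sum_replicate, smul_eq_mul]
  omega

theorem card_addColumns (h : 2 * Multiset.card ν ≤ c) :
    Multiset.card (addColumns ν c) = (c + 1) / 2 := by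
  simp only [addColumns, Multiset.card_add, Multiset.card_map, Multiset.card_replicate]
  omega

theorem mem_addColumns {x : ℕ} : x ∈ addColumns ν c ↔
    (∃ y ∈ ν, y + 2 = x) ∨ (2 ≤ c - 2 * Multiset.card ν ∧ x = 2) ∨ c % 2 = 1 ∧ x = 1 := by
  simp only [addColumns, Multiset.mem_add, Multiset.mem_map, Multiset.mem_replicate, or_assoc]
  refine or_congr_right (or_congr ?_ ?_)
  · refine and_congr_left fun _ => ?_
    omega
  · refine and_congr_left fun _ => ?_
    omega

/-- Two new columns raise ⌈l/2⌉ by one, also when ν is empty, provided some part is created; this is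
where c ≠ 0 enters. The equality is checked by comparing upper bounds. -/
theorem halfSup_addColumns (h : 2 * Multiset.card ν ≤ c) (hc : c ≠ 0) :
    halfSup (addColumns ν c) = halfSup ν + 1 := by
  have key : ∀ t, 2 * halfSup (addColumns ν c) ≤ t ↔ 2 * (halfSup ν + 1) ≤ t := by
    intro t
    rw [two_mul_halfSup_le]
    constructor
    · intro H
      have h2 : 2 ≤ t := by
        by_contra ht
        rcases Multiset.empty_or_exists_mem ν with rfl | ⟨y, hy⟩
        · rcases Nat.mod_two_eq_zero_or_one c with h2 | h2
          · have := H 2 (mem_addColumns.2 (Or.inr (Or.inl ⟨by simp; omega, rfl⟩)))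
            omega
          · have := H 1 (mem_addColumns.2 (Or.inr (Or.inr ⟨h2, rfl⟩)))
            omega
        · have := H _ (mem_addColumns.2 (Or.inl ⟨y, hy, rfl⟩))
          omega
      have h3 : 2 * halfSup ν ≤ t - 2 := by
        rw [two_mul_halfSup_le]
        intro y hy
        have := H _ (mem_addColumns.2 (Or.inl ⟨y, hy, rfl⟩))
        omega
      omega
    · intro H x hx
      have h3 : 2 * halfSup ν ≤ t - 2 := by omega
      rw [two_mul_halfSup_le] at h3
      rcases mem_addColumns.1 hx with ⟨y, hy, rfl⟩ | ⟨_, rfl⟩ | ⟨_, rfl⟩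
      · have := h3 y hy
        omega
      · omega
      · omega
  have h1 := (key _).1 le_rfl
  have h2 := (key _).2 le_rfl
  omega

theorem addColumns_zero_zero : addColumns 0 0 = 0 := rfl

theorem count_addColumns (hν : 0 ∉ ν) (x : ℕ) :
    (addColumns ν c).count x = (if 2 < x then ν.count (x - 2) else 0) +
      (if x = 2 then (c - 2 * Multiset.card ν) / 2 else 0) + (if x = 1 then c % 2 else 0) := by
  rw [addColumns, Multiset.count_add, Multiset.count_add, Multiset.count_replicate,
    Multiset.count_replicate]
  congr 2
  · split_ifs with h
    · obtain ⟨y, rfl⟩ : ∃ y, x = y + 2 := ⟨x - 2, by omega⟩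
      rw [Nat.add_sub_cancel]
      exact Multiset.count_map_eq_count' _ _ (add_left_injective 2) _
    · rw [Multiset.count_eq_zero, Multiset.mem_map]
      rintro ⟨y, hy, rfl⟩
      have : y = 0 := by omega
      exact hν (this ▸ hy)
  · simp only [eq_comm]
  · simp only [eq_comm]

theorem addColumns_mem (hν : ν ∈ oddDistinct) : addColumns ν c ∈ oddDistinct := by
  refine ⟨fun h0 => ?_, fun i hi => ?_⟩
  · rcases mem_addColumns.1 h0 with ⟨y, _, h⟩ | ⟨_, h⟩ | ⟨_, h⟩ <;> omega
  · rw [count_addColumns hν.1]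
    obtain ⟨j, rfl⟩ := hi
    rcases j with _ | j
    · simp
      omega
    · have h1 := hν.2 (2 * j + 1) ⟨j, rfl⟩
      rw [if_pos (by omega), if_neg (by omega), if_neg (by omega),
        show 2 * (j + 1) + 1 - 2 = 2 * j + 1 by omega]
      omega

/-- The multiplicities of the parts above 2 recover ν; those of 2 and 1 then recover the quotient
and the remainder of c modulo 2. -/
theorem addColumns_injOn :
    Set.InjOn (fun x : Multiset ℕ × ℕ => addColumns x.1 x.2)
      {x | 0 ∉ x.1 ∧ 2 * Multiset.card x.1 ≤ x.2} := by
  rintro ⟨ν, c⟩ ⟨hν, hc⟩ ⟨ν', c'⟩ ⟨hν', hc'⟩ h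
  simp only at hν hc hν' hc' h
  have hcount := fun x => congrArg (Multiset.count x) h
  simp only [count_addColumns hν, count_addColumns hν'] at hcount
  have h1 : ν = ν' := by
    ext x
    rcases Nat.eq_zero_or_pos x with rfl | hx
    · rw [Multiset.count_eq_zero_of_notMem hν, Multiset.count_eq_zero_of_notMem hν']
    · have := hcount (x + 2)
      rw [if_pos (show 2 < x + 2 by omega), if_pos (show 2 < x + 2 by omega)] at this
      simpa [hx.ne'] using this
  subst h1
  have h2 := hcount 2
  have h3 := hcount 1
  simp at h2 h3
  rw [Prod.mk.injEq]
  exact ⟨rfl, by omega⟩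

/-- Here c is the number of cells in the first two columns of μ. Since the part 1 occurs at most
once, its multiplicity is c mod 2. -/
theorem exists_eq_addColumns {μ : Multiset ℕ} (hμ : μ ∈ oddDistinct) :
    ∃ ν ∈ oddDistinct, ∃ c, 2 * Multiset.card ν ≤ c ∧ addColumns ν c = μ := by
  have key : ∀ μ : Multiset ℕ, 0 ∉ μ → ∃ ν : Multiset ℕ, ∃ i j, 0 ∉ ν ∧
      μ = ν.map (· + 2) + Multiset.replicate i 2 + Multiset.replicate j 1 := by
    intro μ
    induction μ using Multiset.induction with
    | empty => exact fun _ => ⟨0, 0, 0, by simp, by simp⟩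
    | cons a μ ih =>
      intro h0
      rw [Multiset.mem_cons, not_or] at h0
      obtain ⟨ν, i, j, hν, rfl⟩ := ih h0.2
      rcases lt_trichotomy a 2 with h | rfl | h
      · obtain rfl : a = 1 := by omega
        refine ⟨ν, i, j + 1, hν, ?_⟩
        rw [Multiset.replicate_succ, Multiset.add_cons]
      · refine ⟨ν, i + 1, j, hν, ?_⟩
        rw [Multiset.replicate_succ, Multiset.add_cons, Multiset.cons_add]
      · refine ⟨(a - 2) ::ₘ ν, i, j, ?_, ?_⟩
        · rw [Multiset.mem_cons, not_or]
          exact ⟨by omega, hν⟩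
        · rw [Multiset.map_cons, Multiset.cons_add, Multiset.cons_add,
            show a - 2 + 2 = a by omega]
  obtain ⟨ν, i, j, hν, rfl⟩ := key μ hμ.1
  have hj : j ≤ 1 := by
    have := hμ.2 1 odd_one
    rw [Multiset.count_add, Multiset.count_replicate_self] at this
    omega
  refine ⟨ν, ⟨hν, fun x hx => ?_⟩, 2 * Multiset.card ν + 2 * i + j, by omega, ?_⟩
  · have h1 := hμ.2 (x + 2) (by simpa [Nat.odd_add] using hx)
    rw [Multiset.count_add, Multiset.count_add,
      Multiset.count_map_eq_count' _ _ (add_left_injective 2) x] at h1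
    omega
  · rw [addColumns, show (2 * Multiset.card ν + 2 * i + j - 2 * Multiset.card ν) / 2 = i by omega,
      show (2 * Multiset.card ν + 2 * i + j) % 2 = j by omega]

end addColumns

/-! ### Removing the largest part -/

/-- Add the part `t`, unless `t = 0`. -/
def addPart (ν : Multiset ℕ) (t : ℕ) : Multiset ℕ := if t = 0 then ν else t ::ₘ ν

section addPart

variable {ν : Multiset ℕ} {t : ℕ}

theorem sum_addPart : (addPart ν t).sum = ν.sum + t := by
  rw [addPart]
  split_ifs with h
  · simp [h]
  · rw [Multiset.sum_cons, add_comm]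

theorem card_addPart (ht : t ≠ 0) : Multiset.card (addPart ν t) = Multiset.card ν + 1 := by
  rw [addPart, if_neg ht, Multiset.card_cons]

theorem sup_addPart (h : 2 * halfSup ν ≤ t) : (addPart ν t).sup = t := by
  have h1 : ν.sup ≤ t := by
    rw [halfSup] at h
    omega
  rw [addPart]
  split_ifs with h
  · omega
  · rw [Multiset.sup_cons]
    exact sup_of_le_left h1

theorem addPart_mem (hν : ν ∈ oddDistinct) (h : 2 * halfSup ν ≤ t) : addPart ν t ∈ oddDistinct := by
  rw [addPart]
  split_ifs with ht
  · exact hν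
  rw [two_mul_halfSup_le] at h
  refine ⟨fun h0 => ?_, fun i hi => ?_⟩
  · rcases Multiset.mem_cons.1 h0 with h1 | h1
    · exact ht h1.symm
    · exact hν.1 h1
  · rw [Multiset.count_cons]
    split_ifs with hit
    · subst hit
      rw [Multiset.count_eq_zero_of_notMem]
      intro hmem
      have := h i hmem
      obtain ⟨j, rfl⟩ := hi
      omega
    · exact hν.2 i hi

theorem eq_zero_of_halfSup (hν : 0 ∉ ν) (h : halfSup ν = 0) : ν = 0 := by
  refine Multiset.eq_zero_of_forall_notMem fun x hx => ?_
  have h1 := Multiset.le_sup hx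
  rw [halfSup] at h
  have : x = 0 := by omega
  exact hν (this ▸ hx)

theorem addPart_injOn :
    Set.InjOn (fun x : Multiset ℕ × ℕ => addPart x.1 x.2)
      {x | 0 ∉ x.1 ∧ 2 * halfSup x.1 ≤ x.2} := by
  rintro ⟨ν, t⟩ ⟨hν, ht⟩ ⟨ν', t'⟩ ⟨hν', ht'⟩ h
  simp only at hν ht hν' ht' h
  have h1 := congrArg Multiset.sup h
  rw [sup_addPart ht, sup_addPart ht'] at h1
  subst h1
  rw [Prod.mk.injEq]
  refine ⟨?_, rfl⟩
  rw [addPart, addPart] at h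
  split_ifs at h with h0
  · exact h
  · exact (Multiset.cons_inj_right t).1 h

theorem sup_mem_of_ne_zero {μ : Multiset ℕ} (h : μ ≠ 0) : μ.sup ∈ μ := by
  induction μ using Multiset.induction with
  | empty => exact absurd rfl h
  | cons a μ ih =>
    rw [Multiset.sup_cons, Multiset.mem_cons]
    by_cases h0 : μ = 0
    · left
      simp [h0]
    · rcases le_total a μ.sup with h1 | h1
      · right
        rw [sup_of_le_right h1]
        exact ih h0
      · left
        exact sup_of_le_left h1

/-- Remove one copy of the largest part t. If t is odd it is not repeated, so the other parts are at
most t - 1, as the condition on `halfSup` demands. -/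
theorem exists_eq_addPart {μ : Multiset ℕ} (hμ : μ ∈ oddDistinct) :
    ∃ ν ∈ oddDistinct, ∃ t, 2 * halfSup ν ≤ t ∧ addPart ν t = μ := by
  by_cases h0 : μ = 0
  · exact ⟨0, ⟨by simp, by simp⟩, 0, by simp [halfSup], by simp [addPart, h0]⟩
  have hmem := sup_mem_of_ne_zero h0
  obtain ⟨ν, hν⟩ := Multiset.exists_cons_of_mem hmem
  set t := μ.sup with ht
  have ht0 : t ≠ 0 := fun h => hμ.1 (h ▸ hmem)
  refine ⟨ν, ⟨fun h => hμ.1 ?_, fun i hi => ?_⟩, t, ?_, ?_⟩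
  · rw [hν]
    exact Multiset.mem_cons_of_mem h
  · refine le_trans ?_ (hμ.2 i hi)
    rw [hν]
    exact Multiset.count_le_count_cons _ _ _
  · rw [two_mul_halfSup_le]
    intro x hx
    have h1 : x ≤ t := Multiset.le_sup (hν ▸ Multiset.mem_cons_of_mem hx)
    rcases Nat.even_or_odd t with he | ho
    · rw [Nat.two_mul_div_two_of_even he]
      exact h1
    · have hne : x ≠ t := by
        rintro rfl
        have h2 := hμ.2 _ ho
        rw [hν, Multiset.count_cons_self] at h2
        have := Multiset.one_le_count_iff_mem.2 hx
        omega
      obtain ⟨j, hj⟩ := ho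
      omega
  · rw [addPart, if_neg ht0, hν]

end addPart

/-! ### Counting by rank -/

/-- Number of partitions of `n` without repeated odd parts and with `M₂`-rank at most `m`. -/
def numRankLE (m n : ℤ) : ℤ := ((oddDistinctFinset n).filter (msRank · ≤ m)).card

/-- Number of partitions of `n` without repeated odd parts and with `M₂`-rank at least `m`. -/
def numRankGE (m n : ℤ) : ℤ := ((oddDistinctFinset n).filter (m ≤ msRank ·)).card

theorem numRankLE_add_numRankGE (m n : ℤ) :
    numRankLE m n + numRankGE (m + 1) n = (oddDistinctFinset n).card := by
  rw [numRankLE, numRankGE, ← Finset.card_filter_add_card_filter_not (s := oddDistinctFinset n)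
    (msRank · ≤ m), Nat.cast_add]
  simp only [not_le, Int.add_one_le_iff]

/-- Pairs `(ν, c)` encoding both a partition with a prescribed first column and a partition with a
prescribed largest part. -/
def rankPairs (m n : ℤ) : Set (Multiset ℕ × ℤ) :=
  {x | x.1 ∈ oddDistinct ∧ (x.1.sum : ℤ) + x.2 = n ∧ 2 * (Multiset.card x.1 : ℤ) ≤ x.2 ∧
    2 * (halfSup x.1 : ℤ) - 2 * m - 1 ≤ x.2}

/-- For c ≠ 0 the partition built from (ν, c) has ⌊(c+1)/2⌋ parts and half-length `halfSup ν + 1`,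
so rank at most m+1 is the last inequality in `rankPairs`. For c = 0 the half-length does not
increase, and that inequality reads 0 ≤ m instead of 0 ≤ m+1; hence the clause on the empty
partition. -/
theorem image_addColumns (m n : ℤ) :
    (fun x : Multiset ℕ × ℤ => addColumns x.1 x.2.toNat) '' rankPairs m n =
      {μ ∈ oddDistinct | (μ.sum : ℤ) = n ∧ msRank μ ≤ m + 1 ∧ (μ = 0 → 0 ≤ m)} := by
  ext μ
  constructor
  · rintro ⟨⟨ν, c⟩, ⟨hν, hsum, hc, hm⟩, rfl⟩
    simp only at hν hsum hc hm
    lift c to ℕ using by omega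
    simp only [Int.toNat_natCast]
    have hc' : 2 * Multiset.card ν ≤ c := by exact_mod_cast hc
    refine ⟨addColumns_mem hν, ?_, ?_, ?_⟩
    · rw [sum_addColumns hc']
      exact_mod_cast hsum
    · by_cases h0 : c = 0
      · subst h0
        have h1 : ν = 0 := Multiset.card_eq_zero.1 (by omega)
        subst h1
        rw [addColumns_zero_zero, msRank_zero]
        simp [halfSup] at hm
        omega
      · rw [msRank, halfSup_addColumns hc' h0, card_addColumns hc']
        push_cast
        omega
    · intro h0
      have h1 := congrArg Multiset.card h0
      rw [card_addColumns hc', Multiset.card_zero] at h1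
      omega
  · rintro ⟨hμ, hsum, hr, h0⟩
    obtain ⟨ν, hν, c, hc, rfl⟩ := exists_eq_addColumns hμ
    refine ⟨(ν, (c : ℤ)), ⟨hν, ?_, ?_, ?_⟩, by simp⟩
    · rw [sum_addColumns hc] at hsum
      simp only
      omega
    · simp only
      omega
    · by_cases hc0 : c = 0
      · subst hc0
        have h1 : ν = 0 := Multiset.card_eq_zero.1 (by omega)
        subst h1
        have := h0 addColumns_zero_zero
        simp [halfSup]
        omega
      · rw [msRank, halfSup_addColumns hc hc0, card_addColumns hc] at hr
        push_cast at hr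
        simp only
        omega

/-- With the new part t = c + 2m + 1, the last inequality in `rankPairs` says that t may be adjoined
as largest part, and 2#ν ≤ c says that the rank is at least m. The two inequalities thus exchange
roles compared with `image_addColumns`. For t = 0 no part is added, which again shifts the condition
on the empty partition by one. -/
theorem image_addPart (m n : ℤ) :
    (fun x : Multiset ℕ × ℤ => addPart x.1 (x.2 + 2 * m + 1).toNat) '' rankPairs m n =
      {μ ∈ oddDistinct | (μ.sum : ℤ) = n + 2 * m + 1 ∧ m ≤ msRank μ ∧ (μ = 0 → m ≤ -1)} := by
  ext μ
  constructor
  · rintro ⟨⟨ν, c⟩, ⟨hν, hsum, hc, hm⟩, rfl⟩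
    simp only at hν hsum hc hm
    obtain ⟨t, ht⟩ : ∃ t : ℕ, (t : ℤ) = c + 2 * m + 1 := ⟨(c + 2 * m + 1).toNat, by omega⟩
    simp only [← ht, Int.toNat_natCast]
    have ht' : 2 * halfSup ν ≤ t := by omega
    refine ⟨addPart_mem hν ht', ?_, ?_, ?_⟩
    · rw [sum_addPart]
      omega
    · by_cases h0 : t = 0
      · subst h0
        have h1 : ν = 0 := eq_zero_of_halfSup hν.1 (by omega)
        subst h1
        simp only [addPart, if_true, msRank_zero]
        simp at hc
        omega
      · rw [msRank, halfSup, sup_addPart ht', card_addPart h0]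
        push_cast
        omega
    · intro h0
      have h1 := congrArg Multiset.sup h0
      rw [sup_addPart ht'] at h1
      simp at h1
      omega
  · rintro ⟨hμ, hsum, hr, h0⟩
    obtain ⟨ν, hν, t, ht, rfl⟩ := exists_eq_addPart hμ
    rw [sum_addPart] at hsum
    refine ⟨(ν, (t : ℤ) - 2 * m - 1), ⟨hν, ?_, ?_, ?_⟩, ?_⟩
    · simp only
      omega
    · by_cases ht0 : t = 0
      · subst ht0
        have h1 : ν = 0 := eq_zero_of_halfSup hν.1 (by omega)
        subst h1
        have := h0 (by simp [addPart])
        simp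
        omega
      · rw [msRank, halfSup, sup_addPart ht, card_addPart ht0] at hr
        push_cast at hr
        simp only
        omega
    · simp only
      omega
    · simp only
      congr 1
      omega

theorem injOn_addColumns_rankPairs (m n : ℤ) :
    Set.InjOn (fun x : Multiset ℕ × ℤ => addColumns x.1 x.2.toNat) (rankPairs m n) := by
  rintro ⟨ν, c⟩ ⟨hν, _, hc, _⟩ ⟨ν', c'⟩ ⟨hν', _, hc', _⟩ h
  simp only at hν hc hν' hc' h
  have := addColumns_injOn (x₁ := (ν, c.toNat)) ⟨hν.1, by dsimp only; omega⟩
    (x₂ := (ν', c'.toNat)) ⟨hν'.1, by dsimp only; omega⟩ h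
  rw [Prod.mk.injEq] at this ⊢
  exact ⟨this.1, by omega⟩

theorem injOn_addPart_rankPairs (m n : ℤ) :
    Set.InjOn (fun x : Multiset ℕ × ℤ => addPart x.1 (x.2 + 2 * m + 1).toNat) (rankPairs m n) := by
  rintro ⟨ν, c⟩ ⟨hν, _, _, hc⟩ ⟨ν', c'⟩ ⟨hν', _, _, hc'⟩ h
  simp only at hν hc hν' hc' h
  have := addPart_injOn (x₁ := (ν, (c + 2 * m + 1).toNat)) ⟨hν.1, by dsimp only; omega⟩
    (x₂ := (ν', (c' + 2 * m + 1).toNat)) ⟨hν'.1, by dsimp only; omega⟩ h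
  rw [Prod.mk.injEq] at this ⊢
  exact ⟨this.1, by omega⟩

theorem zero_mem_oddDistinct : (0 : Multiset ℕ) ∈ oddDistinct := ⟨by simp, by simp⟩

theorem eq_zero_of_sum_eq_zero {ν : Multiset ℕ} (hν : ν ∈ oddDistinct) (h : ν.sum = 0) : ν = 0 := by
  refine Multiset.eq_zero_of_forall_notMem fun x hx => ?_
  have : x = 0 := Multiset.sum_eq_zero_iff.1 h x hx
  exact hν.1 (this ▸ hx)

/-- The correction is the empty partition, of rank 0, which is counted but not reached from
`rankPairs` when m = -1 and n = 0. In `numRankGE_eq` the same happens when m = 0 and n = -1. -/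
theorem numRankLE_eq (m n : ℤ) :
    numRankLE (m + 1) n = (rankPairs m n).ncard + if m = -1 ∧ n = 0 then 1 else 0 := by
  rw [← Set.InjOn.ncard_image (injOn_addColumns_rankPairs m n), image_addColumns]
  split_ifs with h
  · obtain ⟨rfl, rfl⟩ := h
    have h1 : {μ ∈ oddDistinct | (μ.sum : ℤ) = 0 ∧ msRank μ ≤ -1 + 1 ∧ (μ = 0 → 0 ≤ (-1 : ℤ))} = ∅ := by
      rw [Set.eq_empty_iff_forall_notMem]
      rintro μ ⟨hμ, hs, _, h0⟩
      have := h0 (eq_zero_of_sum_eq_zero hμ (by exact_mod_cast hs))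
      omega
    have h2 : (oddDistinctFinset 0).filter (msRank · ≤ -1 + 1) = {0} := by
      ext μ
      rw [Finset.mem_filter, mem_oddDistinctFinset, Finset.mem_singleton]
      constructor
      · rintro ⟨⟨hμ, hs⟩, _⟩
        exact eq_zero_of_sum_eq_zero hμ (by exact_mod_cast hs)
      · rintro rfl
        exact ⟨⟨zero_mem_oddDistinct, rfl⟩, le_rfl⟩
    rw [h1, numRankLE, h2]
    simp
  · rw [numRankLE, add_zero, ← Set.ncard_coe_finset]
    congr 2
    ext μ
    simp only [Finset.coe_filter, mem_oddDistinctFinset, Set.mem_ofPred_eq, and_assoc]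
    refine and_congr_right fun _ => and_congr_right fun hs => ?_
    refine ⟨fun hr => ⟨hr, ?_⟩, fun hr => hr.1⟩
    rintro rfl
    rw [msRank_zero] at hr
    simp at hs
    omega

theorem numRankGE_eq (m n : ℤ) :
    numRankGE m (n + 2 * m + 1) = (rankPairs m n).ncard + if m = 0 ∧ n = -1 then 1 else 0 := by
  rw [← Set.InjOn.ncard_image (injOn_addPart_rankPairs m n), image_addPart]
  split_ifs with h
  · obtain ⟨rfl, rfl⟩ := h
    have h1 : {μ ∈ oddDistinct | (μ.sum : ℤ) = -1 + 2 * 0 + 1 ∧ 0 ≤ msRank μ ∧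
        (μ = 0 → (0 : ℤ) ≤ -1)} = ∅ := by
      rw [Set.eq_empty_iff_forall_notMem]
      rintro μ ⟨hμ, hs, _, h0⟩
      have := h0 (eq_zero_of_sum_eq_zero hμ (by omega))
      omega
    have h2 : (oddDistinctFinset (-1 + 2 * 0 + 1)).filter (0 ≤ msRank ·) = {0} := by
      ext μ
      rw [Finset.mem_filter, mem_oddDistinctFinset, Finset.mem_singleton]
      constructor
      · rintro ⟨⟨hμ, hs⟩, _⟩
        exact eq_zero_of_sum_eq_zero hμ (by omega)
      · rintro rfl
        exact ⟨⟨zero_mem_oddDistinct, rfl⟩, le_rfl⟩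
    rw [h1, numRankGE, h2]
    simp
  · rw [numRankGE, add_zero, ← Set.ncard_coe_finset]
    congr 2
    ext μ
    simp only [Finset.coe_filter, mem_oddDistinctFinset, Set.mem_ofPred_eq, and_assoc]
    refine and_congr_right fun _ => and_congr_right fun hs => ?_
    refine ⟨fun hr => ⟨hr, ?_⟩, fun hr => hr.1⟩
    rintro rfl
    rw [msRank_zero] at hr
    simp at hs
    omega

theorem numRankLE_of_neg {n : ℤ} (hn : n < 0) (m : ℤ) : numRankLE m n = 0 := by
  have : oddDistinctFinset n = ∅ := by
    rw [Finset.eq_empty_iff_forall_notMem]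
    intro μ hμ
    have := (mem_oddDistinctFinset.1 hμ).2
    omega
  simp [numRankLE, this]

theorem numRankGE_of_neg {n : ℤ} (hn : n < 0) (m : ℤ) : numRankGE m n = 0 := by
  have : oddDistinctFinset n = ∅ := by
    rw [Finset.eq_empty_iff_forall_notMem]
    intro μ hμ
    have := (mem_oddDistinctFinset.1 hμ).2
    omega
  simp [numRankGE, this]

/-- The distribution of the `M₂`-rank is symmetric. -/
theorem numRankLE_neg (m n : ℤ) : numRankLE (-m) n = numRankGE m n := by
  -- Passing to complements in the set of all partitions of n leaves the defect of symmetry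
  -- unchanged under m ↦ 1 - m.
  have h1 : ∀ m n, numRankLE (-m) n - numRankGE m n =
      numRankLE (-(1 - m)) n - numRankGE (1 - m) n := by
    intro m n
    have h1 := numRankLE_add_numRankGE (-m) n
    have h2 := numRankLE_add_numRankGE (-(1 - m)) n
    rw [show -m + 1 = 1 - m by ring] at h1
    rw [show -(1 - m) + 1 = m by ring] at h2
    omega
  -- The two descriptions of `rankPairs` turn both counts into counts for n - 2m - 1; the
  -- corrections for the empty partition agree in pairs.
  have h2 : ∀ m n, numRankLE (-m) n - numRankGE m n =
      -(numRankLE (-(m + 2)) (n - 2 * m - 1) - numRankGE (m + 2) (n - 2 * m - 1)) := by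
    intro m n
    rw [← neg_sub, neg_inj, ← neg_sub, h1 (m + 2), neg_sub]
    have e1 := numRankLE_eq (-m - 1) n
    have e2 := numRankGE_eq (-m - 1) n
    have e3 := numRankLE_eq m (n - 2 * m - 1)
    have e4 := numRankGE_eq m (n - 2 * m - 1)
    rw [show -m - 1 + 1 = -m by ring] at e1
    rw [show n + 2 * (-m - 1) + 1 = n - 2 * m - 1 by ring] at e2
    rw [show n - 2 * m - 1 + 2 * m + 1 = n by ring] at e4
    rw [show -(1 - (m + 2)) = m + 1 by ring, show 1 - (m + 2) = -m - 1 by ring]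
    split_ifs at e1 e2 e3 e4 <;> omega
  -- For m ≥ 0 the passage (m, n) ↦ (m+2, n-2m-1) strictly lowers n, and all counts vanish for
  -- negative n.
  have h3 : ∀ (k : ℕ) (m n : ℤ), n < k → 0 ≤ m → numRankLE (-m) n - numRankGE m n = 0 := by
    intro k
    induction k with
    | zero =>
      intro m n hn _
      rw [numRankLE_of_neg (by omega), numRankGE_of_neg (by omega), sub_zero]
    | succ k ih =>
      intro m n hn hm
      rw [h2, ih _ _ (by push_cast at hn; omega) (by omega), neg_zero]
  rw [← sub_eq_zero]
  rcases le_total 0 m with hm | hm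
  · exact h3 (n.toNat + 1) m n (by omega) hm
  · rw [h1]
    exact h3 (n.toNat + 1) _ n (by omega) (by omega)

/-! ### The generating function of partitions without repeated odd parts -/

section GeneratingFunction

open scoped PowerSeries.WithPiTopology Topology
open Filter

theorem tendsto_qPochPartial (a : ℂ) {d c : ℕ} (hd : 1 ≤ d) (hc : 1 ≤ c) :
    Tendsto (qPochPartial a d c) atTop (𝓝 (qPoch a d c)) := by
  rw [PowerSeries.WithPiTopology.tendsto_iff_coeff_tendsto]
  exact fun n => tendsto_atTop_of_eventually_const
    fun M (hM : M ≥ n + 1) => coeff_qPochPartial a d c n M hd hc hM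

/-- The weight function singling out the partitions without repeated odd parts. -/
def oddDistinctWeight (i c : ℕ) : ℂ := if Odd i → c ≤ 1 then 1 else 0

theorem coeff_genFun_oddDistinctWeight (n : ℕ) :
    PowerSeries.coeff n (Nat.Partition.genFun oddDistinctWeight) = (oddDistinctFinset n).card := by
  rw [Nat.Partition.coeff_genFun]
  simp only [oddDistinctWeight, Finsupp.prod, Finset.prod_boole]
  rw [Finset.sum_boole]
  congr 1
  refine Finset.card_bij (fun p _ => p.parts) ?_ ?_ ?_
  · intro p hp
    rw [Finset.mem_filter] at hp
    refine mem_oddDistinctFinset.2 ⟨⟨fun h => (p.parts_pos h).ne rfl, fun i hi => ?_⟩, ?_⟩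
    · by_cases hmem : i ∈ p.parts
      · exact hp.2 i (by simpa using hmem) hi
      · rw [Multiset.count_eq_zero_of_notMem hmem]
        exact zero_le_one
    · exact_mod_cast p.parts_sum
  · intro p _ q _ h
    exact Nat.Partition.ext h
  · intro ν hν
    obtain ⟨hν, hs⟩ := mem_oddDistinctFinset.1 hν
    refine ⟨⟨ν, fun {i} hi => Nat.pos_of_ne_zero ?_, by exact_mod_cast hs⟩, ?_, rfl⟩
    · rintro rfl
      exact hν.1 hi
    · rw [Finset.mem_filter]
      exact ⟨Finset.mem_univ _, fun i _ hi => hν.2 i hi⟩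

/-- The even index i = 2k belongs to the odd part i + 1, used at most once. The odd indices below
belong to even parts, which contribute full geometric series. -/
theorem oddDistinctWeight_factor_even (k : ℕ) :
    1 + ∑' j, oddDistinctWeight (2 * k + 1) (j + 1) • (PowerSeries.X : ℂ⟦X⟧) ^ ((2 * k + 1) * (j + 1)) =
      1 + PowerSeries.X ^ (2 * k + 1) := by
  rw [tsum_eq_single 0]
  · simp [oddDistinctWeight]
  · intro j hj
    have : oddDistinctWeight (2 * k + 1) (j + 1) = 0 := by
      rw [oddDistinctWeight, if_neg]
      intro h
      have := h ⟨k, rfl⟩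
      omega
    rw [this, zero_smul]

theorem oddDistinctWeight_factor_odd (k : ℕ) :
    (1 + ∑' j, oddDistinctWeight (2 * k + 2) (j + 1) •
      (PowerSeries.X : ℂ⟦X⟧) ^ ((2 * k + 2) * (j + 1))) * (1 - PowerSeries.X ^ (2 * k + 2)) = 1 := by
  have h0 : PowerSeries.constantCoeff ((PowerSeries.X : ℂ⟦X⟧) ^ (2 * k + 2)) = 0 := by simp
  have h1 : ∀ j, oddDistinctWeight (2 * k + 2) (j + 1) •
      (PowerSeries.X : ℂ⟦X⟧) ^ ((2 * k + 2) * (j + 1)) = (PowerSeries.X ^ (2 * k + 2)) ^ (j + 1) := by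
    intro j
    rw [oddDistinctWeight, if_pos, one_smul, pow_mul]
    rintro ⟨i, hi⟩
    omega
  have h2 := PowerSeries.WithPiTopology.tsum_pow_mul_one_sub_of_constantCoeff_eq_zero h0
  rw [(PowerSeries.WithPiTopology.summable_pow_of_constantCoeff_eq_zero h0).tsum_eq_zero_add,
    pow_zero] at h2
  simpa only [h1] using h2

theorem prod_range_mul_qPochPartial (M : ℕ) :
    (∏ i ∈ Finset.range (2 * M), (1 + ∑' j, oddDistinctWeight (i + 1) (j + 1) •
      (PowerSeries.X : ℂ⟦X⟧) ^ ((i + 1) * (j + 1)))) * qPochPartial 1 2 2 M =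
      qPochPartial (-1) 1 2 M := by
  induction M with
  | zero => simp [qPochPartial]
  | succ M ih =>
    have h := oddDistinctWeight_factor_odd M
    rw [show 2 * (M + 1) = 2 * M + 1 + 1 by ring, Finset.prod_range_succ, Finset.prod_range_succ,
      oddDistinctWeight_factor_even, qPochPartial_succ, qPochPartial_succ, ← ih,
      show 2 + 2 * M = 2 * M + 2 by ring, show 1 + 2 * M = 2 * M + 1 by ring, map_neg, map_one]
    simp only [show 2 * M + 1 + 1 = 2 * M + 2 by ring] at h ⊢
    linear_combination (∏ i ∈ Finset.range (2 * M), (1 + ∑' j, oddDistinctWeight (i + 1) (j + 1) •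
      (PowerSeries.X : ℂ⟦X⟧) ^ ((i + 1) * (j + 1)))) * qPochPartial 1 2 2 M *
      (1 + PowerSeries.X ^ (2 * M + 1)) * h

/-- Limit of the finite identity `prod_range_mul_qPochPartial`, taken along the even partial
products of the partition generating function. -/
theorem coeff_prefactor (n : ℕ) :
    PowerSeries.coeff n prefactor = (oddDistinctFinset n).card := by
  have h1 := (Nat.Partition.hasProd_genFun oddDistinctWeight).tendsto_prod_nat
  have h2 := (h1.comp (tendsto_id.const_mul_atTop' (two_pos (α := ℕ)))).mul
    (tendsto_qPochPartial 1 (d := 2) (c := 2) (by norm_num) (by norm_num))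
  have h3 := tendsto_nhds_unique h2 ((tendsto_qPochPartial (-1) (d := 1) (c := 2) (by norm_num)
    (by norm_num)).congr fun M => (prod_range_mul_qPochPartial M).symm)
  rw [← coeff_genFun_oddDistinctWeight, prefactor, ← h3, mul_assoc,
    mul_qInv _ (constantCoeff_qPoch _ _ _ (by norm_num)), mul_one]

end GeneratingFunction

/-! ### Rank counts and rank moments -/

/-- Number of partitions of `n` without repeated odd parts and with `M₂`-rank `m`. -/
def numRank (m n : ℤ) : ℤ := ((oddDistinctFinset n).filter (msRank · = m)).card

theorem numRank_eq_sub (m n : ℤ) : numRank m n = numRankLE m n - numRankLE (m - 1) n := by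
  have h := Finset.card_filter_add_card_filter_not (s := (oddDistinctFinset n).filter (msRank · ≤ m))
    (msRank · = m)
  rw [Finset.filter_filter, Finset.filter_filter] at h
  have h1 : (oddDistinctFinset n).filter (fun μ => msRank μ ≤ m ∧ msRank μ = m) =
      (oddDistinctFinset n).filter (msRank · = m) :=
    Finset.filter_congr fun μ _ => by omega
  have h2 : (oddDistinctFinset n).filter (fun μ => msRank μ ≤ m ∧ ¬ msRank μ = m) =
      (oddDistinctFinset n).filter (msRank · ≤ m - 1) :=
    Finset.filter_congr fun μ _ => by omega
  rw [h1, h2] at h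
  rw [numRank, numRankLE, numRankLE]
  omega

theorem ceil_half (s : ℕ) : ⌈((s : ℕ) : ℚ) / 2⌉ = (((s + 1) / 2 : ℕ) : ℤ) := by
  rw [Int.ceil_eq_iff]
  obtain ⟨k, rfl | rfl⟩ := Nat.even_or_odd' s
  · rw [show (2 * k + 1) / 2 = k by omega]
    push_cast
    constructor <;> linarith
  · rw [show (2 * k + 1 + 1) / 2 = k + 1 by omega]
    push_cast
    constructor <;> linarith

theorem m2Rank_eq {n : ℕ} (p : n.Partition) : m2Rank p = msRank p.parts := by
  rw [m2Rank, ceil_half, msRank, halfSup]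

theorem noRepeatedOddParts_iff {n : ℕ} (p : n.Partition) :
    NoRepeatedOddParts p ↔ p.parts ∈ oddDistinct := by
  constructor
  · refine fun h => ⟨fun h0 => (p.parts_pos h0).ne rfl, fun i hi => ?_⟩
    by_cases hmem : i ∈ p.parts
    · exact (h i hmem hi).le
    · rw [Multiset.count_eq_zero_of_notMem hmem]
      exact zero_le_one
  · exact fun h i hmem hi => le_antisymm (h.2 i hi) (Multiset.one_le_count_iff_mem.2 hmem)

theorem N2_eq (m : ℤ) (n : ℕ) : (N2 m n : ℤ) = numRank m n := by
  rw [N2, numRank, Nat.cast_inj, ← Nat.card_eq_finsetCard]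
  refine Nat.card_congr (Equiv.ofBijective (fun p => ⟨p.1.parts, ?_⟩) ⟨?_, ?_⟩)
  · exact Finset.mem_filter.2 ⟨mem_oddDistinctFinset.2 ⟨(noRepeatedOddParts_iff _).1 p.2.1,
      by exact_mod_cast p.1.parts_sum⟩, (m2Rank_eq _).symm.trans p.2.2⟩
  · rintro ⟨p, _⟩ ⟨q, _⟩ h
    simp only [Subtype.mk.injEq] at h ⊢
    exact Nat.Partition.ext h
  · rintro ⟨ν, hν⟩
    obtain ⟨h1, h2⟩ := Finset.mem_filter.1 hν
    obtain ⟨h1, h3⟩ := mem_oddDistinctFinset.1 h1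
    let p : n.Partition := ⟨ν, fun {i} hi => Nat.pos_of_ne_zero (by
      rintro rfl
      exact h1.1 hi), by exact_mod_cast h3⟩
    exact ⟨⟨p, (noRepeatedOddParts_iff p).2 h1, (m2Rank_eq p).trans h2⟩, rfl⟩

/-- A sum over ranks is regrouped as a sum over partitions; moments of the rank thus become sums of
polynomials in `msRank μ`. -/
theorem finsum_numRank (u : ℤ → ℂ) (j n : ℤ) :
    ∑ᶠ m, u m * numRank (m + j) n = ∑ μ ∈ oddDistinctFinset n, u (msRank μ - j) := by
  rw [Finset.sum_comp u (fun μ => msRank μ - j),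
    finsum_eq_sum_of_support_subset (s := (oddDistinctFinset n).image fun μ => msRank μ - j)]
  · refine Finset.sum_congr rfl fun m _ => ?_
    rw [nsmul_eq_mul, mul_comm, numRank, Int.cast_natCast]
    congr 3
    refine Finset.filter_congr fun μ _ => ?_
    omega
  · intro m hm
    rw [Function.mem_support] at hm
    have h1 := right_ne_zero_of_mul hm
    rw [numRank, Int.cast_natCast, Nat.cast_ne_zero, Finset.card_ne_zero] at h1
    obtain ⟨μ, hμ⟩ := h1
    obtain ⟨h2, h3⟩ := Finset.mem_filter.1 hμ
    rw [Finset.coe_image]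
    exact ⟨μ, h2, by simp only; omega⟩

theorem support_numRank_finite (u : ℤ → ℂ) (j n : ℤ) :
    (Function.support fun m => u m * numRank (m + j) n).Finite := by
  refine (Finset.finite_toSet ((oddDistinctFinset n).image fun μ => msRank μ - j)).subset
    fun m hm => ?_
  rw [Function.mem_support] at hm
  have h1 := right_ne_zero_of_mul hm
  rw [numRank, Int.cast_natCast, Nat.cast_ne_zero, Finset.card_ne_zero] at h1
  obtain ⟨μ, hμ⟩ := h1
  obtain ⟨h2, h3⟩ := Finset.mem_filter.1 hμ
  rw [Finset.coe_image]
  exact ⟨μ, h2, by simp only; omega⟩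

theorem coeff_R2Moment (k n : ℕ) : PowerSeries.coeff n (R2Moment k) =
    ∑ μ ∈ oddDistinctFinset n, (msRank μ : ℂ) ^ k := by
  have h := finsum_numRank (fun m => (m : ℂ) ^ k) 0 n
  simp only [add_zero, sub_zero] at h
  rw [← h, R2Moment, momentSeries, PowerSeries.coeff_mk]
  refine finsum_congr fun m => ?_
  rw [← N2_eq, Int.cast_natCast]

/-! ### The theta quotient attached to the `M₂`-rank -/

theorem isUnit_of_constantCoeff_eq_one {R : Type*} [CommRing R] {f : R⟦X⟧}
    (hf : PowerSeries.constantCoeff f = 1) : IsUnit f :=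
  IsUnit.of_mul_eq_one _ (mul_qInv f hf)

theorem zDer_mul_logDeriv {F G e e' : ℂ[T;T⁻¹]⟦X⟧} (hF : zDer F = F * e) (hG : zDer G = G * e') :
    zDer (F * G) = F * G * (e + e') := by
  rw [zDer.leibniz, hF, hG, smul_eq_mul, smul_eq_mul]
  ring

/-- `c₀(q) (-zq;q²)_∞ (-z⁻¹q;q²)_∞ / ((zq²;q²)_∞ (z⁻¹q²;q²)_∞)³`, with `c₀(q)` such that the value
at `z = 1` is `1`. -/
def thetaQuotient : ℂ[T;T⁻¹]⟦X⟧ :=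
  crankQuotient 1 1 * crankQuotient 2 4 * (crankQuotient 1 2 * crankQuotient 1 2) *
    qInv (crankQuotient 2 2)

/-- The logarithmic derivative of `thetaQuotient`. -/
def thetaLogDeriv : ℂ[T;T⁻¹]⟦X⟧ :=
  crankLogDeriv 1 1 one_ne_zero + crankLogDeriv 2 4 four_ne_zero +
    (crankLogDeriv 1 2 two_ne_zero + crankLogDeriv 1 2 two_ne_zero) +
    -crankLogDeriv 2 2 two_ne_zero

theorem zDer_qInv_crankQuotient {s : ℤ} {c : ℕ} (hc : c ≠ 0) :
    zDer (qInv (crankQuotient s c)) = qInv (crankQuotient s c) * -crankLogDeriv s c hc := by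
  rw [derivation_qInv zDer (constantCoeff_crankQuotient hc) (zDer_crankQuotient hc), mul_neg]

theorem map_evalOne_qInv_crankQuotient {s : ℤ} {c : ℕ} (hc : c ≠ 0) :
    PowerSeries.map evalOne (qInv (crankQuotient s c)) = 1 := by
  rw [map_qInv _ (constantCoeff_crankQuotient hc), map_evalOne_crankQuotient hc, qInv_one]

theorem zDer_thetaQuotient : zDer thetaQuotient = thetaQuotient * thetaLogDeriv :=
  zDer_mul_logDeriv (zDer_mul_logDeriv
    (zDer_mul_logDeriv (zDer_crankQuotient one_ne_zero) (zDer_crankQuotient four_ne_zero))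
    (zDer_mul_logDeriv (zDer_crankQuotient two_ne_zero) (zDer_crankQuotient two_ne_zero)))
    (zDer_qInv_crankQuotient two_ne_zero)

theorem map_evalOne_thetaQuotient : PowerSeries.map evalOne thetaQuotient = 1 := by
  rw [thetaQuotient, map_mul, map_mul, map_mul, map_mul, map_evalOne_crankQuotient one_ne_zero,
    map_evalOne_crankQuotient two_ne_zero, map_evalOne_crankQuotient four_ne_zero,
    map_evalOne_qInv_crankQuotient two_ne_zero]
  simp

theorem quasimodularMoments_thetaLogDeriv : QuasimodularMoments 1 thetaLogDeriv := by
  have h := fun (s : ℤ) (c : ℕ) (hc : c ≠ 0) (hd : c ∣ 4) =>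
    quasimodularMoments_crankLogDeriv (s := s) hc hd
  exact (((h 1 1 _ (by norm_num)).add (h 2 4 _ (by norm_num))).add
    ((h 1 2 _ (by norm_num)).add (h 1 2 _ (by norm_num)))).add (h 2 2 _ (by norm_num)).neg

theorem quasimodularMoments_thetaQuotient : QuasimodularMoments 0 thetaQuotient :=
  .of_logDeriv quasimodularMoments_thetaLogDeriv map_evalOne_thetaQuotient zDer_thetaQuotient

theorem constantCoeff_thetaQuotient : PowerSeries.constantCoeff thetaQuotient = 1 := by
  simp only [thetaQuotient, map_mul, constantCoeff_crankQuotient one_ne_zero, constantCoeff_qInv,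
    constantCoeff_crankQuotient two_ne_zero, constantCoeff_crankQuotient four_ne_zero, mul_one]

theorem moment_thetaLogDeriv_zero : moment thetaLogDeriv 0 = 0 := by
  simp [thetaLogDeriv, moment_add, moment_neg, moment_crankLogDeriv]

/-- The weights s² of the factors combine to σ(q) - 2σ(q²) + 4σ(q⁴), with σ(q) = ∑ σ₁(n)qⁿ: the
logarithmic derivative of the prefactor P. Hence the second moment of `thetaSeries` is 2δ_q P, the
value required by the rank side in `thetaSum_add`. -/
theorem moment_thetaLogDeriv_one : moment thetaLogDeriv 1 = (2 : ℂ) • logDerivPrefactor := by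
  simp only [thetaLogDeriv, moment_add, moment_neg, moment_crankLogDeriv, logDerivPrefactor,
    PowerSeries.expand_one_apply, Algebra.smul_def]
  simp only [map_mul, map_pow, map_sub, map_neg, map_one, Int.cast_one, Int.cast_ofNat, map_ofNat]
  ring

theorem moment_thetaQuotient_one : moment thetaQuotient 1 = 0 := by
  have h0 := moment_thetaLogDeriv_zero
  rw [moment_zero] at h0
  rw [moment_succ, zDer_thetaQuotient, moment_zero, map_mul, h0, mul_zero]

theorem moment_thetaQuotient_two : moment thetaQuotient 2 = (2 : ℂ) • logDerivPrefactor := by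
  have h0 := moment_thetaLogDeriv_zero
  have h1 := moment_thetaLogDeriv_one
  rw [moment_zero] at h0
  rw [moment_succ, moment_zero] at h1
  rw [moment_succ, zDer_thetaQuotient, moment_succ, zDer.leibniz, smul_eq_mul, smul_eq_mul,
    moment_zero, map_add, map_mul, map_mul, h0, zero_mul, add_zero, h1, map_evalOne_thetaQuotient,
    one_mul]

/-! ### Symmetry z ↔ z⁻¹ and product form of the theta series. -/

theorem map_invert_crankQuotient {s : ℤ} {c : ℕ} (hc : c ≠ 0) :
    PowerSeries.map (LaurentPolynomial.invert (R := ℂ) : ℂ[T;T⁻¹] →+* ℂ[T;T⁻¹])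
      (crankQuotient s c) = crankQuotient s c := by
  rw [crankQuotient, map_mul, map_qInv _ (constantCoeff_crankDenominator hc), map_pow, map_mul,
    map_qPoch, map_qPoch, map_qPoch, map_one]
  simp only [RingHom.coe_coe, LaurentPolynomial.invert_T, neg_neg]
  rw [mul_comm (qPoch (LaurentPolynomial.T (-s)) c c)]

theorem map_invert_thetaQuotient :
    PowerSeries.map (LaurentPolynomial.invert (R := ℂ) : ℂ[T;T⁻¹] →+* ℂ[T;T⁻¹])
      thetaQuotient = thetaQuotient := by
  rw [thetaQuotient, map_mul, map_mul, map_mul, map_mul,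
    map_qInv _ (constantCoeff_crankQuotient two_ne_zero), map_invert_crankQuotient one_ne_zero,
    map_invert_crankQuotient two_ne_zero, map_invert_crankQuotient two_ne_zero,
    map_invert_crankQuotient four_ne_zero]

/-- `(-q;q²)_∞ / (q²;q²)_∞` times the theta quotient. -/
def thetaSeries : ℂ[T;T⁻¹]⟦X⟧ := constZ prefactor * thetaQuotient

theorem moment_thetaSeries (k : ℕ) : moment thetaSeries k = prefactor * moment thetaQuotient k :=
  moment_constZ_mul _ _ _

theorem zqCoeff_thetaSeries_neg (m : ℤ) (n : ℕ) :
    zqCoeff thetaSeries (-m) n = zqCoeff thetaSeries m n := by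
  have h : PowerSeries.map (LaurentPolynomial.invert (R := ℂ) : ℂ[T;T⁻¹] →+* ℂ[T;T⁻¹])
      thetaSeries = thetaSeries := by
    rw [thetaSeries, map_mul, map_invert_thetaQuotient]
    congr 1
    ext1 n
    simp [constZ]
  conv_rhs => rw [← h]
  rw [zqCoeff, zqCoeff, PowerSeries.coeff_map]
  exact (LaurentPolynomial.invert_apply _ _).symm

theorem crankQuotient_mul_denominator {s : ℤ} {c : ℕ} (hc : c ≠ 0) :
    crankQuotient s c * (qPoch (LaurentPolynomial.T s) c c * qPoch (LaurentPolynomial.T (-s)) c c) =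
      qPoch 1 c c ^ 2 := by
  rw [crankQuotient, mul_assoc, qInv_mul _ (constantCoeff_crankDenominator hc), mul_one]

/-- The pure algebra behind `exists_thetaSeries_mul`. The letters n, a, b, k, g stand for (-zq;q²),
(zq;q), (z²q⁴;q⁴), (z²q²;q²), (zq²;q²), with index 2 for z⁻¹ in place of z, and r_c for (q^c;q^c).
The common last factor is a unit there and is cancelled. -/
theorem theta_product_identity {R : Type*} [CommRing R]
    {θ u11 u12 u24 u22 a1 a2 b1 b2 g1 g2 k1 k2 n1 n2 r1 r2 r4 : R}
    (hp : n1 * a1 * b1 = k1 * g1) (hm : n2 * a2 * b2 = k2 * g2)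
    (h11 : u11 * (a1 * a2) = r1 ^ 2) (h24 : u24 * (b1 * b2) = r4 ^ 2)
    (h12 : u12 * (g1 * g2) = r2 ^ 2) (h22 : u22 * (k1 * k2) = r2 ^ 2)
    (hθ : θ * u22 = u11 * u24 * (u12 * u12)) :
    θ * (g1 * g2) ^ 3 * (a1 * a2 * (b1 * b2) * r2 ^ 2) =
      (r1 * r2 * r4) ^ 2 * (n1 * n2) * (a1 * a2 * (b1 * b2) * r2 ^ 2) := by
  calc θ * (g1 * g2) ^ 3 * (a1 * a2 * (b1 * b2) * r2 ^ 2)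
      = θ * (u22 * (k1 * k2)) * (g1 * g2) ^ 3 * (a1 * a2 * (b1 * b2)) := by rw [h22]; ring
    _ = (θ * u22) * (k1 * g1) * (k2 * g2) * (g1 * g2) ^ 2 * (a1 * a2 * (b1 * b2)) := by ring
    _ = (u11 * (a1 * a2)) * (u24 * (b1 * b2)) * (u12 * (g1 * g2)) ^ 2 * (k1 * g1) * (k2 * g2) := by
        rw [hθ]; ring
    _ = _ := by rw [h11, h24, h12, ← hp, ← hm]; ring

/-- The exact value of f is irrelevant later: a series in q = xy alone is symmetric in x and y. -/
theorem exists_thetaSeries_mul : ∃ f : ℂ⟦X⟧,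
    thetaSeries * (qPoch (LaurentPolynomial.T 1) 2 2 * qPoch (LaurentPolynomial.T (-1)) 2 2) ^ 3 =
      constZ f * (qPoch (-LaurentPolynomial.T 1) 1 2 * qPoch (-LaurentPolynomial.T (-1)) 1 2) := by
  refine ⟨prefactor * (qPoch 1 1 1 * qPoch 1 2 2 * qPoch 1 4 4) ^ 2, ?_⟩
  have hp := qPoch_neg_odd (LaurentPolynomial.T 1 : ℂ[T;T⁻¹])
  have hm := qPoch_neg_odd (LaurentPolynomial.T (-1) : ℂ[T;T⁻¹])
  rw [show (LaurentPolynomial.T 1 : ℂ[T;T⁻¹]) ^ 2 = LaurentPolynomial.T 2 from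
    LaurentPolynomial.T_pow 1 2] at hp
  rw [show (LaurentPolynomial.T (-1) : ℂ[T;T⁻¹]) ^ 2 = LaurentPolynomial.T (-2) from
    LaurentPolynomial.T_pow (-1) 2] at hm
  have h11 := crankQuotient_mul_denominator (s := 1) one_ne_zero
  have h12 := crankQuotient_mul_denominator (s := 1) two_ne_zero
  have h24 := crankQuotient_mul_denominator (s := 2) four_ne_zero
  have h22 := crankQuotient_mul_denominator (s := 2) two_ne_zero
  have hθ : thetaQuotient * crankQuotient 2 2 =
      crankQuotient 1 1 * crankQuotient 2 4 * (crankQuotient 1 2 * crankQuotient 1 2) := by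
    rw [thetaQuotient, mul_assoc, qInv_mul _ (constantCoeff_crankQuotient two_ne_zero), mul_one]
  rw [thetaSeries, map_mul, map_pow, map_mul, map_mul, constZ_qPoch, constZ_qPoch, constZ_qPoch,
    map_one, mul_assoc, mul_assoc]
  refine congrArg (constZ prefactor * ·) ?_
  have hu1 : IsUnit ((qPoch (LaurentPolynomial.T 1 : ℂ[T;T⁻¹]) 1 1 *
      qPoch (LaurentPolynomial.T (-1)) 1 1) * (qPoch (LaurentPolynomial.T 2 : ℂ[T;T⁻¹]) 4 4 *
      qPoch (LaurentPolynomial.T (-2)) 4 4) * qPoch 1 2 2 ^ 2) := by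
    refine isUnit_of_constantCoeff_eq_one ?_
    rw [map_mul, map_mul, constantCoeff_crankDenominator one_ne_zero,
      constantCoeff_crankDenominator four_ne_zero, map_pow,
      constantCoeff_qPoch _ _ _ (by norm_num)]
    simp
  refine hu1.mul_right_cancel ?_
  exact theta_product_identity hp hm h11 h24 h12 h22 hθ

/-! ### Double power series and the change of variables `z = x²`, `q = x y` -/

section Swap

variable {R : Type*} [CommRing R]

/-- Exchange of the two variables of a double power series. -/
def swapXY : R⟦X⟧⟦X⟧ →+* R⟦X⟧⟦X⟧ where
  toFun F := PowerSeries.mk fun b => PowerSeries.mk fun a =>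
    PowerSeries.coeff b (PowerSeries.coeff a F)
  map_one' := by
    ext b a
    simp only [PowerSeries.coeff_mk, PowerSeries.coeff_one]
    split_ifs <;> simp_all [PowerSeries.coeff_one]
  map_zero' := by
    ext b a
    simp
  map_add' F G := by
    ext b a
    simp
  map_mul' F G := by
    ext b a
    simp only [PowerSeries.coeff_mk, PowerSeries.coeff_mul, map_sum]
    exact Finset.sum_comm

theorem coeff_swapXY (F : R⟦X⟧⟦X⟧) (a b : ℕ) :
    PowerSeries.coeff a (PowerSeries.coeff b (swapXY F)) =
      PowerSeries.coeff b (PowerSeries.coeff a F) := by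
  simp [swapXY]

/-- The monomial `x ^ a y ^ b`. -/
def monoXY (a b : ℕ) : R⟦X⟧⟦X⟧ := PowerSeries.C (PowerSeries.X ^ a) * PowerSeries.X ^ b

theorem swapXY_monoXY (a b : ℕ) : swapXY (monoXY a b : R⟦X⟧⟦X⟧) = monoXY b a := by
  ext i j
  rw [coeff_swapXY, monoXY, monoXY]
  simp only [PowerSeries.coeff_C_mul, PowerSeries.coeff_X_pow]
  split_ifs <;> simp_all [PowerSeries.coeff_X_pow]

/-- A power series in `x y`. -/
def diagXY (f : R⟦X⟧) : R⟦X⟧⟦X⟧ :=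
  PowerSeries.mk fun n => PowerSeries.C (PowerSeries.coeff n f) * PowerSeries.X ^ n

theorem swapXY_diagXY (f : R⟦X⟧) : swapXY (diagXY f) = diagXY f := by
  ext i j
  rw [coeff_swapXY, diagXY]
  simp only [PowerSeries.coeff_mk, PowerSeries.coeff_C_mul, PowerSeries.coeff_X_pow]
  split_ifs <;> simp_all

end Swap

/-! ### The substitution z = x², q = xy in Laurent series. -/

/-- The substitution `z = x²` into Laurent polynomials. -/
def zToSq : ℂ[T;T⁻¹] →ₐ[ℂ] LaurentSeries ℂ :=
  AddMonoidAlgebra.lift ℂ (LaurentSeries ℂ) ℤ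
    { toFun := fun m => HahnSeries.single (2 * m.toAdd) 1
      map_one' := rfl
      map_mul' := fun m n => by
        rw [HahnSeries.single_mul_single, toAdd_mul, mul_add, one_mul] }

theorem zToSq_C_mul_T (a : ℂ) (m : ℤ) :
    zToSq (LaurentPolynomial.C a * LaurentPolynomial.T m) = HahnSeries.single (2 * m) a := by
  rw [← LaurentPolynomial.single_eq_C_mul_T, zToSq, AddMonoidAlgebra.lift_single]
  rw [Algebra.smul_def]
  rw [HahnSeries.algebraMap_apply', PowerSeries.algebraMap_apply, Algebra.algebraMap_self_apply,
    HahnSeries.ofPowerSeries_C, HahnSeries.C_apply]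
  simp

theorem zToSq_T (m : ℤ) : zToSq (LaurentPolynomial.T m) = HahnSeries.single (2 * m) 1 := by
  have := zToSq_C_mul_T 1 m
  rwa [map_one, one_mul] at this

theorem zToSq_C (a : ℂ) : zToSq (LaurentPolynomial.C a) = HahnSeries.C a := by
  have := zToSq_C_mul_T a 0
  rwa [LaurentPolynomial.T_zero, mul_one, mul_zero] at this

/-- The substitution `z = x²`, `q = x y`. -/
def zqToXY : ℂ[T;T⁻¹]⟦X⟧ →+* (LaurentSeries ℂ)⟦X⟧ :=
  (PowerSeries.rescale (HahnSeries.single (1 : ℤ) (1 : ℂ))).comp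
    (PowerSeries.map (zToSq : ℂ[T;T⁻¹] →+* LaurentSeries ℂ))

theorem coeff_zqToXY (F : ℂ[T;T⁻¹]⟦X⟧) (n : ℕ) : PowerSeries.coeff n (zqToXY F) =
    HahnSeries.single (n : ℤ) 1 * zToSq (PowerSeries.coeff n F) := by
  simp [zqToXY, PowerSeries.coeff_rescale, HahnSeries.single_pow]

/-- The inclusion of double power series. -/
def laurentXY : ℂ⟦X⟧⟦X⟧ →+* (LaurentSeries ℂ)⟦X⟧ := PowerSeries.map (HahnSeries.ofPowerSeries ℤ ℂ)

/-- The monomial `x ^ a y ^ b`, with an integer `a`. -/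
def laurentMonoXY (a : ℤ) (b : ℕ) : (LaurentSeries ℂ)⟦X⟧ :=
  PowerSeries.C (HahnSeries.single a 1) * PowerSeries.X ^ b

theorem laurentMonoXY_mul (a a' : ℤ) (b b' : ℕ) :
    laurentMonoXY a b * laurentMonoXY a' b' = laurentMonoXY (a + a') (b + b') := by
  rw [laurentMonoXY, laurentMonoXY, laurentMonoXY, pow_add, mul_mul_mul_comm, ← map_mul,
    HahnSeries.single_mul_single, one_mul]

theorem laurentXY_monoXY (a b : ℕ) : laurentXY (monoXY a b) = laurentMonoXY a b := by
  rw [laurentXY, monoXY, laurentMonoXY, map_mul, PowerSeries.map_C, map_pow (PowerSeries.map _),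
    PowerSeries.map_X, HahnSeries.ofPowerSeries_X_pow]

theorem zqToXY_monomial (m : ℤ) (k : ℕ) :
    zqToXY (PowerSeries.C (LaurentPolynomial.T m) * PowerSeries.X ^ k) =
      laurentMonoXY (2 * m + k) k := by
  ext1 n
  rw [coeff_zqToXY, laurentMonoXY, PowerSeries.coeff_C_mul, PowerSeries.coeff_C_mul,
    PowerSeries.coeff_X_pow, PowerSeries.coeff_X_pow]
  split_ifs with h
  · rw [mul_one, mul_one, zToSq_T, HahnSeries.single_mul_single, h, one_mul, add_comm]
  · rw [mul_zero, mul_zero, map_zero, mul_zero]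

theorem zqToXY_constZ (f : ℂ⟦X⟧) : zqToXY (constZ f) = laurentXY (diagXY f) := by
  ext1 n
  rw [coeff_zqToXY, constZ, PowerSeries.coeff_map, laurentXY, PowerSeries.coeff_map, diagXY,
    PowerSeries.coeff_mk, map_mul, HahnSeries.ofPowerSeries_X_pow, HahnSeries.ofPowerSeries_C,
    zToSq_C, mul_comm]

/-- The degree in y equals the degree in q, so truncation in q becomes truncation in y. -/
theorem modX_zqToXY {n : ℕ} {F G : ℂ[T;T⁻¹]⟦X⟧} (h : modX _ n F = modX _ n G) :
    modX _ n (zqToXY F) = modX _ n (zqToXY G) := by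
  rw [modX_eq_iff] at h ⊢
  intro m hm
  rw [coeff_zqToXY, coeff_zqToXY, h m hm]

theorem modX_zqToXY_qPoch (m : ℤ) {n M c : ℕ} (h : n ≤ M) (hc : 1 ≤ c) :
    modX _ n (zqToXY (qPoch (LaurentPolynomial.T m) c c)) =
      modX _ n (∏ i ∈ Finset.range M, (1 - laurentMonoXY (2 * m + (c + c * i : ℕ)) (c + c * i))) := by
  rw [modX_zqToXY (modX_qPoch h _ hc hc), qPochPartial, map_prod]
  simp only [map_sub, map_one, zqToXY_monomial]

theorem modX_zqToXY_qPoch_neg (m : ℤ) {n M d c : ℕ} (h : n ≤ M) (hd : 1 ≤ d) (hc : 1 ≤ c) :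
    modX _ n (zqToXY (qPoch (-LaurentPolynomial.T m) d c)) =
      modX _ n (∏ i ∈ Finset.range M, (1 + laurentMonoXY (2 * m + (d + c * i : ℕ)) (d + c * i))) := by
  rw [modX_zqToXY (modX_qPoch h _ hd hc), qPochPartial, map_prod]
  simp only [map_one, map_neg, neg_mul, sub_neg_eq_add, map_add, zqToXY_monomial]

/-! ### The kernel `(1 - x²)⁻³` -/

/-- The expansion of `(1 - x²)⁻³`. -/
def cubeKernel : ℂ⟦X⟧ := PowerSeries.expand 2 two_ne_zero
  (PowerSeries.mk fun n => ((2 + n).choose 2 : ℂ))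

theorem cubeKernel_mul : cubeKernel * (1 - PowerSeries.X ^ 2) ^ 3 = 1 := by
  have h := congrArg (PowerSeries.expand 2 two_ne_zero)
    (PowerSeries.mk_add_choose_mul_one_sub_pow_eq_one (S := ℂ) 2)
  simpa [map_mul, map_pow, map_sub, PowerSeries.expand_X, cubeKernel] using h

/-- The sums `∑_j C(m - j + 2, 2) f_j` over `j ≤ m`. -/
def cubeSum (f : ℂ[T;T⁻¹]) (m : ℤ) : ℂ :=
  (zToSq f * HahnSeries.ofPowerSeries ℤ ℂ cubeKernel).coeff (2 * m)

theorem cubeSum_eq_finsum (f : ℂ[T;T⁻¹]) (m : ℤ) : cubeSum f m =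
    ∑ᶠ j : ℤ, f.coeff j * (if 0 ≤ m - j then ((m - j + 1) * (m - j + 2) / 2 : ℂ) else 0) := by
  induction f using LaurentPolynomial.induction_on' with
  | add p q hp hq =>
    have hfin : ∀ p : ℂ[T;T⁻¹], (Function.support fun j : ℤ => p.coeff j *
        (if 0 ≤ m - j then ((m - j + 1) * (m - j + 2) / 2 : ℂ) else 0)).Finite := fun p =>
      p.coeff.hasFiniteSupport.subset fun j hj => left_ne_zero_of_mul hj
    have h1 : cubeSum (p + q) m = cubeSum p m + cubeSum q m := by
      rw [cubeSum, map_add, add_mul, HahnSeries.coeff_add]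
      rfl
    rw [h1, hp, hq, ← finsum_add_distrib (hfin p) (hfin q)]
    refine finsum_congr fun j => ?_
    exact (add_mul (p.coeff j) (q.coeff j) _).symm
  | C_mul_T n a =>
    rw [finsum_eq_single _ n]
    · rw [cubeSum, zToSq_C_mul_T, ← LaurentPolynomial.single_eq_C_mul_T, AddMonoidAlgebra.coeff_single,
        Finsupp.single_eq_same, HahnSeries.coeff_single_mul, PowerSeries.coeff_coe]
      congr 1
      by_cases h : 0 ≤ m - n
      · obtain ⟨k, hk⟩ := Int.eq_ofNat_of_zero_le h
        have h2 : (m : ℂ) - n = k := by exact_mod_cast congrArg (Int.cast (R := ℂ)) hk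
        rw [if_neg (by omega), if_pos h, cubeKernel, PowerSeries.coeff_expand,
          if_pos (by omega), PowerSeries.coeff_mk, h2,
          show (2 * m - 2 * n).natAbs / 2 = k by omega, Nat.cast_choose_two]
        push_cast
        ring
      · rw [if_pos (by omega), if_neg h]
    · intro j hj
      rw [← LaurentPolynomial.single_eq_C_mul_T, AddMonoidAlgebra.coeff_single,
        Finsupp.single_eq_of_ne hj, zero_mul]

/-! ### The symmetry of the theta series -/

/-- The symmetric denominator of the truncated theta series. -/
def thetaDen (M : ℕ) : ℂ⟦X⟧⟦X⟧ :=
  (∏ i ∈ Finset.range (M + 1), (1 - monoXY (2 * i + 2) (2 * i))) *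
    ∏ i ∈ Finset.range (M + 1), (1 - monoXY (2 * i) (2 * i + 2))

/-- The symmetric numerator of the truncated theta series. -/
def thetaNum (M : ℕ) : ℂ⟦X⟧⟦X⟧ :=
  (monoXY 1 0 + monoXY 0 1) * ((∏ i ∈ Finset.range M, (1 + monoXY (2 * i + 3) (2 * i + 1))) *
    ∏ i ∈ Finset.range M, (1 + monoXY (2 * i + 1) (2 * i + 3)))

theorem swapXY_thetaDen (M : ℕ) : swapXY (thetaDen M) = thetaDen M := by
  simp only [thetaDen, map_mul, map_prod, map_sub, map_one, swapXY_monoXY]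
  rw [mul_comm]

theorem swapXY_thetaNum (M : ℕ) : swapXY (thetaNum M) = thetaNum M := by
  simp only [thetaNum, map_mul, map_prod, map_add, map_one, swapXY_monoXY]
  rw [add_comm, mul_comm (∏ i ∈ Finset.range M, (1 + monoXY (2 * i + 1) (2 * i + 3)))]

theorem isUnit_thetaDen (M : ℕ) : IsUnit (thetaDen M) := by
  rw [PowerSeries.isUnit_iff_constantCoeff, PowerSeries.isUnit_iff_constantCoeff]
  simp [thetaDen, monoXY]

/-- The extra factor 1 - z = 1 - x² completes (zq²;q²) to the mirror image of (z⁻¹q²;q²) under x ↔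
y. It supplies the missing factor, which is why the two truncations have M and M + 1 factors. -/
theorem laurentXY_thetaDen (M : ℕ) : laurentXY (thetaDen M) = (1 - laurentMonoXY 2 0) *
    ((∏ i ∈ Finset.range M, (1 - laurentMonoXY (2 * 1 + (2 + 2 * i : ℕ)) (2 + 2 * i))) *
      ∏ i ∈ Finset.range (M + 1), (1 - laurentMonoXY (2 * -1 + (2 + 2 * i : ℕ)) (2 + 2 * i))) := by
  have h1 : ∀ i : ℕ, laurentMonoXY (2 * 1 + (2 + 2 * i : ℕ)) (2 + 2 * i) =
      laurentMonoXY (2 * (i + 1) + 2 : ℕ) (2 * (i + 1)) := fun i =>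
    congrArg₂ _ (by push_cast; ring) (by ring)
  have h2 : ∀ i : ℕ, laurentMonoXY (2 * -1 + (2 + 2 * i : ℕ)) (2 + 2 * i) =
      laurentMonoXY (2 * i : ℕ) (2 * i + 2) := fun i =>
    congrArg₂ _ (by push_cast; ring) (by ring)
  simp only [thetaDen, map_mul, map_prod, map_sub, map_one, laurentXY_monoXY, h1, h2]
  rw [Finset.prod_range_succ', ← mul_assoc, mul_comm (1 - laurentMonoXY 2 0)]
  rfl

/-- The only factor with a negative power of x is 1 + z⁻¹q = 1 + x⁻¹y; multiplied by x it becomes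
the symmetric x + y. -/
theorem laurentXY_thetaNum (M : ℕ) : laurentXY (thetaNum M) = laurentMonoXY 1 0 *
    ((∏ i ∈ Finset.range M, (1 + laurentMonoXY (2 * 1 + (1 + 2 * i : ℕ)) (1 + 2 * i))) *
      ∏ i ∈ Finset.range (M + 1), (1 + laurentMonoXY (2 * -1 + (1 + 2 * i : ℕ)) (1 + 2 * i))) := by
  have h0 : laurentMonoXY 1 0 * (1 + laurentMonoXY (-1) 1) =
      laurentMonoXY 1 0 + laurentMonoXY 0 1 := by
    rw [mul_add, mul_one, laurentMonoXY_mul]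
    rfl
  rw [Finset.prod_range_succ']
  simp only [thetaNum, map_mul, map_prod, map_add, map_one, laurentXY_monoXY]
  have h1 : ∀ i : ℕ, laurentMonoXY (2 * -1 + (1 + 2 * (i + 1) : ℕ)) (1 + 2 * (i + 1)) =
      laurentMonoXY (2 * i + 1 : ℕ) (2 * i + 3) := by
    exact fun i => congrArg₂ _ (by push_cast; ring) (by ring)
  have h2 : ∀ i : ℕ, laurentMonoXY (2 * 1 + (1 + 2 * i : ℕ)) (1 + 2 * i) =
      laurentMonoXY (2 * i + 3 : ℕ) (2 * i + 1) := by
    exact fun i => congrArg₂ _ (by push_cast; ring) (by ring)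
  simp only [h1, h2]
  rw [show (2 * -1 + (1 + 2 * 0 : ℕ) : ℤ) = -1 by norm_num, show 1 + 2 * 0 = 1 by norm_num,
    Nat.cast_one, Nat.cast_zero, ← h0]
  ring

theorem cubeKernel_mul_laurent : PowerSeries.C (HahnSeries.ofPowerSeries ℤ ℂ cubeKernel) *
    (1 - laurentMonoXY 2 0) ^ 3 = 1 := by
  have h := congrArg (HahnSeries.ofPowerSeries ℤ ℂ) cubeKernel_mul
  rw [map_mul, map_pow, map_sub, map_one, HahnSeries.ofPowerSeries_X_pow] at h
  have h2 := congrArg (PowerSeries.C (R := LaurentSeries ℂ)) h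
  rw [map_mul, map_pow, map_sub, map_one] at h2
  rw [laurentMonoXY, pow_zero, mul_one]
  exact h2

/-- After the substitution, x(1-z)⁻³ times the theta series is, modulo y^M, a series in xy times a
symmetric numerator over the cube of a symmetric denominator. The latter is a unit among double
power series, so the quotient G is an ordinary, symmetric double power series. The monomial z^m q^n
becomes x^{2m+n+1}y^n, the 1 coming from the factor x. -/
theorem exists_symmetric_expansion (M : ℕ) : ∃ G : ℂ⟦X⟧⟦X⟧, swapXY G = G ∧ ∀ n < M, ∀ m : ℤ,
    cubeSum (PowerSeries.coeff n thetaSeries) m =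
      (HahnSeries.ofPowerSeries ℤ ℂ (PowerSeries.coeff n G)).coeff (2 * m + n + 1) := by
  obtain ⟨f, hf⟩ := exists_thetaSeries_mul
  obtain ⟨u, hu⟩ := (isUnit_thetaDen M).pow 3
  have hG : thetaDen M ^ 3 * (↑u⁻¹ * (diagXY f * thetaNum M)) = diagXY f * thetaNum M := by
    rw [← hu, Units.mul_inv_cancel_left]
  generalize (↑u⁻¹ * (diagXY f * thetaNum M) : ℂ⟦X⟧⟦X⟧) = G at hG
  refine ⟨G, ?_, ?_⟩
  · have h := congrArg swapXY hG
    rw [map_mul, map_pow, map_mul, swapXY_thetaDen, swapXY_diagXY, swapXY_thetaNum, ← hG] at h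
    exact ((isUnit_thetaDen M).pow 3).mul_left_cancel h
  -- Both sides are compared after multiplication by the unit `thetaDen M ^ 3`, where the kernel
  -- cancels (1 - x²)³.
  have hmod : modX _ M (laurentMonoXY 1 0 * PowerSeries.C (HahnSeries.ofPowerSeries ℤ ℂ cubeKernel) *
      zqToXY thetaSeries) = modX _ M (laurentXY G) := by
    have h1 := congrArg (fun F => modX _ M (zqToXY F)) hf
    simp only [map_mul, map_pow] at h1
    rw [modX_zqToXY_qPoch 1 (le_refl M) (by norm_num),
      modX_zqToXY_qPoch (-1) (Nat.le_succ M) (by norm_num),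
      modX_zqToXY_qPoch_neg 1 (le_refl M) (by norm_num) (by norm_num),
      modX_zqToXY_qPoch_neg (-1) (Nat.le_succ M) (by norm_num) (by norm_num), zqToXY_constZ,
      ← map_mul, ← map_mul (modX _ M), ← map_pow, ← map_mul, ← map_mul] at h1
    have h2 := congrArg (fun F => modX _ M (laurentXY F)) hG
    simp only [map_mul, map_pow] at h2
    have hunit : IsUnit (modX _ M (laurentXY (thetaDen M)) ^ 3) :=
      (((isUnit_thetaDen M).map laurentXY).map (modX _ M)).pow 3
    refine hunit.mul_left_cancel ?_
    rw [h2, ← map_pow, ← map_mul, ← map_mul, laurentXY_thetaDen, laurentXY_thetaNum]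
    have h3 := congrArg (modX _ M (laurentMonoXY 1 0) * ·) h1
    simp only [← map_mul] at h3
    refine Eq.trans (congrArg _ ?_) (h3.trans (congrArg _ ?_))
    · linear_combination (laurentMonoXY 1 0 * zqToXY thetaSeries *
        ((∏ i ∈ Finset.range M, (1 - laurentMonoXY (2 * 1 + (2 + 2 * i : ℕ)) (2 + 2 * i))) *
        ∏ i ∈ Finset.range (M + 1), (1 - laurentMonoXY (2 * -1 + (2 + 2 * i : ℕ)) (2 + 2 * i))) ^ 3) *
        cubeKernel_mul_laurent
    · ring
  intro n hn m
  have h := congrArg (HahnSeries.coeff · (2 * m + n + 1)) (modX_eq_iff.1 hmod n hn)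
  simp only [laurentXY, PowerSeries.coeff_map] at h
  rw [← h, laurentMonoXY, pow_zero, mul_one, ← map_mul, PowerSeries.coeff_C_mul, coeff_zqToXY,
    mul_mul_mul_comm, mul_comm (HahnSeries.ofPowerSeries ℤ ℂ cubeKernel), HahnSeries.single_mul_single,
    one_mul, HahnSeries.coeff_single_mul, one_mul, cubeSum]
  congr 1
  ring

/-- `cubeSum` of the coefficients of the theta series, extended by zero to negative exponents. -/
def thetaSum (m n : ℤ) : ℂ :=
  if n < 0 then 0 else cubeSum (PowerSeries.coeff n.toNat thetaSeries) m

/-- The exponents (2m+n+1, n) of x and y are exchanged. When one of them is negative both sides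
vanish, since G has no negative powers. -/
theorem thetaSum_symm (m n : ℤ) : thetaSum m n = thetaSum (-1 - m) (n + 2 * m + 1) := by
  obtain ⟨G, hG, h⟩ := exists_symmetric_expansion (n.toNat + (n + 2 * m + 1).toNat + 1)
  rw [thetaSum, thetaSum]
  split_ifs with h1 h2 h2
  · rfl
  · rw [h _ (by omega), PowerSeries.coeff_coe, if_pos (by omega)]
  · rw [h _ (by omega), PowerSeries.coeff_coe, if_pos (by omega)]
  · rw [h _ (by omega), h _ (by omega), PowerSeries.coeff_coe, PowerSeries.coeff_coe,
      if_neg (by omega), if_neg (by omega),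
      show (2 * m + (n.toNat : ℤ) + 1).natAbs = (n + 2 * m + 1).toNat by omega,
      show (2 * (-1 - m) + ((n + 2 * m + 1).toNat : ℤ) + 1).natAbs = n.toNat by omega]
    conv_lhs => rw [← hG, coeff_swapXY]

/-! ### The rank-crank identity -/

/-- The coefficients `C(i + 2, 2)` of `(1 - z)⁻³`. -/
def cubeWeight (i : ℤ) : ℂ := if 0 ≤ i then (i + 1) * (i + 2) / 2 else 0

/-- The polynomial (i+1)(i+2)/2 is invariant under i ↦ -3-i. Exactly one of i, -3-i is nonnegative,
except for i = -1, -2, where the polynomial is zero. -/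
theorem cubeWeight_add_cubeWeight (i : ℤ) :
    cubeWeight i + cubeWeight (-3 - i) = (i + 1) * (i + 2) / 2 := by
  rw [cubeWeight, cubeWeight]
  split_ifs with h1 h2 h2
  · omega
  · rw [add_zero]
  · push_cast
    ring
  · obtain rfl | rfl : i = -1 ∨ i = -2 := by omega
    all_goals norm_num

theorem cubeWeight_thirdDifference (i : ℤ) :
    cubeWeight i - 3 * cubeWeight (i - 1) + 3 * cubeWeight (i - 2) - cubeWeight (i - 3) =
      if i = 0 then 1 else 0 := by
  rcases lt_or_ge i 3 with h | h
  · rcases lt_or_ge i 0 with h0 | h0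
    · simp only [cubeWeight]
      rw [if_neg (by omega), if_neg (by omega), if_neg (by omega), if_neg (by omega),
        if_neg (by omega)]
      norm_num
    · obtain rfl | rfl | rfl : i = 0 ∨ i = 1 ∨ i = 2 := by omega
      all_goals norm_num [cubeWeight]
  · simp only [cubeWeight]
    rw [if_pos (by omega), if_pos (by omega), if_pos (by omega), if_pos (by omega),
      if_neg (by omega)]
    push_cast
    ring

theorem cubeSum_eq_sum (f : ℂ[T;T⁻¹]) (m : ℤ) :
    cubeSum f m = ∑ j ∈ f.coeff.support, f.coeff j * cubeWeight (m - j) := by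
  rw [cubeSum_eq_finsum, finsum_eq_sum_of_support_subset (s := f.coeff.support)]
  · simp only [cubeWeight, Int.cast_sub]
  · intro j hj
    rw [Finset.mem_coe, Finsupp.mem_support_iff]
    exact left_ne_zero_of_mul hj

theorem cubeSum_thirdDifference (f : ℂ[T;T⁻¹]) (m : ℤ) :
    cubeSum f m - 3 * cubeSum f (m - 1) + 3 * cubeSum f (m - 2) - cubeSum f (m - 3) =
      f.coeff m := by
  simp only [cubeSum_eq_sum, Finset.mul_sum, ← Finset.sum_sub_distrib, ← Finset.sum_add_distrib]
  have h : ∀ j, f.coeff j * cubeWeight (m - j) - 3 * (f.coeff j * cubeWeight (m - 1 - j)) +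
      3 * (f.coeff j * cubeWeight (m - 2 - j)) - f.coeff j * cubeWeight (m - 3 - j) =
      if j = m then f.coeff j else 0 := by
    intro j
    have h1 := cubeWeight_thirdDifference (m - j)
    rw [show m - j - 1 = m - 1 - j by ring, show m - j - 2 = m - 2 - j by ring,
      show m - j - 3 = m - 3 - j by ring] at h1
    have h2 : (if j = m then f.coeff j else 0) = f.coeff j * (if m - j = 0 then 1 else 0) := by
      split_ifs <;> first | omega | simp
    rw [h2, ← h1]
    ring
  simp only [h]
  rw [Finset.sum_ite_eq' f.coeff.support m]
  split_ifs with hm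
  · rfl
  · rw [Finsupp.notMem_support_iff.1 hm]

theorem coeff_moment_eq_sum (F : ℂ[T;T⁻¹]⟦X⟧) (k n : ℕ) : PowerSeries.coeff n (moment F k) =
    ∑ j ∈ (PowerSeries.coeff n F).coeff.support, (PowerSeries.coeff n F).coeff j * (j : ℂ) ^ k := by
  rw [← momentSeries_zqCoeff, momentSeries, PowerSeries.coeff_mk,
    finsum_eq_sum_of_support_subset (s := (PowerSeries.coeff n F).coeff.support)]
  · exact Finset.sum_congr rfl fun j _ => mul_comm _ _
  · intro j hj
    rw [Finset.mem_coe, Finsupp.mem_support_iff]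
    exact right_ne_zero_of_mul hj

/-- By evenness in z, the two sums combine through `cubeWeight_add_cubeWeight` into a sum against a
quadratic polynomial in j. Only the moments of order 0, 1, 2 enter, namely P, 0 and 2δ_q P, with P
the prefactor. -/
theorem thetaSum_add (m n : ℤ) : thetaSum m n + thetaSum (-3 - m) n =
    (n + (m + 1) * (m + 2) / 2) * (oddDistinctFinset n).card := by
  rcases lt_or_ge n 0 with hn | hn
  · have : oddDistinctFinset n = ∅ := by
      rw [Finset.eq_empty_iff_forall_notMem]
      intro μ hμ
      have := (mem_oddDistinctFinset.1 hμ).2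
      omega
    simp [thetaSum, hn, this]
  lift n to ℕ using hn
  rw [thetaSum, thetaSum, if_neg (by omega), if_neg (by omega), Int.toNat_natCast]
  have hsymm : ∀ j, (PowerSeries.coeff n thetaSeries).coeff (-j) =
      (PowerSeries.coeff n thetaSeries).coeff j := fun j => zqCoeff_thetaSeries_neg j n
  have h0 := congrArg (PowerSeries.coeff n) (moment_thetaSeries 0)
  have h1 := congrArg (PowerSeries.coeff n) (moment_thetaSeries 1)
  have h2 := congrArg (PowerSeries.coeff n) (moment_thetaSeries 2)
  rw [coeff_moment_eq_sum, moment_zero, map_evalOne_thetaQuotient, mul_one, coeff_prefactor] at h0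
  rw [coeff_moment_eq_sum, moment_thetaQuotient_one, mul_zero, map_zero] at h1
  rw [coeff_moment_eq_sum, moment_thetaQuotient_two, mul_smul_comm, ← deltaQ_prefactor,
    PowerSeries.coeff_smul, coeff_deltaQ, coeff_prefactor, smul_eq_mul] at h2
  rw [cubeSum_eq_sum, cubeSum_eq_sum]
  generalize PowerSeries.coeff n thetaSeries = f at *
  have hneg : ∑ j ∈ f.coeff.support, f.coeff j * cubeWeight (-3 - m - j) =
      ∑ j ∈ f.coeff.support, f.coeff j * cubeWeight (-3 - (m - j)) := by
    refine Finset.sum_nbij' (fun j => -j) (fun j => -j) ?_ ?_ ?_ ?_ ?_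
    · intro j hj
      rw [Finsupp.mem_support_iff] at hj ⊢
      rwa [hsymm]
    · intro j hj
      rw [Finsupp.mem_support_iff] at hj ⊢
      rwa [hsymm]
    · exact fun j _ => neg_neg j
    · exact fun j _ => neg_neg j
    · intro j _
      rw [hsymm]
      congr 2
      ring
  rw [hneg, ← Finset.sum_add_distrib]
  simp only [← mul_add, cubeWeight_add_cubeWeight]
  have key : ∀ j : ℤ, f.coeff j * ((((m - j : ℤ) : ℂ) + 1) * (((m - j : ℤ) : ℂ) + 2) / 2) =
      ((m + 1) * (m + 2) / 2 : ℂ) * (f.coeff j * (j : ℂ) ^ 0) -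
        ((2 * m + 3) / 2 : ℂ) * (f.coeff j * (j : ℂ) ^ 1) + (1 / 2 : ℂ) * (f.coeff j * (j : ℂ) ^ 2) := by
    intro j
    push_cast
    ring
  simp only [key, Finset.sum_add_distrib, Finset.sum_sub_distrib, ← Finset.mul_sum]
  rw [h0, h1, h2]
  push_cast
  ring

/-- The number of partitions of `n` without repeated odd parts and with `M₂`-rank at most `m + 1`,
with the weight `n + (m + 1)(m + 2)/2`. -/
def weightedRankSum (m n : ℤ) : ℂ := (n + (m + 1) * (m + 2) / 2) * numRankLE (m + 1) n

/-- The weight is invariant under m ↦ -3-m, and by symmetry of the rank the two counts are those of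
complementary sets of partitions. -/
theorem weightedRankSum_add (m n : ℤ) : weightedRankSum m n + weightedRankSum (-3 - m) n =
    (n + (m + 1) * (m + 2) / 2) * (oddDistinctFinset n).card := by
  have h1 := numRankLE_neg (m + 2) n
  have h2 := numRankLE_add_numRankGE (m + 1) n
  rw [show m + 1 + 1 = m + 2 by ring, ← h1] at h2
  have h3 := congrArg (Int.cast (R := ℂ)) h2
  rw [Int.cast_natCast, Int.cast_add] at h3
  rw [weightedRankSum, weightedRankSum, show -3 - m + 1 = -(m + 2) by ring, ← h3]
  push_cast
  ring

/-- The weight takes the same value at (m, n) and (-1-m, n+2m+1), and it is zero at the two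
exceptional pairs (-1, 0) and (0, -1), so the corrections for the empty partition do no harm. -/
theorem weightedRankSum_symm (m n : ℤ) :
    weightedRankSum m n = weightedRankSum (-1 - m) (n + 2 * m + 1) := by
  have h1 := numRankLE_neg m (n + 2 * m + 1)
  have h2 := numRankLE_eq m n
  have h3 := numRankGE_eq m n
  rw [weightedRankSum, weightedRankSum, show -1 - m + 1 = -m by ring, h1, h2, h3]
  split_ifs with h h' h'
  · omega
  · obtain ⟨rfl, rfl⟩ := h
    push_cast
    ring
  · obtain ⟨rfl, rfl⟩ := h'
    push_cast
    ring
  · push_cast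
    ring

/-- Both sides obey the same reflection and the same invariance. Their difference therefore changes
sign under (m, n) ↦ (m+2, n-2m-5), which lowers n when m ≥ -2; it vanishes for negative n. The range
m ≤ -2 follows by reflection. -/
theorem weightedRankSum_eq_thetaSum (m n : ℤ) : weightedRankSum m n = thetaSum m n := by
  have h1 : ∀ m n, weightedRankSum m n - thetaSum m n =
      -(weightedRankSum (-3 - m) n - thetaSum (-3 - m) n) := by
    intro m n
    linear_combination weightedRankSum_add m n - thetaSum_add m n
  have h2 : ∀ m n, weightedRankSum m n - thetaSum m n =
      -(weightedRankSum (m + 2) (n - 2 * m - 5) - thetaSum (m + 2) (n - 2 * m - 5)) := by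
    intro m n
    rw [h1, weightedRankSum_symm, thetaSum_symm, show -1 - (-3 - m) = m + 2 by ring,
      show n + 2 * (-3 - m) + 1 = n - 2 * m - 5 by ring]
  have h3 : ∀ (k : ℕ) (m n : ℤ), n < k → -2 ≤ m → weightedRankSum m n - thetaSum m n = 0 := by
    intro k
    induction k with
    | zero =>
      intro m n hn _
      rw [weightedRankSum, numRankLE_of_neg (by omega), thetaSum, if_pos (by omega)]
      simp
    | succ k ih =>
      intro m n hn hm
      rw [h2, ih _ _ (by push_cast at hn; omega) (by omega), neg_zero]
  rw [← sub_eq_zero]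
  rcases le_total (-2) m with hm | hm
  · exact h3 (n.toNat + 1) m n (by omega) hm
  · rw [h1, h3 (n.toNat + 1) _ n (by omega) (by omega), neg_zero]

/-- The differential equation relating the `M₂`-rank to the theta quotient. -/
theorem zqCoeff_thetaSeries (m : ℤ) (n : ℕ) : zqCoeff thetaSeries m n =
    (n + (m + 1) * (m + 2) / 2) * numRank (m + 1) n + (1 - m ^ 2 - 2 * n) * numRank m n +
      (n + (m - 2) * (m - 1) / 2) * numRank (m - 1) n := by
  -- Multiplying back by (1-z)³ is a third difference in m. The cumulative counts then regroup into
  -- three consecutive values of `numRank`.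
  have h := cubeSum_thirdDifference (PowerSeries.coeff n thetaSeries) m
  have h1 : ∀ m, cubeSum (PowerSeries.coeff n thetaSeries) m = weightedRankSum m n := by
    intro m
    rw [weightedRankSum_eq_thetaSum, thetaSum, if_neg (by omega), Int.toNat_natCast]
  simp only [h1, weightedRankSum] at h
  rw [show m - 1 + 1 = m by ring, show m - 2 + 1 = m - 1 by ring,
    show m - 3 + 1 = m - 1 - 1 by ring] at h
  rw [numRank_eq_sub, numRank_eq_sub, numRank_eq_sub, show m + 1 - 1 = m by ring]
  rw [zqCoeff, ← h]
  push_cast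
  ring

/-! ### Moments of the rank -/

theorem coeff_moment_T_mul (e : ℤ) (F : ℂ[T;T⁻¹]⟦X⟧) (k n : ℕ) :
    PowerSeries.coeff n (moment (PowerSeries.C (LaurentPolynomial.T e) * F) k) =
      ∑ᶠ m : ℤ, ((m : ℂ) + e) ^ k * zqCoeff F m n := by
  rw [← momentSeries_zqCoeff, momentSeries, PowerSeries.coeff_mk,
    ← finsum_comp_equiv (Equiv.addRight e)]
  refine finsum_congr fun m => ?_
  rw [Equiv.coe_addRight, Int.cast_add, zqCoeff, PowerSeries.coeff_C_mul, LaurentPolynomial.T]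
  congr 1
  dsimp only
  rw [add_comm m e, AddMonoidAlgebra.coeff_single_mul_apply, neg_add_cancel_left, one_mul]
  rfl

/-- The two-variable series `(z + z⁻¹) h(z, q)`, for the theta quotient `h`. -/
def shiftedThetaQuotient : ℂ[T;T⁻¹]⟦X⟧ :=
  (PowerSeries.C (LaurentPolynomial.T 1) + PowerSeries.C (LaurentPolynomial.T (-1))) * thetaQuotient

theorem coeff_prefactor_mul_moment (k n : ℕ) :
    PowerSeries.coeff n (prefactor * moment shiftedThetaQuotient k) =
      ∑ᶠ m : ℤ, (((m : ℂ) + 1) ^ k + ((m : ℂ) - 1) ^ k) * zqCoeff thetaSeries m n := by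
  have hfin : ∀ u : ℤ → ℂ, (Function.support fun m => u m * zqCoeff thetaSeries m n).Finite :=
    fun u => (zqCoeff_support_finite thetaSeries n).subset fun m hm => right_ne_zero_of_mul hm
  have h : constZ prefactor * shiftedThetaQuotient =
      PowerSeries.C (LaurentPolynomial.T 1) * thetaSeries +
        PowerSeries.C (LaurentPolynomial.T (-1)) * thetaSeries := by
    rw [shiftedThetaQuotient, thetaSeries]
    ring
  rw [← moment_constZ_mul, h, moment_add, map_add, coeff_moment_T_mul, coeff_moment_T_mul,
    ← finsum_add_distrib (hfin _) (hfin _)]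
  refine finsum_congr fun m => ?_
  rw [← add_mul, Int.cast_one, Int.cast_neg, Int.cast_one, ← sub_eq_add_neg]

/-- The differential equation is inserted and the three shifted counts are summed over partitions;
the shift in the rank moves to the polynomial weights, by summation by parts. -/
theorem coeff_prefactor_mul_moment_eq_sum (k n : ℕ) :
    PowerSeries.coeff n (prefactor * moment shiftedThetaQuotient k) =
      ∑ μ ∈ oddDistinctFinset n,
        ((n + (msRank μ : ℂ) * (msRank μ + 1) / 2) * ((msRank μ : ℂ) ^ k + (msRank μ - 2) ^ k) +
        (1 - (msRank μ : ℂ) ^ 2 - 2 * n) * ((msRank μ + 1 : ℂ) ^ k + (msRank μ - 1) ^ k) +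
        (n + (msRank μ - 1 : ℂ) * msRank μ / 2) * ((msRank μ + 2 : ℂ) ^ k + (msRank μ : ℂ) ^ k)) := by
  let w : ℤ → ℂ := fun m => ((m : ℂ) + 1) ^ k + ((m : ℂ) - 1) ^ k
  let u1 : ℤ → ℂ := fun m => w m * (n + (m + 1) * (m + 2) / 2)
  let u2 : ℤ → ℂ := fun m => w m * (1 - m ^ 2 - 2 * n)
  let u3 : ℤ → ℂ := fun m => w m * (n + (m - 2) * (m - 1) / 2)
  have h : ∀ m : ℤ, (((m : ℂ) + 1) ^ k + ((m : ℂ) - 1) ^ k) * zqCoeff thetaSeries m n =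
      u1 m * numRank (m + 1) n + u2 m * numRank (m + 0) n + u3 m * numRank (m + -1) n := by
    intro m
    rw [zqCoeff_thetaSeries, add_zero, ← sub_eq_add_neg]
    simp only [u1, u2, u3, w]
    ring
  rw [coeff_prefactor_mul_moment]
  simp only [h]
  rw [finsum_add_distrib ?_ (support_numRank_finite _ _ _), finsum_add_distrib
    (support_numRank_finite _ _ _) (support_numRank_finite _ _ _), finsum_numRank, finsum_numRank,
    finsum_numRank, ← Finset.sum_add_distrib, ← Finset.sum_add_distrib]
  · refine Finset.sum_congr rfl fun μ _ => ?_
    simp only [u1, u2, u3, w]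
    push_cast
    ring_nf
  · exact ((support_numRank_finite u1 1 n).union (support_numRank_finite u2 0 n)).subset
      (Function.support_add _ _)

/-! ### Binomial sums -/

theorem sum_range_even_odd (f : ℕ → ℂ) (N : ℕ) : ∑ j ∈ Finset.range (2 * N + 1), f j =
    ∑ k ∈ Finset.range (N + 1), f (2 * k) + ∑ k ∈ Finset.range N, f (2 * k + 1) := by
  induction N with
  | zero => simp
  | succ N ih =>
    rw [show 2 * (N + 1) + 1 = 2 * N + 1 + 1 + 1 by ring, Finset.sum_range_succ,
      Finset.sum_range_succ, ih, Finset.sum_range_succ (fun k => f (2 * k)) (N + 1),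
      Finset.sum_range_succ (fun k => f (2 * k + 1)), show 2 * (N + 1) = 2 * N + 1 + 1 by ring]
    ring

theorem add_pow_even (r x : ℂ) (N : ℕ) : (r + x) ^ (2 * N) =
    ∑ k ∈ Finset.range (N + 1), (2 * N).choose (2 * k) * x ^ (2 * k) * r ^ (2 * N - 2 * k) +
      ∑ k ∈ Finset.range N, (2 * N).choose (2 * k + 1) * x ^ (2 * k + 1) *
        r ^ (2 * N - (2 * k + 1)) := by
  rw [add_comm r x, add_pow, sum_range_even_odd]
  congr 1
  · exact Finset.sum_congr rfl fun k _ => by ring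
  · exact Finset.sum_congr rfl fun k _ => by ring

theorem add_pow_add_sub_pow (r x : ℂ) (N : ℕ) : (r + x) ^ (2 * N) + (r - x) ^ (2 * N) =
    2 * ∑ k ∈ Finset.range (N + 1), (2 * N).choose (2 * k) * x ^ (2 * k) * r ^ (2 * N - 2 * k) := by
  rw [sub_eq_add_neg, add_pow_even, add_pow_even]
  simp only [pow_succ (-x) (2 * _), pow_succ x (2 * _), pow_mul (-x), neg_sq, ← pow_mul, mul_neg,
    neg_mul, Finset.sum_neg_distrib]
  ring

theorem add_pow_sub_sub_pow (r x : ℂ) (N : ℕ) : (r + x) ^ (2 * N) - (r - x) ^ (2 * N) =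
    2 * ∑ k ∈ Finset.range N, (2 * N).choose (2 * k + 1) * x ^ (2 * k + 1) *
      r ^ (2 * N - (2 * k + 1)) := by
  rw [sub_eq_add_neg r x, add_pow_even, add_pow_even]
  simp only [pow_succ (-x) (2 * _), pow_succ x (2 * _), pow_mul (-x), neg_sq, ← pow_mul, mul_neg,
    neg_mul, Finset.sum_neg_distrib]
  ring

theorem sum_Icc_one (f : ℕ → ℂ) (M : ℕ) :
    ∑ k ∈ Finset.Icc 1 M, f k = ∑ k ∈ Finset.range M, f (k + 1) := by
  rw [Finset.range_eq_Ico, Finset.sum_Ico_add' f 0 M 1]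
  rfl

/-- The contribution of a single partition of n with rank r, for a = 2(M+1). The right side is
regrouped as (n + r²/2) times a second-difference combination of r^a, plus (r/2)((r+2)^a - (r-2)^a),
plus (r+1)^a + (r-1)^a, minus the two final terms; each piece is expanded binomially. -/
theorem rank_polynomial_identity (n r : ℂ) (M : ℕ) :
    (((2 * (M + 1) : ℕ) : ℂ) ^ 2 - 3 * ((2 * (M + 1) : ℕ) : ℂ) + 2) * r ^ (2 * (M + 1)) +
      ∑ k ∈ Finset.Icc 1 M, ((2 * (M + 1)).choose (2 * k) * (2 ^ (2 * k + 1) - 4)) *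
        (n * r ^ (2 * (M + 1) - 2 * k)) +
      ∑ k ∈ Finset.Icc 1 M, (2 * ((2 * (M + 1)).choose (2 * k) : ℂ) -
        2 ^ (2 * k + 1) * ((2 * (M + 1)).choose (2 * k + 1) : ℂ) +
        (2 ^ (2 * k + 2) - 2) * ((2 * (M + 1)).choose (2 * k + 2) : ℂ)) *
          r ^ (2 * (M + 1) - 2 * k) =
    (n + r * (r + 1) / 2) * (r ^ (2 * (M + 1)) + (r - 2) ^ (2 * (M + 1))) +
      (1 - r ^ 2 - 2 * n) * ((r + 1) ^ (2 * (M + 1)) + (r - 1) ^ (2 * (M + 1))) +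
      (n + (r - 1) * r / 2) * ((r + 2) ^ (2 * (M + 1)) + r ^ (2 * (M + 1))) -
      (2 ^ (2 * (M + 1) + 1) - 4) * n - 2 := by
  have s2 := add_pow_add_sub_pow r 2 (M + 1)
  have s1 := add_pow_add_sub_pow r 1 (M + 1)
  have d2 := add_pow_sub_sub_pow r 2 (M + 1)
  set a := 2 * (M + 1) with ha
  -- The r^a terms cancel (2 + 2 - 4 = 0), so no δ_q of the a-th moment appears. The index k = a/2
  -- gives the constant 2^{a+1} - 4.
  have hA : 2 * r ^ a + ((r + 2) ^ a + (r - 2) ^ a) - 2 * ((r + 1) ^ a + (r - 1) ^ a) =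
      ∑ k ∈ Finset.Icc 1 M, (a.choose (2 * k) * (2 ^ (2 * k + 1) - 4)) * r ^ (a - 2 * k) +
        (2 ^ (a + 1) - 4) := by
    rw [s2, s1, sum_Icc_one, Finset.sum_range_succ', Finset.sum_range_succ,
      Finset.sum_range_succ' (fun k => (a.choose (2 * k) : ℂ) * 1 ^ (2 * k) * r ^ (a - 2 * k)),
      Finset.sum_range_succ (fun k => (a.choose (2 * (k + 1)) : ℂ) * 1 ^ (2 * (k + 1)) *
        r ^ (a - 2 * (k + 1))), ← ha]
    simp only [one_pow, Nat.choose_self, Nat.sub_self, mul_zero, Nat.choose_zero_right, pow_zero,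
      Nat.sub_zero, mul_one, Nat.cast_one, one_mul]
    have : ∑ k ∈ Finset.range M, (a.choose (2 * (k + 1)) * (2 ^ (2 * (k + 1) + 1) - 4)) *
        r ^ (a - 2 * (k + 1)) =
        2 * ∑ k ∈ Finset.range M, (a.choose (2 * (k + 1)) : ℂ) * 2 ^ (2 * (k + 1)) *
          r ^ (a - 2 * (k + 1)) -
        4 * ∑ k ∈ Finset.range M, (a.choose (2 * (k + 1)) : ℂ) * r ^ (a - 2 * (k + 1)) := by
      rw [Finset.mul_sum, Finset.mul_sum, ← Finset.sum_sub_distrib]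
      exact Finset.sum_congr rfl fun k _ => by ring
    rw [this]
    ring
  -- The factor r² shifts the summation index by one, which produces the binomials with lower entry
  -- 2k + 2.
  have hB : r ^ 2 / 2 * (2 * r ^ a + ((r + 2) ^ a + (r - 2) ^ a) -
      2 * ((r + 1) ^ a + (r - 1) ^ a)) = ∑ k ∈ Finset.range (M + 1),
        ((2 ^ (2 * k + 2) - 2) * (a.choose (2 * k + 2) : ℂ)) * r ^ (a - 2 * k) := by
    rw [hA, sum_Icc_one, Finset.sum_range_succ, mul_add, Finset.mul_sum]
    congr 1
    · refine Finset.sum_congr rfl fun k hk => ?_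
      rw [Finset.mem_range] at hk
      rw [show a - 2 * k = a - 2 * (k + 1) + 2 by omega, show 2 * (k + 1) = 2 * k + 2 by ring]
      ring
    · rw [show a - 2 * M = 2 by omega, show 2 * M + 2 = a by omega, Nat.choose_self]
      push_cast
      ring
  have hC : r / 2 * ((r + 2) ^ a - (r - 2) ^ a) = ∑ k ∈ Finset.range (M + 1),
      (2 ^ (2 * k + 1) * (a.choose (2 * k + 1) : ℂ)) * r ^ (a - 2 * k) := by
    rw [d2, ← mul_assoc, Finset.mul_sum]
    refine Finset.sum_congr rfl fun k hk => ?_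
    rw [Finset.mem_range] at hk
    rw [show a - 2 * k = a - (2 * k + 1) + 1 by omega]
    ring
  have hD : (r + 1) ^ a + (r - 1) ^ a = ∑ k ∈ Finset.range (M + 1),
      (2 * (a.choose (2 * k) : ℂ)) * r ^ (a - 2 * k) + 2 := by
    rw [s1, Finset.sum_range_succ, ← ha, mul_add, Finset.mul_sum]
    simp only [one_pow, mul_one, Nat.choose_self, Nat.sub_self, pow_zero, Nat.cast_one]
    congr 1
    exact Finset.sum_congr rfl fun k _ => by ring
  -- The leading coefficient is the term k = 0 of the same family: 2 - 2a + 2·a(a-1)/2 = a² - 3a +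
  -- 2.
  have hE : ((a : ℂ) ^ 2 - 3 * (a : ℂ) + 2) * r ^ a +
      ∑ k ∈ Finset.Icc 1 M, (2 * (a.choose (2 * k) : ℂ) -
        2 ^ (2 * k + 1) * (a.choose (2 * k + 1) : ℂ) +
        (2 ^ (2 * k + 2) - 2) * (a.choose (2 * k + 2) : ℂ)) * r ^ (a - 2 * k) =
      ∑ k ∈ Finset.range (M + 1), (2 * (a.choose (2 * k) : ℂ) -
        2 ^ (2 * k + 1) * (a.choose (2 * k + 1) : ℂ) +
        (2 ^ (2 * k + 2) - 2) * (a.choose (2 * k + 2) : ℂ)) * r ^ (a - 2 * k) := by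
    rw [sum_Icc_one, Finset.sum_range_succ', add_comm]
    congr 1
    simp only [mul_zero, zero_add, Nat.choose_zero_right, Nat.choose_one_right, Nat.sub_zero,
      Nat.cast_choose_two]
    push_cast
    ring
  have hF : ∑ k ∈ Finset.range (M + 1), (2 * (a.choose (2 * k) : ℂ) -
        2 ^ (2 * k + 1) * (a.choose (2 * k + 1) : ℂ) +
        (2 ^ (2 * k + 2) - 2) * (a.choose (2 * k + 2) : ℂ)) * r ^ (a - 2 * k) =
      ∑ k ∈ Finset.range (M + 1), (2 * (a.choose (2 * k) : ℂ)) * r ^ (a - 2 * k) -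
      ∑ k ∈ Finset.range (M + 1), (2 ^ (2 * k + 1) * (a.choose (2 * k + 1) : ℂ)) * r ^ (a - 2 * k) +
      ∑ k ∈ Finset.range (M + 1),
        ((2 ^ (2 * k + 2) - 2) * (a.choose (2 * k + 2) : ℂ)) * r ^ (a - 2 * k) := by
    rw [← Finset.sum_sub_distrib, ← Finset.sum_add_distrib]
    exact Finset.sum_congr rfl fun k _ => by ring
  have hG : ∑ k ∈ Finset.Icc 1 M, (a.choose (2 * k) * (2 ^ (2 * k + 1) - 4)) *
        (n * r ^ (a - 2 * k)) =
      n * ∑ k ∈ Finset.Icc 1 M, (a.choose (2 * k) * (2 ^ (2 * k + 1) - 4)) * r ^ (a - 2 * k) := by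
    rw [Finset.mul_sum]
    exact Finset.sum_congr rfl fun k _ => by ring
  rw [hG]
  linear_combination hE + hF - hB + hC - hD - n * hA

/-! ### The combination of rank moments -/

/-- Summation of `rank_polynomial_identity` over the partitions of n. With P the prefactor, the
leftover term proportional to n sums to a multiple of δ_q P, and the leftover 2 sums to 2P. -/
theorem rank_moments_eq (M : ℕ) :
    (((2 * (M + 1) : ℕ) : ℂ) ^ 2 - 3 * ((2 * (M + 1) : ℕ) : ℂ) + 2) • R2Moment (2 * (M + 1)) +
      ∑ k ∈ Finset.Icc 1 M, (((2 * (M + 1)).choose (2 * k) : ℂ) * (2 ^ (2 * k + 1) - 4)) •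
        deltaQ (R2Moment (2 * (M + 1) - 2 * k)) +
      ∑ k ∈ Finset.Icc 1 M, (2 * ((2 * (M + 1)).choose (2 * k) : ℂ) -
        2 ^ (2 * k + 1) * ((2 * (M + 1)).choose (2 * k + 1) : ℂ) +
        (2 ^ (2 * k + 2) - 2) * ((2 * (M + 1)).choose (2 * k + 2) : ℂ)) •
          R2Moment (2 * (M + 1) - 2 * k) =
    prefactor * (moment shiftedThetaQuotient (2 * (M + 1)) -
      ((2 : ℂ) ^ (2 * (M + 1) + 1) - 4) • logDerivPrefactor - (2 : ℂ) • 1) := by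
  ext n
  rw [mul_sub, mul_sub, map_sub, map_sub, coeff_prefactor_mul_moment_eq_sum, mul_smul_comm,
    mul_smul_comm, ← deltaQ_prefactor, mul_one, map_add, map_add, map_sum, map_sum]
  simp only [PowerSeries.coeff_smul, coeff_deltaQ, coeff_R2Moment, coeff_prefactor, smul_eq_mul,
    Finset.mul_sum]
  rw [Finset.sum_comm (s := Finset.Icc 1 M), Finset.sum_comm (s := Finset.Icc 1 M),
    ← Finset.sum_add_distrib, ← Finset.sum_add_distrib]
  simp only [rank_polynomial_identity]
  rw [Finset.sum_sub_distrib, Finset.sum_sub_distrib, Finset.sum_const, Finset.sum_const,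
    nsmul_eq_mul, nsmul_eq_mul]
  ring

theorem quasimodularMoments_shiftedThetaQuotient :
    QuasimodularMoments 0 shiftedThetaQuotient :=
  ((QuasimodularMoments.T 1).add (QuasimodularMoments.T (-1))).mul_weight_zero
    quasimodularMoments_thetaQuotient

theorem coeff_zero_moment_shiftedThetaQuotient (N : ℕ) :
    PowerSeries.coeff 0 (moment shiftedThetaQuotient (2 * N)) = 2 := by
  have h : PowerSeries.coeff 0 shiftedThetaQuotient =
      LaurentPolynomial.T 1 + LaurentPolynomial.T (-1) := by
    rw [PowerSeries.coeff_zero_eq_constantCoeff_apply, shiftedThetaQuotient, map_mul,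
      constantCoeff_thetaQuotient, mul_one, map_add, PowerSeries.constantCoeff_C,
      PowerSeries.constantCoeff_C]
  rw [moment, PowerSeries.coeff_map, coeff_iterate_zDer, h, iterate_map_add, map_add,
    evalOne_iterate_laurentEuler_T, evalOne_iterate_laurentEuler_T]
  push_cast
  rw [pow_mul, pow_mul]
  norm_num

theorem rank_moments_mem {N : ℕ} (hN : 1 ≤ N) :
    prefactor * (moment shiftedThetaQuotient (2 * N) -
      ((2 : ℂ) ^ (2 * N + 1) - 4) • logDerivPrefactor - (2 : ℂ) • 1) ∈ commonSpace N := by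
  refine mem_commonSpace_iff.2 ⟨_, ?_, ?_, rfl⟩
  · refine sub_mem (sub_mem ?_ ?_) ?_
    · simpa using quasimodularMoments_shiftedThetaQuotient (2 * N)
    · exact Submodule.smul_mem _ _ (quasimodularForms_mono (by omega) logDerivPrefactor_mem)
    · exact Submodule.smul_mem _ _ (one_mem_quasimodularForms 4 _)
  -- At q = 0 the shifted quotient is z + z⁻¹, whose even moments equal 2; the subtracted 2 makes
  -- the constant term vanish.
  · rw [map_sub, map_sub, coeff_zero_moment_shiftedThetaQuotient, PowerSeries.coeff_smul,
      coeff_zero_logDerivPrefactor, PowerSeries.coeff_smul, PowerSeries.coeff_zero_one]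
    simp

end M2Crank
end

/-! ### The theorem. -/

theorem theorem1p1 (N : ℕ) (hN : 1 ≤ N) :
    (∀ m j : ℕ, 1 ≤ j → j ≤ N → j + m ≤ N →
      M2Crank.deltaQ^[m] (M2Crank.C1Moment (2 * j)) ∈ M2Crank.commonSpace N) ∧
    (∀ m j : ℕ, 1 ≤ j → j ≤ N → j + m ≤ N →
      M2Crank.deltaQ^[m] (M2Crank.C2Moment (2 * j)) ∈ M2Crank.commonSpace N) ∧
    (∀ m j : ℕ, 1 ≤ j → j ≤ N → j + m ≤ N →
      M2Crank.deltaQ^[m] (M2Crank.C4Moment (2 * j)) ∈ M2Crank.commonSpace N) ∧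
    (∀ a : ℕ, a = 2 * N →
      ((a : ℂ) ^ 2 - 3 * (a : ℂ) + 2) • M2Crank.R2Moment a
        + ∑ k ∈ Finset.Icc 1 (a / 2 - 1),
            ((a.choose (2 * k) : ℂ) * (2 ^ (2 * k + 1) - 4)) •
              M2Crank.deltaQ (M2Crank.R2Moment (a - 2 * k))
        + ∑ k ∈ Finset.Icc 1 (a / 2 - 1),
            (2 * (a.choose (2 * k) : ℂ) - 2 ^ (2 * k + 1) * (a.choose (2 * k + 1) : ℂ)
                + (2 ^ (2 * k + 2) - 2) * (a.choose (2 * k + 2) : ℂ)) •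
              M2Crank.R2Moment (a - 2 * k)
        ∈ M2Crank.commonSpace N) := by
  refine ⟨fun m j hj _ hm => ?_, fun m j hj _ hm => ?_, fun m j hj _ hm => ?_, ?_⟩
  · rw [M2Crank.C1Moment, M2Crank.C1_eq]
    exact M2Crank.iterate_deltaQ_moment_mem hj hm (by norm_num)
  · rw [M2Crank.C2Moment, M2Crank.C2_eq]
    exact M2Crank.iterate_deltaQ_moment_mem hj hm (by norm_num)
  · rw [M2Crank.C4Moment, M2Crank.C4_eq]
    exact M2Crank.iterate_deltaQ_moment_mem hj hm (by norm_num)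
  · rintro a rfl
    obtain ⟨M, rfl⟩ := Nat.exists_eq_succ_of_ne_zero (Nat.one_le_iff_ne_zero.1 hN)
    rw [Nat.mul_div_cancel_left _ two_pos, Nat.succ_eq_add_one, Nat.add_sub_cancel,
      M2Crank.rank_moments_eq]
    exact M2Crank.rank_moments_mem (by omega)
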